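/- Let $\Omega=(a,b)\times(c,d)$, $T>0$, $\epsilon_0,\epsilon_\infty,\mu_0,\tau_0>0$, $\epsilon_s>\epsilon_\infty$, $\alpha\in(0,1)$ and $\theta\in[\frac{\alpha}{2},\frac12]$. For scalar $H$ and vector valued $\boldsymbol E=(E_1,E_2)$ write $\nabla\times H=(\partial_yH,-\partial_xH)$ and $\nabla\times\boldsymbol E=\partial_xE_2-\partial_yE_1$ (weak derivatives). $H(\mathrm{curl};\Omega)$ is the space of $L^2$ fields (vector or scalar) whose curl is in $L^2$, with the graph norm, and $H_0(\mathrm{curl};\Omega)$ is the space of vector fields $\boldsymbol v\in H(\mathrm{curl};\Omega)$ with $\boldsymbol n\times\boldsymbol v=0$ on $\partial\Omega$. $(\cdot,\cdot)$ and $\|\cdot\|$ are the inner product and norm of $L^2(\Omega)$ or $(L^2(\Omega))^2$, and $\partial_t^\alpha u(t)=\frac{1}{\Gamma(1-\alpha)}\int_0^t (t-s)^{-\alpha}u'(s)\,ds$ is the Caputo derivative. Let $\boldsymbol E\in C([0,T];H_0(\mathrm{curl};\Omega))\cap C^3([0,T];(L^2(\Omega))^2)$, $\boldsymbol P\in C^3([0,T];(L^2(\Omega))^2)$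 and $H\in C^3([0,T];H(\mathrm{curl};\Omega))$ satisfy $\boldsymbol P(0)=\boldsymbol 0$ and, for $0<t<T$, the Cole–Cole system with source terms $$\epsilon_0\epsilon_\infty\,\partial_t\boldsymbol E=\nabla\times H-\partial_t\boldsymbol P+\boldsymbol f_1,\qquad \mu_0\,\partial_tH=-\nabla\times\boldsymbol E+f_2,\qquad \tau_0^\alpha\,\partial_t^\alpha\boldsymbol P+\boldsymbol P=\epsilon_0(\epsilon_s-\epsilon_\infty)\boldsymbol E+\boldsymbol f_3 .$$ In the case $\theta=\frac12$ assume moreover that $\boldsymbol f_3\in C^1([0,T];(L^2(\Omega))^2)$ (this holds in particular if $\boldsymbol f_3=\boldsymbol 0$). For $N\ge1$ let $\tau=T/N$, $t_n=n\tau$, $t_{n-\theta}=(n-\theta)\tau$, and for sequences put $$\partial_\tau^{n-\theta}u=\frac{u^n-u^{n-1}}{\tau},\qquad \overline u^{\,n-\theta}=(1-\theta)u^n+\theta u^{n-1},\qquad \partial_\tau^\alpha u^{n-\theta}=\tau^{-\alpha}\sum_{k=1}^n\omega_{n-k}(u^k-u^0),$$ where $\displaystyle\sum_{k\ge0}\omega_k\zeta^k=\Big[\frac{1-\zeta}{\frac12(1+\zeta)+\frac\theta\alpha(1-\zeta)}\Big]^\alpha$.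 The semi-discrete SFTR-$\theta$ scheme asks for $\boldsymbol E_\tau^n\in H_0(\mathrm{curl};\Omega)$, $H_\tau^n\in L^2(\Omega)$, $\boldsymbol P_\tau^n\in(L^2(\Omega))^2$ with $\boldsymbol E_\tau^0=\boldsymbol E(0)$, $H_\tau^0=H(0)$, $\boldsymbol P_\tau^0=\boldsymbol P(0)$ such that for $1\le n\le N$ $$\epsilon_0\epsilon_\infty(\partial_\tau^{n-\theta}\boldsymbol E_\tau,\boldsymbol\chi)+(\partial_\tau^{n-\theta}\boldsymbol P_\tau,\boldsymbol\chi)-(\overline H_\tau^{\,n-\theta},\nabla\times\boldsymbol\chi)=(\boldsymbol f_1(t_{n-\theta}),\boldsymbol\chi)\quad\forall\boldsymbol\chi\in H_0(\mathrm{curl};\Omega),$$ $$\mu_0(\partial_\tau^{n-\theta}H_\tau,\phi)+(\nabla\times\overline{\boldsymbol E}_\tau^{\,n-\theta},\phi)=(f_2(t_{n-\theta}),\phi)\quad\forall\phi\in L^2(\Omega),$$ $$\tau_0^\alpha(\partial_\tau^\alpha\boldsymbol P_\tau^{n-\theta},\boldsymbol\psi)+(\overline{\boldsymbol P}_\tau^{\,n-\theta},\boldsymbol\psi)-\epsilon_0(\epsilon_s-\epsilon_\infty)(\overline{\boldsymbol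 E}_\tau^{\,n-\theta},\boldsymbol\psi)=(\boldsymbol f_3(t_{n-\theta}),\boldsymbol\psi)\quad\forall\boldsymbol\psi\in(L^2(\Omega))^2 .$$ Then there are constants $C>0$ and $\tau_{\max}>0$, independent of $\tau$, such that for every $N\ge1$ with $\tau=T/N\le\tau_{\max}$ and every solution of the scheme $$\max_{1\le n\le N}\big(\|\boldsymbol E(t_n)-\boldsymbol E_\tau^n\|+\|\boldsymbol P(t_n)-\boldsymbol P_\tau^n\|+\|H(t_n)-H_\tau^n\|\big)\le C\tau^s,\qquad s=\begin{cases}1,&\theta\in[\frac\alpha2,\frac12),\\2,&\theta=\frac12.\end{cases}$$ -/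

import Mathlib

open MeasureTheory Set
open scoped ContDiff RealInnerProductSpace

noncomputable section

namespace ColeCole

/-- Points and vectors of the plane, with the Euclidean norm. -/
abbrev Plane : Type := EuclideanSpace ℝ (Fin 2)

/-- The open rectangle `(a, b) × (c, d)`. -/
def rect (a b c d : ℝ) : Set Plane :=
  {x | (a < x 0 ∧ x 0 < b) ∧ (c < x 1 ∧ x 1 < d)}

/-- `L²(Ω)`. -/
abbrev L2S (Ω : Set Plane) : Type := Lp ℝ 2 (volume.restrict Ω)

/-- `(L²(Ω))²`, as the space of square integrable plane-valued fields. -/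
abbrev L2V (Ω : Set Plane) : Type := Lp Plane 2 (volume.restrict Ω)

/-- `∂φ/∂xᵢ` for a function on the plane. -/
def pderiv {F : Type*} [NormedAddCommGroup F] [NormedSpace ℝ F]
    (i : Fin 2) (φ : Plane → F) (x : Plane) : F :=
  fderiv ℝ φ x (EuclideanSpace.single i 1)

/-- The curl `(∂φ/∂y, -∂φ/∂x)` of a smooth scalar function. -/
def curlS (φ : Plane → ℝ) (x : Plane) : Plane :=
  !₂[pderiv 1 φ x, -pderiv 0 φ x]

/-- The curl `∂Φ₂/∂x - ∂Φ₁/∂y` of a smooth vector field. -/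
def curlV (Φ : Plane → Plane) (x : Plane) : ℝ :=
  (pderiv 0 Φ x) 1 - (pderiv 1 Φ x) 0

/-- `C_c^∞(Ω; F)`. -/
def IsTest {F : Type*} [NormedAddCommGroup F] [NormedSpace ℝ F]
    (Ω : Set Plane) (φ : Plane → F) : Prop :=
  ContDiff ℝ ∞ φ ∧ HasCompactSupport φ ∧ tsupport φ ⊆ Ω

/-- `w ∈ L²(Ω)` is the weak curl of the vector field `v ∈ (L²(Ω))²`. -/
def IsWeakCurlV (Ω : Set Plane) (v : L2V Ω) (w : L2S Ω) : Prop :=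
  ∀ φ : Plane → ℝ, IsTest Ω φ →
    ∫ x in Ω, w x * φ x = ∫ x in Ω, ⟪v x, curlS φ x⟫

/-- `W ∈ (L²(Ω))²` is the weak curl of the scalar function `h ∈ L²(Ω)`. -/
def IsWeakCurlS (Ω : Set Plane) (h : L2S Ω) (W : L2V Ω) : Prop :=
  ∀ Φ : Plane → Plane, IsTest Ω Φ →
    ∫ x in Ω, ⟪W x, Φ x⟫ = ∫ x in Ω, h x * curlV Φ x

section Helpers

variable {Ω : Set Plane}

theorem continuous_pderiv {F : Type*} [NormedAddCommGroup F] [NormedSpace ℝ F]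
    {φ : Plane → F} (h : IsTest Ω φ) (i : Fin 2) : Continuous (pderiv i φ) :=
  (h.1.continuous_fderiv (by simp)).clm_apply continuous_const

theorem hasCompactSupport_pderiv {F : Type*} [NormedAddCommGroup F] [NormedSpace ℝ F]
    {φ : Plane → F} (h : IsTest Ω φ) (i : Fin 2) : HasCompactSupport (pderiv i φ) :=
  h.2.1.fderiv_apply (𝕜 := ℝ) _

theorem memLp_curlS {φ : Plane → ℝ} (h : IsTest Ω φ) :
    MemLp (curlS φ) 2 (volume.restrict Ω) := by
  have hc : Continuous (curlS φ) := by
    refine (PiLp.continuous_toLp 2 _).comp (continuous_pi fun i => ?_)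
    fin_cases i
    · exact continuous_pderiv h 1
    · exact (continuous_pderiv h 0).neg
  have hs : HasCompactSupport (curlS φ) := by
    have h0 := hasCompactSupport_pderiv h 0
    have h1 := hasCompactSupport_pderiv h 1
    refine HasCompactSupport.intro (h1.isCompact.union h0.isCompact) fun x hx => ?_
    rw [Set.mem_union, not_or] at hx
    ext i
    fin_cases i
    · simpa [curlS] using image_eq_zero_of_notMem_tsupport hx.1
    · simpa [curlS] using image_eq_zero_of_notMem_tsupport hx.2
  exact hc.memLp_of_hasCompactSupport hs

theorem memLp_curlV {Φ : Plane → Plane} (h : IsTest Ω Φ) :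
    MemLp (curlV Φ) 2 (volume.restrict Ω) := by
  have hc : Continuous (curlV Φ) := by
    have h0 := continuous_pderiv h 0
    have h1 := continuous_pderiv h 1
    unfold curlV
    fun_prop
  have hs : HasCompactSupport (curlV Φ) := by
    have h0 := hasCompactSupport_pderiv h 0
    have h1 := hasCompactSupport_pderiv h 1
    refine HasCompactSupport.intro (h0.isCompact.union h1.isCompact) fun x hx => ?_
    rw [Set.mem_union, not_or] at hx
    simp [curlV, image_eq_zero_of_notMem_tsupport hx.1, image_eq_zero_of_notMem_tsupport hx.2]
  exact hc.memLp_of_hasCompactSupport hs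

theorem memLp_test {F : Type*} [NormedAddCommGroup F] [NormedSpace ℝ F]
    {φ : Plane → F} (h : IsTest Ω φ) : MemLp φ 2 (volume.restrict Ω) :=
  h.1.continuous.memLp_of_hasCompactSupport h.2.1

theorem inner_toLp {F : Type*} [NormedAddCommGroup F] [InnerProductSpace ℝ F]
    (v : Lp F 2 (volume.restrict Ω)) {g : Plane → F} (hg : MemLp g 2 (volume.restrict Ω)) :
    ∫ x in Ω, ⟪v x, g x⟫ = ⟪v, hg.toLp g⟫ := by
  rw [L2.inner_def]
  refine integral_congr_ae ?_
  filter_upwards [hg.coeFn_toLp] with x hx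
  rw [hx]

theorem integral_mul_toLp (v : L2S Ω) {g : Plane → ℝ} (hg : MemLp g 2 (volume.restrict Ω)) :
    ∫ x in Ω, v x * g x = ⟪v, hg.toLp g⟫ := by
  rw [← inner_toLp v hg]
  refine integral_congr_ae (Filter.Eventually.of_forall fun x => ?_)
  simp [mul_comm]

theorem isWeakCurlV_iff (v : L2V Ω) (w : L2S Ω) :
    IsWeakCurlV Ω v w ↔ ∀ (φ : Plane → ℝ) (h : IsTest Ω φ),
      ⟪w, (memLp_test h).toLp φ⟫ = ⟪v, (memLp_curlS h).toLp (curlS φ)⟫ := by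
  refine forall_congr' fun φ => forall_congr' fun h => ?_
  rw [integral_mul_toLp w (memLp_test h), inner_toLp v (memLp_curlS h)]

theorem isWeakCurlS_iff (u : L2S Ω) (W : L2V Ω) :
    IsWeakCurlS Ω u W ↔ ∀ (Φ : Plane → Plane) (h : IsTest Ω Φ),
      ⟪W, (memLp_test h).toLp Φ⟫ = ⟪u, (memLp_curlV h).toLp (curlV Φ)⟫ := by
  refine forall_congr' fun Φ => forall_congr' fun h => ?_
  rw [integral_mul_toLp u (memLp_curlV h), inner_toLp W (memLp_test h)]

end Helpers

/-- `H(curl; Ω)` for vector fields. An element is a field `v ∈ (L²(Ω))²` together with its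
(unique) weak curl in `L²(Ω)`; the norm is `(‖v‖² + ‖∇ × v‖²)^{1/2}`. -/
def Hcurl (Ω : Set Plane) : Submodule ℝ (WithLp 2 (L2V Ω × L2S Ω)) where
  carrier := {p | IsWeakCurlV Ω p.fst p.snd}
  zero_mem' := by
    simp only [mem_ofPred_eq, isWeakCurlV_iff]
    intro φ h
    simp
  add_mem' := by
    intro p q hp hq
    simp only [mem_ofPred_eq, isWeakCurlV_iff] at *
    intro φ h
    simp [inner_add_left, hp φ h, hq φ h]
  smul_mem' := by
    intro r p hp
    simp only [mem_ofPred_eq, isWeakCurlV_iff] at *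
    intro φ h
    simp [real_inner_smul_left, hp φ h]

/-- `H(curl; Ω)` for scalar functions, which is `H¹(Ω)`. An element is a function `h ∈ L²(Ω)`
together with its (unique) weak curl `(∂h/∂y, -∂h/∂x) ∈ (L²(Ω))²`, with the graph norm. -/
def HcurlS (Ω : Set Plane) : Submodule ℝ (WithLp 2 (L2S Ω × L2V Ω)) where
  carrier := {p | IsWeakCurlS Ω p.fst p.snd}
  zero_mem' := by
    simp only [mem_ofPred_eq, isWeakCurlS_iff]
    intro φ h
    simp
  add_mem' := by
    intro p q hp hq
    simp only [mem_ofPred_eq, isWeakCurlS_iff] at *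
    intro φ h
    simp [inner_add_left, hp φ h, hq φ h]
  smul_mem' := by
    intro r p hp
    simp only [mem_ofPred_eq, isWeakCurlS_iff] at *
    intro φ h
    simp [real_inner_smul_left, hp φ h]

/-- `H₀(curl; Ω)`: the fields `v ∈ H(curl; Ω)` with `n × v = 0` on `∂Ω`. The tangential trace of
`v` is the functional `h ↦ (∇ × v, h) - (v, ∇ × h)` on `H¹(Ω)` (Green's formula), and it has
to vanish. -/
def H0curl (Ω : Set Plane) : Submodule ℝ (WithLp 2 (L2V Ω × L2S Ω)) where
  carrier := {p | p ∈ Hcurl Ω ∧ ∀ q ∈ HcurlS Ω, ⟪p.snd, q.fst⟫ = ⟪p.fst, q.snd⟫}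
  zero_mem' := ⟨(Hcurl Ω).zero_mem, fun q _ => by simp⟩
  add_mem' := by
    intro p q hp hq
    refine ⟨(Hcurl Ω).add_mem hp.1 hq.1, fun r hr => ?_⟩
    simp [inner_add_left, hp.2 r hr, hq.2 r hr]
  smul_mem' := by
    intro s p hp
    refine ⟨(Hcurl Ω).smul_mem s hp.1, fun r hr => ?_⟩
    simp [real_inner_smul_left, hp.2 r hr]

/-- The underlying `L²` field of an element of `H₀(curl; Ω)`. -/
def fieldV {Ω : Set Plane} (v : H0curl Ω) : L2V Ω := (v : WithLp 2 (L2V Ω × L2S Ω)).fst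

/-- `∇ × v` for `v ∈ H₀(curl; Ω)`. -/
def curlE {Ω : Set Plane} (v : H0curl Ω) : L2S Ω := (v : WithLp 2 (L2V Ω × L2S Ω)).snd

/-- The underlying `L²` function of a scalar element of `H(curl; Ω)`. -/
def funcS {Ω : Set Plane} (h : HcurlS Ω) : L2S Ω := (h : WithLp 2 (L2S Ω × L2V Ω)).fst

/-- `∇ × h` for a scalar `h ∈ H(curl; Ω)`. -/
def curlH {Ω : Set Plane} (h : HcurlS Ω) : L2V Ω := (h : WithLp 2 (L2S Ω × L2V Ω)).snd

/-- The Riemann-Liouville integral `(I^β u)(t) = Γ(β)⁻¹ ∫₀ᵗ (t - s)^{β - 1} u(s) ds`. -/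
def rlIntegral {F : Type*} [NormedAddCommGroup F] [NormedSpace ℝ F]
    (β : ℝ) (u : ℝ → F) (t : ℝ) : F :=
  (Real.Gamma β)⁻¹ • ∫ s in (0 : ℝ)..t, (t - s) ^ (β - 1) • u s

/-- The Caputo derivative `∂ₜ^α u = I^{1-α} uₜ`. -/
def caputo {F : Type*} [NormedAddCommGroup F] [NormedSpace ℝ F]
    (α : ℝ) (u : ℝ → F) (t : ℝ) : F :=
  rlIntegral (1 - α) (deriv u) t

/-- The physical parameters of the Cole-Cole medium. -/
structure Medium where
  ε₀ : ℝ
  εinf : ℝ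
  εs : ℝ
  μ₀ : ℝ
  τ₀ : ℝ
  α : ℝ
  ε₀_pos : 0 < ε₀
  εinf_pos : 0 < εinf
  εinf_lt_εs : εinf < εs
  μ₀_pos : 0 < μ₀
  τ₀_pos : 0 < τ₀
  α_pos : 0 < α
  α_lt_one : α < 1

/-- `(E, P, H)` solves the Cole-Cole system with sources `f₁, f₂, f₃` on `Ω × (0, T)`, with
`P(0) = 0`. The boundary condition `n × E = 0` is contained in `E(t) ∈ H₀(curl; Ω)`. -/
structure IsSolution (M : Medium) {Ω : Set Plane} (T : ℝ)
    (f₁ : ℝ → L2V Ω) (f₂ : ℝ → L2S Ω) (f₃ : ℝ → L2V Ω)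
    (E : ℝ → H0curl Ω) (P : ℝ → L2V Ω) (H : ℝ → HcurlS Ω) : Prop where
  init : P 0 = 0
  ampere : ∀ t ∈ Ioo 0 T,
    (M.ε₀ * M.εinf) • deriv (fun s => fieldV (E s)) t = curlH (H t) - deriv P t + f₁ t
  faraday : ∀ t ∈ Ioo 0 T,
    M.μ₀ • deriv (fun s => funcS (H s)) t = -curlE (E t) + f₂ t
  polarization : ∀ t ∈ Ioo 0 T,
    M.τ₀ ^ M.α • caputo M.α P t + P t = (M.ε₀ * (M.εs - M.εinf)) • fieldV (E t) + f₃ t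

/-- The generating function `ω(ζ) = [(1 - ζ) / ((1 + ζ)/2 + (θ/α)(1 - ζ))]^α`. -/
def omega (α θ ζ : ℝ) : ℝ :=
  ((1 - ζ) / ((1 / 2) * (1 + ζ) + (θ / α) * (1 - ζ))) ^ α

/-- The weight `ω_k`: the coefficient of `ζ^k` in the power series of `ω` at `0`. -/
def weight (α θ : ℝ) (k : ℕ) : ℝ :=
  iteratedDeriv k (omega α θ) 0 / (k.factorial : ℝ)

section Discrete

variable {F : Type*} [AddCommGroup F] [Module ℝ F]

/-- The difference quotient `(uⁿ - uⁿ⁻¹)/τ`, used for `n ≥ 1`. -/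
def dq (τ : ℝ) (u : ℕ → F) (n : ℕ) : F := τ⁻¹ • (u n - u (n - 1))

/-- The average `(1 - θ) uⁿ + θ uⁿ⁻¹`, used for `n ≥ 1`. -/
def avg (θ : ℝ) (u : ℕ → F) (n : ℕ) : F := (1 - θ) • u n + θ • u (n - 1)

/-- The shifted fractional trapezoidal rule `τ^{-α} ∑_{k=1}^n ω_{n-k} (u^k - u^0)`. -/
def fracDq (α θ τ : ℝ) (u : ℕ → F) (n : ℕ) : F :=
  τ ^ (-α) • ∑ k ∈ Finset.Icc 1 n, weight α θ (n - k) • (u k - u 0)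

end Discrete

/-- `(Eτ, Pτ, Hτ)` solves the semi-discrete SFTR-θ scheme with step `τ`, sources sampled at
`t_{n-θ} = (n - θ) τ`, and initial values `E₀, P₀, H₀`, for the steps `n = 1, …, N`. -/
structure IsSchemeSolution (M : Medium) {Ω : Set Plane} (θ τ : ℝ) (N : ℕ)
    (f₁ : ℝ → L2V Ω) (f₂ : ℝ → L2S Ω) (f₃ : ℝ → L2V Ω)
    (E₀ : H0curl Ω) (P₀ : L2V Ω) (H₀ : L2S Ω)
    (Eτ : ℕ → H0curl Ω) (Pτ : ℕ → L2V Ω) (Hτ : ℕ → L2S Ω) : Prop where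
  initE : Eτ 0 = E₀
  initP : Pτ 0 = P₀
  initH : Hτ 0 = H₀
  ampere : ∀ n, 1 ≤ n → n ≤ N → ∀ χ : H0curl Ω,
    M.ε₀ * M.εinf * ⟪fieldV (dq τ Eτ n), fieldV χ⟫ + ⟪dq τ Pτ n, fieldV χ⟫
      - ⟪avg θ Hτ n, curlE χ⟫ = ⟪f₁ ((n - θ) * τ), fieldV χ⟫
  faraday : ∀ n, 1 ≤ n → n ≤ N → ∀ φ : L2S Ω,
    M.μ₀ * ⟪dq τ Hτ n, φ⟫ + ⟪curlE (avg θ Eτ n), φ⟫ = ⟪f₂ ((n - θ) * τ), φ⟫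
  polarization : ∀ n, 1 ≤ n → n ≤ N → ∀ ψ : L2V Ω,
    M.τ₀ ^ M.α * ⟪fracDq M.α θ τ Pτ n, ψ⟫ + ⟪avg θ Pτ n, ψ⟫
      - M.ε₀ * (M.εs - M.εinf) * ⟪fieldV (avg θ Eτ n), ψ⟫ = ⟪f₃ ((n - θ) * τ), ψ⟫

/-- The convergence order: `2` for `θ = 1/2`, and `1` otherwise. -/
def order (θ : ℝ) : ℕ := if θ = 1 / 2 then 2 else 1

end ColeCole

end

/-! The proof is consistency plus stability. The energy estimate needs no Gronwall argument, and the
quadrature error is measured by its total variation in time.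

Stability. Written in terms of increments, the fractional quotient has the generating function
`A^(-α) (1 - X)^(α-1) (1 - q X)^(-α)` with `A = 1/2 + θ/α` and `q = (θ/α - 1/2)/A`, where `0 ≤ q <
1` because `α/2 ≤ θ`. Its coefficients are moments of a positive Beta density, so the kernel is a
mixture of geometric kernels, each of them positive semidefinite (`sum_fracDq_inner_nonneg`).
Testing Ampère's law with the averaged `E` error, Faraday's law with the averaged `H` error and the
polarization law with the increment of the `P` error cancels the curl and coupling terms. What
remains is an energy that telescopes, since `θ ≤ 1/2` (`scheme_stability`). Residuals paired with
increments are summed by parts, so their variation has to be small, not only their size.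

The curl of `E`. The field is smooth in time only in `L²`, so the curl of its averaging error `ρ`
has no rate. But `ρ` is itself an admissible test field: subtracting Ampère's law tested with `ρ`
removes this curl, and only `L²` norms of `ρ` survive.

Consistency. Convolution with `κ = 1/ω` gives a discrete curve whose fractional quotients are
exactly the Caputo derivatives at `t_{n-θ}`; its distance `δ` to `P` has total variation `O(τ
‖P'(0)‖ + τ²)` (`IsC3.exists_discrete_comparison`). Taylor's formula reduces this to the functions
`t` and `(t - s)₊²/2`, uniformly in `s`. Their Caputo derivatives, sampled on the grid, are expanded
in the coefficients of `(1 - X)^(α-3)`, `(1 - X)^(α-2)`, `(1 - X)^(α-1)` up to an `ℓ¹` remainder, by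
the asymptotics of binomial coefficients. Moreover `(1 - X) κ = (1 - X)^(1-α) W` with `W = (A - B
X)^α = 1 + α B (1 - X) + (1 - X)² Y` and `B = A - 1`. The singular terms `(1 - X)^(-2)` cancel
because `W(1) = 1`, and the terms `(1 - X)^(-1)` because `α B = θ - α/2` matches the sampling shift
`θ`.

Order. Averaging errors are `O(τ²)` for every `θ`. Difference quotients compared with the derivative
at `t_{n-θ}` are of second order only at the midpoint `θ = 1/2`. There the term `τ ‖P'(0)‖` must
vanish too: `C¹` data make the Caputo derivative of `P` a `C¹` function up to `t = 0`, while it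
behaves like `t^(1-α) P'(0)/Γ(2-α)`, so `P'(0) = 0`. -/

noncomputable section

namespace ColeCole

/-! ### The binomial series `(1 - x X) ^ r` -/

/-- The power series of `(1 - x X) ^ r`. -/
def binSer (r x : ℝ) : PowerSeries ℝ :=
  PowerSeries.rescale (-x) (PowerSeries.binomialSeries ℝ r)

theorem coeff_binSer (r x : ℝ) (n : ℕ) :
    PowerSeries.coeff n (binSer r x) = (-x) ^ n * Ring.choose r n := by
  simp [binSer, PowerSeries.coeff_rescale]

theorem succ_mul_choose (r : ℝ) (n : ℕ) :
    ((n : ℝ) + 1) * Ring.choose r (n + 1) = (r - n) * Ring.choose r n := by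
  have h := Ring.choose_smul_choose r (Nat.le_succ n)
  rw [Nat.choose_succ_self_right, show n + 1 - n = 1 by omega, Ring.choose_one_right] at h
  simp only [nsmul_eq_mul] at h
  push_cast at h
  rw [h]; ring

theorem succ_mul_choose' (r : ℝ) (n : ℕ) :
    ((n : ℝ) + 1) * Ring.choose r (n + 1) = r * Ring.choose (r - 1) n := by
  have h := Ring.choose_smul_choose r (show 1 ≤ n + 1 by omega)
  rw [Nat.choose_one_right, Nat.add_sub_cancel, Ring.choose_one_right] at h
  simpa [nsmul_eq_mul] using h

theorem coeff_binSer_zero (r x : ℝ) : PowerSeries.coeff 0 (binSer r x) = 1 := by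
  simp [coeff_binSer]

theorem coeff_binSer_succ (r x : ℝ) (n : ℕ) :
    PowerSeries.coeff (n + 1) (binSer r x)
      = x * ((n - r) / (n + 1)) * PowerSeries.coeff n (binSer r x) := by
  have h := succ_mul_choose r n
  have hn : (n : ℝ) + 1 ≠ 0 := by positivity
  have h' : Ring.choose r (n + 1) = (r - n) * Ring.choose r n / (n + 1) := by
    rw [← h]; field_simp
  rw [coeff_binSer, coeff_binSer, h']
  field_simp
  ring

theorem binSer_add (r s x : ℝ) : binSer (r + s) x = binSer r x * binSer s x := by
  simp [binSer, PowerSeries.binomialSeries_add]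

theorem binSer_zero (x : ℝ) : binSer 0 x = 1 := by
  simp [binSer]

theorem binSer_one (x : ℝ) : binSer 1 x = 1 - x • PowerSeries.X := by
  ext n
  rw [coeff_binSer]
  match n with
  | 0 => simp
  | 1 => simp
  | n + 2 =>
    have : Ring.choose (1 : ℝ) (n + 2) = 0 := by
      have := Ring.choose_natCast (R := ℝ) 1 (n + 2)
      rwa [Nat.choose_eq_zero_of_lt (by omega), Nat.cast_one, Nat.cast_zero] at this
    simp [this, PowerSeries.coeff_X, PowerSeries.coeff_one]

theorem coeff_binSer_neg_one (n : ℕ) : PowerSeries.coeff n (binSer (-1) 1) = 1 := by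
  induction n with
  | zero => exact coeff_binSer_zero _ _
  | succ n ih =>
    rw [coeff_binSer_succ, ih]
    have : (n : ℝ) + 1 ≠ 0 := by positivity
    field_simp
    ring

theorem coeff_binSer_neg_two (n : ℕ) : PowerSeries.coeff n (binSer (-2) 1) = n + 1 := by
  induction n with
  | zero => simpa using coeff_binSer_zero _ _
  | succ n ih =>
    rw [coeff_binSer_succ, ih]
    have : (n : ℝ) + 1 ≠ 0 := by positivity
    push_cast
    field_simp
    ring

theorem coeff_binSer_nonneg {r x : ℝ} (hr : r ≤ 0) (hx : 0 ≤ x) (n : ℕ) :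
    0 ≤ PowerSeries.coeff n (binSer r x) := by
  induction n with
  | zero => simp [coeff_binSer_zero]
  | succ n ih =>
    rw [coeff_binSer_succ]
    have : 0 ≤ (n : ℝ) - r := by have : (0 : ℝ) ≤ n := by positivity
                                 linarith
    positivity

theorem coeff_binSer_pos {r : ℝ} (hr : r < 0) (n : ℕ) :
    0 < PowerSeries.coeff n (binSer r 1) := by
  induction n with
  | zero => simp [coeff_binSer_zero]
  | succ n ih =>
    rw [coeff_binSer_succ]
    have : 0 < (n : ℝ) - r := by have : (0 : ℝ) ≤ n := by positivity
                                 linarith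
    positivity

/-- The coefficients of `(1 - X) ^ (r - 1)` from those of `(1 - X) ^ r`. -/
theorem coeff_binSer_sub_one (r : ℝ) (hr : r ≠ 0) (n : ℕ) :
    PowerSeries.coeff n (binSer (r - 1) 1)
      = (n - r) / (-r) * PowerSeries.coeff n (binSer r 1) := by
  have h1 := succ_mul_choose r n
  rw [succ_mul_choose'] at h1
  rw [coeff_binSer, coeff_binSer]
  field_simp
  linear_combination h1

theorem coeff_one_sub_X_mul_succ (F : PowerSeries ℝ) (n : ℕ) :
    PowerSeries.coeff (n + 1) ((1 - PowerSeries.X) * F)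
      = PowerSeries.coeff (n + 1) F - PowerSeries.coeff n F := by
  rw [sub_mul, one_mul, map_sub, PowerSeries.coeff_succ_X_mul]

theorem coeff_one_sub_X_mul_zero (F : PowerSeries ℝ) :
    PowerSeries.coeff 0 ((1 - PowerSeries.X) * F) = PowerSeries.coeff 0 F := by
  simp

theorem binSer_one_one : binSer 1 1 = 1 - PowerSeries.X := by
  simp [binSer_one]

theorem one_sub_X_mul_binSer (r : ℝ) :
    (1 - PowerSeries.X) * binSer r 1 = binSer (r + 1) 1 := by
  rw [← binSer_one_one, ← binSer_add, add_comm]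

/-! ### Power series with absolutely summable coefficients -/

/-- The coefficients of `F` have `ℓ¹` norm at most `C`. -/
def SumAbsLE (F : PowerSeries ℝ) (C : ℝ) : Prop :=
  ∀ N : ℕ, ∑ n ∈ Finset.range N, |PowerSeries.coeff n F| ≤ C

theorem SumAbsLE.nonneg {F : PowerSeries ℝ} {C : ℝ} (h : SumAbsLE F C) : 0 ≤ C := by
  simpa using h 0

theorem SumAbsLE.mono {F : PowerSeries ℝ} {C D : ℝ} (h : SumAbsLE F C) (hCD : C ≤ D) :
    SumAbsLE F D := fun N => (h N).trans hCD

theorem SumAbsLE.add {F G : PowerSeries ℝ} {C D : ℝ} (hF : SumAbsLE F C) (hG : SumAbsLE G D) :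
    SumAbsLE (F + G) (C + D) := by
  intro N
  calc ∑ n ∈ Finset.range N, |PowerSeries.coeff n (F + G)|
      ≤ ∑ n ∈ Finset.range N, (|PowerSeries.coeff n F| + |PowerSeries.coeff n G|) :=
        Finset.sum_le_sum fun n _ => by rw [map_add]; exact abs_add_le _ _
    _ ≤ C + D := by rw [Finset.sum_add_distrib]; exact add_le_add (hF N) (hG N)

theorem SumAbsLE.smul {F : PowerSeries ℝ} {C : ℝ} (hF : SumAbsLE F C) (r : ℝ) :
    SumAbsLE (r • F) (|r| * C) := by
  intro N
  simp only [PowerSeries.coeff_smul, smul_eq_mul, abs_mul, ← Finset.mul_sum]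
  exact mul_le_mul_of_nonneg_left (hF N) (abs_nonneg r)

theorem SumAbsLE.neg {F : PowerSeries ℝ} {C : ℝ} (hF : SumAbsLE F C) : SumAbsLE (-F) C := by
  intro N
  simpa using hF N

theorem SumAbsLE.sub {F G : PowerSeries ℝ} {C D : ℝ} (hF : SumAbsLE F C) (hG : SumAbsLE G D) :
    SumAbsLE (F - G) (C + D) := by
  rw [sub_eq_add_neg]
  exact hF.add hG.neg

theorem SumAbsLE.mul {F G : PowerSeries ℝ} {C D : ℝ} (hF : SumAbsLE F C) (hG : SumAbsLE G D) :
    SumAbsLE (F * G) (C * D) := by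
  intro N
  calc ∑ n ∈ Finset.range N, |PowerSeries.coeff n (F * G)|
      ≤ ∑ n ∈ Finset.range N, ∑ p ∈ Finset.HasAntidiagonal.antidiagonal n,
          |PowerSeries.coeff p.1 F| * |PowerSeries.coeff p.2 G| := by
        refine Finset.sum_le_sum fun n _ => ?_
        rw [PowerSeries.coeff_mul]
        refine (Finset.abs_sum_le_sum_abs _ _).trans (le_of_eq ?_)
        simp only [abs_mul]
    _ = ∑ p ∈ Finset.range N ×ˢ Finset.range N with p.1 + p.2 < N,
          |PowerSeries.coeff p.1 F| * |PowerSeries.coeff p.2 G| := by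
        rw [← Finset.sum_fiberwise_of_maps_to (g := fun p : ℕ × ℕ => p.1 + p.2)
          (t := Finset.range N) (fun p hp => by simpa using (Finset.mem_filter.1 hp).2)]
        refine Finset.sum_congr rfl fun n hn => Finset.sum_congr ?_ fun _ _ => rfl
        ext p
        simp only [Finset.mem_range, Finset.HasAntidiagonal.mem_antidiagonal, Finset.mem_filter,
          Finset.mem_product] at hn ⊢
        omega
    _ ≤ ∑ p ∈ Finset.range N ×ˢ Finset.range N,
          |PowerSeries.coeff p.1 F| * |PowerSeries.coeff p.2 G| :=
        Finset.sum_le_sum_of_subset_of_nonneg (Finset.filter_subset _ _)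
          fun _ _ _ => by positivity
    _ = (∑ n ∈ Finset.range N, |PowerSeries.coeff n F|)
          * ∑ n ∈ Finset.range N, |PowerSeries.coeff n G| := by
        rw [Finset.sum_mul_sum, Finset.sum_product]
    _ ≤ C * D := mul_le_mul (hF N) (hG N) (Finset.sum_nonneg fun _ _ => abs_nonneg _) hF.nonneg

theorem sumAbsLE_X_pow_mul {F : PowerSeries ℝ} {C : ℝ} (hF : SumAbsLE F C) (j : ℕ) :
    SumAbsLE (PowerSeries.X ^ j * F) C := by
  have h : SumAbsLE (PowerSeries.X ^ j : PowerSeries ℝ) 1 := by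
    intro N
    simp only [PowerSeries.coeff_X_pow, apply_ite abs, abs_one, abs_zero]
    rw [Finset.sum_ite_eq']
    split_ifs <;> norm_num
  simpa using h.mul hF

theorem sumAbsLE_one : SumAbsLE 1 1 := by
  intro N
  simp only [PowerSeries.coeff_one, apply_ite abs, abs_one, abs_zero]
  rw [Finset.sum_ite_eq']
  split_ifs <;> norm_num

theorem sumAbsLE_one_sub_X : SumAbsLE (1 - PowerSeries.X) 2 := by
  have h := sumAbsLE_X_pow_mul sumAbsLE_one 1
  rw [pow_one, mul_one] at h
  exact (sumAbsLE_one.sub h).mono (by norm_num)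

/-- For `x = 1` all coefficients after the leading `1` are nonpositive, while the partial sums are
coefficients of `(1 - X)^(r-1)` and hence nonnegative; so the negative part has mass at most `1`. A
smaller `x` only shrinks each coefficient. -/
theorem sumAbsLE_binSer {r x : ℝ} (hr0 : 0 ≤ r) (hr1 : r ≤ 1) (hx0 : 0 ≤ x) (hx1 : x ≤ 1) :
    SumAbsLE (binSer r x) 2 := by
  have hneg : ∀ n : ℕ, PowerSeries.coeff (n + 1) (binSer r 1) ≤ 0 := by
    intro n
    induction n with
    | zero => rw [coeff_binSer_succ, coeff_binSer_zero]; simp; exact hr0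
    | succ n ih =>
      rw [coeff_binSer_succ]
      push_cast
      have : 0 ≤ 1 * (((n : ℝ) + 1 - r) / ((n : ℝ) + 1 + 1)) := by
        have : (0 : ℝ) ≤ n := by positivity
        have : 0 ≤ (n : ℝ) + 1 - r := by linarith
        positivity
      exact mul_nonpos_of_nonneg_of_nonpos this ih
  have hsum : ∀ n : ℕ, ∑ k ∈ Finset.range (n + 1), PowerSeries.coeff k (binSer r 1)
      = PowerSeries.coeff n (binSer (r - 1) 1) := by
    intro n
    have h := one_sub_X_mul_binSer (r - 1)
    rw [sub_add_cancel] at h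
    rw [← h]
    induction n with
    | zero => simp
    | succ n ih => rw [Finset.sum_range_succ, ih, coeff_one_sub_X_mul_succ]; ring
  have hle : ∀ n : ℕ, |PowerSeries.coeff n (binSer r x)| ≤ |PowerSeries.coeff n (binSer r 1)| := by
    intro n
    rw [coeff_binSer, coeff_binSer, abs_mul, abs_mul]
    refine mul_le_mul_of_nonneg_right ?_ (abs_nonneg _)
    rw [abs_pow, abs_pow, abs_neg, abs_neg, abs_one, one_pow, abs_of_nonneg hx0]
    exact pow_le_one₀ hx0 hx1
  intro N
  refine (Finset.sum_le_sum fun n _ => hle n).trans ?_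
  cases N with
  | zero => simp
  | succ n =>
    have h1 := hsum n
    have h2 := coeff_binSer_nonneg (r := r - 1) (x := 1) (by linarith) zero_le_one n
    rw [← h1, Finset.sum_range_succ', coeff_binSer_zero] at h2
    rw [Finset.sum_range_succ', coeff_binSer_zero, abs_one]
    have h3 : ∑ k ∈ Finset.range n, |PowerSeries.coeff (k + 1) (binSer r 1)|
        = -∑ k ∈ Finset.range n, PowerSeries.coeff (k + 1) (binSer r 1) := by
      rw [← Finset.sum_neg_distrib]
      exact Finset.sum_congr rfl fun k _ => abs_of_nonpos (hneg k)
    linarith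

/-! ### Identification of the weights -/

theorem hasDerivAt_one_sub_mul_rpow (r x : ℝ) {z : ℝ} (hz : 1 - x * z ≠ 0) :
    HasDerivAt (fun y : ℝ => (1 - x * y) ^ r) (-x * r * (1 - x * z) ^ (r - 1)) z := by
  have h1 : HasDerivAt (fun y : ℝ => 1 - x * y) (-x) z := by
    simpa using ((hasDerivAt_id z).const_mul x).const_sub 1
  exact h1.rpow_const (Or.inl hz)

theorem eventually_one_sub_mul_pos (x : ℝ) : ∀ᶠ z in nhds (0 : ℝ), 0 < 1 - x * z := by
  have : ContinuousAt (fun z : ℝ => 1 - x * z) 0 := by fun_prop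
  exact this.eventually (lt_mem_nhds (by simp))

/-- The exponent is quantified after the induction variable because each differentiation lowers it
by one. -/
theorem iteratedDeriv_one_sub_mul_rpow (x : ℝ) (n : ℕ) : ∀ r : ℝ,
    iteratedDeriv n (fun y : ℝ => (1 - x * y) ^ r) 0
      = n.factorial * PowerSeries.coeff n (binSer r x) := by
  induction n with
  | zero => intro r; simp [coeff_binSer_zero]
  | succ n ih =>
    intro r
    rw [iteratedDeriv_succ']
    have h : deriv (fun y : ℝ => (1 - x * y) ^ r) =ᶠ[nhds 0]
        fun y => (-x * r) * (1 - x * y) ^ (r - 1) := by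
      filter_upwards [eventually_one_sub_mul_pos x] with z hz
      exact (hasDerivAt_one_sub_mul_rpow r x hz.ne').deriv
    rw [h.iteratedDeriv_eq, iteratedDeriv_const_mul_field, ih, coeff_binSer, coeff_binSer]
    have h1 := succ_mul_choose' r n
    rw [Nat.factorial_succ]
    push_cast
    rw [pow_succ]
    linear_combination (-(-x) ^ n * -x * n.factorial) * h1

theorem contDiffAt_one_sub_mul_rpow (x r : ℝ) (n : WithTop ℕ∞) :
    ContDiffAt ℝ n (fun y : ℝ => (1 - x * y) ^ r) 0 := by
  refine ContDiffAt.rpow_const_of_ne ?_ (by simp)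
  fun_prop

/-- The power series of the generating function `ω`. -/
def omegaSer (α θ : ℝ) : PowerSeries ℝ :=
  ((1 / 2 + θ / α) ^ (-α)) •
    (binSer α 1 * binSer (-α) ((θ / α - 1 / 2) / (1 / 2 + θ / α)))

/-- The denominator of `ω` is `A (1 - q z)`, so near `0` the function is a constant times a product
of two binomial powers; Leibniz' rule for its derivatives is the Cauchy product of the two series.
-/
theorem weight_eq_coeff {α θ : ℝ} (hα : 0 < α) (hθ : α / 2 ≤ θ) (n : ℕ) :
    weight α θ n = PowerSeries.coeff n (omegaSer α θ) := by
  have hθα : 1 / 2 ≤ θ / α := by rw [le_div_iff₀ hα]; linarith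
  set A := 1 / 2 + θ / α with hA
  set q := (θ / α - 1 / 2) / A with hq
  have hA0 : 0 < A := by linarith
  have hev : omega α θ =ᶠ[nhds 0]
      fun z => A ^ (-α) * ((1 - 1 * z) ^ α * (1 - q * z) ^ (-α)) := by
    filter_upwards [eventually_one_sub_mul_pos 1, eventually_one_sub_mul_pos q] with z h1 hqz
    have : (1 / 2) * (1 + z) + (θ / α) * (1 - z) = A * (1 - q * z) := by
      have : A * q = θ / α - 1 / 2 := by rw [hq]; field_simp
      linear_combination (-1 : ℝ) * hA + z * this
    rw [omega, this, one_mul]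
    rw [one_mul] at h1
    rw [Real.div_rpow h1.le (by positivity), Real.mul_rpow hA0.le hqz.le,
      Real.rpow_neg hA0.le, Real.rpow_neg hqz.le]
    field_simp
  rw [weight, hev.iteratedDeriv_eq, iteratedDeriv_const_mul_field,
    iteratedDeriv_fun_mul (contDiffAt_one_sub_mul_rpow 1 α n) (contDiffAt_one_sub_mul_rpow q (-α) n),
    omegaSer, ← hA, ← hq, PowerSeries.coeff_smul, PowerSeries.coeff_mul, smul_eq_mul, mul_div_assoc,
    Finset.Nat.sum_antidiagonal_eq_sum_range_succ_mk, Finset.sum_div]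
  congr 1
  refine Finset.sum_congr rfl fun i hi => ?_
  have hi' : i ≤ n := by simpa [Nat.lt_succ_iff] using hi
  rw [iteratedDeriv_one_sub_mul_rpow, iteratedDeriv_one_sub_mul_rpow]
  have h := Nat.choose_mul_factorial_mul_factorial hi'
  have h' : (n.choose i : ℝ) * i.factorial * (n - i).factorial = n.factorial := by exact_mod_cast h
  rw [← h']
  have h1 : (i.factorial : ℝ) ≠ 0 := by positivity
  have h2 : ((n - i).factorial : ℝ) ≠ 0 := by positivity
  have h3 : (n.choose i : ℝ) ≠ 0 := by
    have := Nat.choose_pos hi'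
    positivity
  clear_value q
  field_simp

/-! ### Positivity of the discrete fractional derivative -/

theorem intervalIntegrable_beta {u v : ℝ} (hu : 0 < u) (hv : 0 < v) :
    IntervalIntegrable (fun x : ℝ => x ^ (u - 1) * (1 - x) ^ (v - 1)) volume 0 1 := by
  have h := Complex.betaIntegral_convergent (u := u) (v := v) (by simpa using hu) (by simpa using hv)
  rw [intervalIntegrable_iff_integrableOn_Ioc_of_le zero_le_one] at h ⊢
  refine (show Integrable _ _ from Integrable.re h).congr ?_
  refine (ae_restrict_mem measurableSet_Ioc).mono fun x hx => ?_
  have h1 : (x : ℂ) ^ ((u : ℂ) - 1) = ((x ^ (u - 1) : ℝ) : ℂ) := by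
    rw [Complex.ofReal_cpow hx.1.le]; simp
  have h2 : (1 - (x : ℂ)) ^ ((v : ℂ) - 1) = (((1 - x) ^ (v - 1) : ℝ) : ℂ) := by
    rw [Complex.ofReal_cpow (by linarith [hx.2])]; simp
  beta_reduce
  rw [h1, h2, ← Complex.ofReal_mul]
  simp

theorem integral_beta {u v : ℝ} (hu : 0 < u) (hv : 0 < v) :
    ∫ x in (0 : ℝ)..1, x ^ (u - 1) * (1 - x) ^ (v - 1)
      = Real.Gamma u * Real.Gamma v / Real.Gamma (u + v) := by
  have h := Complex.betaIntegral_eq_Gamma_mul_div (u : ℂ) (v : ℂ) (by simpa using hu)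
    (by simpa using hv)
  rw [← Complex.ofReal_add, Complex.Gamma_ofReal, Complex.Gamma_ofReal, Complex.Gamma_ofReal,
    Complex.betaIntegral] at h
  have h2 : ∫ x in (0 : ℝ)..1, (x : ℂ) ^ ((u : ℂ) - 1) * (1 - (x : ℂ)) ^ ((v : ℂ) - 1)
      = ∫ x in (0 : ℝ)..1, ((x ^ (u - 1) * (1 - x) ^ (v - 1) : ℝ) : ℂ) := by
    refine intervalIntegral.integral_congr fun x hx => ?_
    rw [uIcc_of_le zero_le_one] at hx
    rw [Complex.ofReal_mul, Complex.ofReal_cpow hx.1, Complex.ofReal_cpow (by linarith [hx.2])]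
    simp
  rw [h2, intervalIntegral.integral_ofReal] at h
  exact_mod_cast h

theorem coeff_binSer_eq_Gamma {r : ℝ} (hr : 0 < r) (x : ℝ) (n : ℕ) :
    PowerSeries.coeff n (binSer (-r) x)
      = x ^ n * (Real.Gamma (n + r) / (Real.Gamma r * n.factorial)) := by
  have hΓ : Real.Gamma r ≠ 0 := (Real.Gamma_pos_of_pos hr).ne'
  induction n with
  | zero => rw [coeff_binSer_zero]; simp [hΓ]
  | succ n ih =>
    rw [coeff_binSer_succ, ih, Nat.factorial_succ]
    have h : Real.Gamma ((n : ℝ) + r + 1) = (n + r) * Real.Gamma (n + r) :=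
      Real.Gamma_add_one (by positivity)
    push_cast
    rw [show (n : ℝ) + 1 + r = n + r + 1 by ring, h, pow_succ]
    have : (n : ℝ) + 1 ≠ 0 := by positivity
    field_simp
    ring

/-- The coefficients of `(1 - X) ^ (α - 1) (1 - q X) ^ (-α)` are the moments of a positive
density. -/
theorem coeff_binSer_mul_binSer_eq_integral {α : ℝ} (h0 : 0 < α) (h1 : α < 1) (q : ℝ) (n : ℕ) :
    PowerSeries.coeff n (binSer (α - 1) 1 * binSer (-α) q)
      = (Real.Gamma (1 - α) * Real.Gamma α)⁻¹ *
        ∫ y in (0 : ℝ)..1, (y + (1 - y) * q) ^ n * (y ^ ((1 - α) - 1) * (1 - y) ^ (α - 1)) := by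
  have hΓ1 : Real.Gamma (1 - α) ≠ 0 := (Real.Gamma_pos_of_pos (by linarith)).ne'
  have hΓ2 : Real.Gamma α ≠ 0 := (Real.Gamma_pos_of_pos h0).ne'
  -- Each term of the binomial expansion of `(y + (1 - y) q)^n` is a Beta integrand whose two
  -- parameters add up to `n + 1`, so every term has the same denominator `n!`.
  have key : ∀ i ∈ Finset.range (n + 1), ∀ y ∈ Ioo (0 : ℝ) 1,
      (y ^ i * ((1 - y) * q) ^ (n - i) * (n.choose i : ℝ)) *
        (y ^ ((1 - α) - 1) * (1 - y) ^ (α - 1))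
      = (n.choose i * q ^ (n - i)) *
        (y ^ ((i + (1 - α)) - 1) * (1 - y) ^ (((n - i : ℕ) + α) - 1)) := by
    intro i _ y hy
    have e1 : y ^ ((i + (1 - α)) - 1) = y ^ i * y ^ ((1 - α) - 1) := by
      rw [← Real.rpow_natCast, ← Real.rpow_add hy.1]; congr 1; ring
    have e2 : (1 - y) ^ (((n - i : ℕ) + α) - 1) = (1 - y) ^ (n - i) * (1 - y) ^ (α - 1) := by
      rw [← Real.rpow_natCast, ← Real.rpow_add (by linarith [hy.2])]; congr 1; ring
    rw [e1, e2, mul_pow]; ring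
  have hI : ∫ y in (0 : ℝ)..1, (y + (1 - y) * q) ^ n * (y ^ ((1 - α) - 1) * (1 - y) ^ (α - 1))
      = ∑ i ∈ Finset.range (n + 1), (n.choose i * q ^ (n - i)) *
        (Real.Gamma (i + (1 - α)) * Real.Gamma ((n - i : ℕ) + α) / n.factorial) := by
    have e : ∫ y in (0 : ℝ)..1, (y + (1 - y) * q) ^ n * (y ^ ((1 - α) - 1) * (1 - y) ^ (α - 1))
        = ∫ y in (0 : ℝ)..1, ∑ i ∈ Finset.range (n + 1), (n.choose i * q ^ (n - i)) *
          (y ^ ((i + (1 - α)) - 1) * (1 - y) ^ (((n - i : ℕ) + α) - 1)) := by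
      refine intervalIntegral.integral_congr_ae' ?_ ?_
      · have : ∀ᵐ y : ℝ, y ≠ 1 := by simp [ae_iff, measure_singleton]
        filter_upwards [this] with y hy1 hy
        rw [add_pow, Finset.sum_mul]
        exact Finset.sum_congr rfl fun i hi =>
          key i hi y ⟨hy.1, lt_of_le_of_ne hy.2 hy1⟩
      · exact Filter.Eventually.of_forall fun y hy => by
          have := hy.1.trans_le hy.2
          norm_num at this
    rw [e, intervalIntegral.integral_finsetSum]
    · refine Finset.sum_congr rfl fun i hi => ?_
      rw [intervalIntegral.integral_const_mul,
        integral_beta (by have : (0 : ℝ) ≤ i := by positivity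
                          linarith) (by positivity)]
      have hi' : i ≤ n := by simpa [Nat.lt_succ_iff] using hi
      have : (i : ℝ) + (1 - α) + ((n - i : ℕ) + α) = n + 1 := by
        rw [Nat.cast_sub hi']; ring
      rw [this, Real.Gamma_nat_eq_factorial]
    · intro i _
      exact (intervalIntegrable_beta (by have : (0 : ℝ) ≤ i := by positivity
                                         linarith) (by positivity)).const_mul _
  rw [hI, PowerSeries.coeff_mul, Finset.Nat.sum_antidiagonal_eq_sum_range_succ_mk, Finset.mul_sum]
  refine Finset.sum_congr rfl fun i hi => ?_
  have hi' : i ≤ n := by simpa [Nat.lt_succ_iff] using hi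
  rw [show α - 1 = -(1 - α) by ring, coeff_binSer_eq_Gamma (by linarith), coeff_binSer_eq_Gamma h0]
  have h := Nat.choose_mul_factorial_mul_factorial hi'
  have h' : (n.choose i : ℝ) * i.factorial * (n - i).factorial = n.factorial := by exact_mod_cast h
  rw [← h']
  have h3 : (n.choose i : ℝ) ≠ 0 := by
    have := Nat.choose_pos hi'
    positivity
  simp only [one_pow]
  field_simp

section

variable {F : Type*} [NormedAddCommGroup F] [InnerProductSpace ℝ F]

/-- With `S n = x S (n-1) + v n`, the inner sum is `⟪S n, v n⟫ = ‖S n‖² - x ⟪S n, S (n-1)⟫ ≥ (‖S n‖²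
- ‖S (n-1)‖²)/2`, which telescopes. -/
theorem sum_pow_inner_nonneg {x : ℝ} (h0 : 0 ≤ x) (h1 : x ≤ 1) (v : ℕ → F) (N : ℕ) :
    0 ≤ ∑ n ∈ Finset.range N, ∑ k ∈ Finset.range (n + 1), x ^ (n - k) * ⟪v k, v n⟫ := by
  set S : ℕ → F := fun n => ∑ k ∈ Finset.range (n + 1), x ^ (n - k) • v k with hS
  have hstep : ∀ n, S (n + 1) = x • S n + v (n + 1) := by
    intro n
    simp only [hS]
    rw [Finset.sum_range_succ _ (n + 1), Finset.smul_sum]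
    simp only [Nat.sub_self, pow_zero, one_smul]
    congr 1
    refine Finset.sum_congr rfl fun k hk => ?_
    have : k ≤ n := by simpa [Nat.lt_succ_iff] using hk
    rw [smul_smul, ← pow_succ', show n + 1 - k = n - k + 1 by omega]
  have hterm : ∀ n, ∑ k ∈ Finset.range (n + 1), x ^ (n - k) * ⟪v k, v n⟫ = ⟪S n, v n⟫ := by
    intro n
    simp only [hS, sum_inner, real_inner_smul_left]
  simp only [hterm]
  have hclaim : ∀ n, ‖S n‖ ^ 2 / 2 ≤ ∑ m ∈ Finset.range (n + 1), ⟪S m, v m⟫ := by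
    intro n
    induction n with
    | zero => simp [hS]
    | succ n ih =>
      rw [Finset.sum_range_succ]
      have hv : v (n + 1) = S (n + 1) - x • S n := by rw [hstep]; abel
      rw [hv, inner_sub_right, real_inner_smul_right, real_inner_self_eq_norm_sq]
      have hcs := real_inner_le_norm (S (n + 1)) (S n)
      have hx : x * ⟪S (n + 1), S n⟫ ≤ ‖S (n + 1)‖ ^ 2 / 2 + ‖S n‖ ^ 2 / 2 := by
        calc x * ⟪S (n + 1), S n⟫ ≤ x * (‖S (n + 1)‖ * ‖S n‖) := by gcongr
          _ ≤ 1 * (‖S (n + 1)‖ * ‖S n‖) := by gcongr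
          _ ≤ _ := by nlinarith [sq_nonneg (‖S (n + 1)‖ - ‖S n‖)]
      linarith
  cases N with
  | zero => simp
  | succ n => exact le_trans (by positivity) (hclaim n)

/-- The series of the kernel of the fractional difference quotient with respect to increments. -/
def incrSer (α θ : ℝ) : PowerSeries ℝ :=
  ((1 / 2 + θ / α) ^ (-α)) •
    (binSer (α - 1) 1 * binSer (-α) ((θ / α - 1 / 2) / (1 / 2 + θ / α)))

theorem one_sub_X_mul_incrSer (α θ : ℝ) :
    (1 - PowerSeries.X) * incrSer α θ = omegaSer α θ := by
  rw [incrSer, omegaSer, mul_smul_comm, ← mul_assoc, one_sub_X_mul_binSer, sub_add_cancel]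

/-- The kernel is an average, with respect to a nonnegative Beta density in `y`, of geometric
kernels of ratio `y + (1 - y) q`. The condition `α/2 ≤ θ` makes `q` nonnegative and keeps this ratio
in `[0, 1]`. -/
theorem sum_incrSer_inner_nonneg {α θ : ℝ} (h0 : 0 < α) (h1 : α < 1) (hθ : α / 2 ≤ θ)
    (v : ℕ → F) (N : ℕ) :
    0 ≤ ∑ n ∈ Finset.range N, ∑ k ∈ Finset.range (n + 1),
      PowerSeries.coeff (n - k) (incrSer α θ) * ⟪v k, v n⟫ := by
  have hθα : 1 / 2 ≤ θ / α := by rw [le_div_iff₀ h0]; linarith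
  rw [show incrSer α θ = _ from rfl]
  unfold incrSer
  set A := 1 / 2 + θ / α with hA
  set q := (θ / α - 1 / 2) / A with hq
  have hA0 : 0 < A := by linarith
  have hq0 : 0 ≤ q := div_nonneg (by linarith) hA0.le
  have hq1 : q ≤ 1 := by rw [hq, div_le_one hA0]; linarith
  simp only [PowerSeries.coeff_smul, smul_eq_mul, coeff_binSer_mul_binSer_eq_integral h0 h1]
  have hint : ∀ m : ℕ, IntervalIntegrable
      (fun y : ℝ => (y + (1 - y) * q) ^ m * (y ^ ((1 - α) - 1) * (1 - y) ^ (α - 1))) volume 0 1 :=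
    fun m => (intervalIntegrable_beta (by linarith) h0).continuousOn_mul (by fun_prop)
  set c := A ^ (-α) * (Real.Gamma (1 - α) * Real.Gamma α)⁻¹ with hc
  have hc0 : 0 ≤ c := by
    have := Real.Gamma_pos_of_pos h0
    have := Real.Gamma_pos_of_pos (show 0 < 1 - α by linarith)
    positivity
  have e : ∑ n ∈ Finset.range N, ∑ k ∈ Finset.range (n + 1),
      A ^ (-α) * ((Real.Gamma (1 - α) * Real.Gamma α)⁻¹ *
        ∫ y in (0 : ℝ)..1, (y + (1 - y) * q) ^ (n - k) *
          (y ^ ((1 - α) - 1) * (1 - y) ^ (α - 1))) * ⟪v k, v n⟫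
      = c * ∫ y in (0 : ℝ)..1, ∑ n ∈ Finset.range N, ∑ k ∈ Finset.range (n + 1),
        (y + (1 - y) * q) ^ (n - k) * (y ^ ((1 - α) - 1) * (1 - y) ^ (α - 1)) * ⟪v k, v n⟫ := by
    rw [intervalIntegral.integral_finsetSum, Finset.mul_sum]
    · refine Finset.sum_congr rfl fun n _ => ?_
      rw [intervalIntegral.integral_finsetSum, Finset.mul_sum]
      · refine Finset.sum_congr rfl fun k _ => ?_
        rw [intervalIntegral.integral_mul_const, hc]
        ring
      · exact fun k _ => (hint _).mul_const _
    · refine fun n _ => ?_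
      have := IntervalIntegrable.sum (Finset.range (n + 1))
        (f := fun k y => (y + (1 - y) * q) ^ (n - k) *
          (y ^ ((1 - α) - 1) * (1 - y) ^ (α - 1)) * ⟪v k, v n⟫) (μ := volume) (a := 0) (b := 1)
          (fun k _ => (hint _).mul_const _)
      simpa only [Finset.sum_fn] using this
  rw [e]
  refine mul_nonneg hc0 (intervalIntegral.integral_nonneg zero_le_one fun y hy => ?_)
  have hy1 : 0 ≤ 1 - y := by linarith [hy.2]
  have h := sum_pow_inner_nonneg (x := y + (1 - y) * q)
    (add_nonneg hy.1 (mul_nonneg hy1 hq0)) (by nlinarith) v N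
  have hw : 0 ≤ y ^ ((1 - α) - 1) * (1 - y) ^ (α - 1) :=
    mul_nonneg (Real.rpow_nonneg hy.1 _) (Real.rpow_nonneg hy1 _)
  have := mul_nonneg hw h
  rw [Finset.mul_sum] at this
  refine this.trans (le_of_eq (Finset.sum_congr rfl fun n _ => ?_))
  rw [Finset.mul_sum]
  exact Finset.sum_congr rfl fun k _ => by ring

end

section

variable {F : Type*} [AddCommGroup F] [Module ℝ F]

/-- Summation by parts: the fractional difference quotient in terms of increments. -/
theorem fracDq_eq_incr {α θ : ℝ} (hα : 0 < α) (hθ : α / 2 ≤ θ) (τ : ℝ) (u : ℕ → F) (n : ℕ) :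
    fracDq α θ τ u n = τ ^ (-α) • ∑ k ∈ Finset.range (n + 1),
      PowerSeries.coeff (n - k) (incrSer α θ) • (u k - u (k - 1)) := by
  rw [fracDq]
  congr 1
  -- The weights are differences of `β`, so this is Abel summation. The term `k = 0` in the
  -- increment form vanishes, because `0 - 1 = 0` in `ℕ`.
  set β : ℕ → ℝ := fun m => PowerSeries.coeff m (incrSer α θ) with hβ
  have hw0 : weight α θ 0 = β 0 := by
    rw [weight_eq_coeff hα hθ, ← one_sub_X_mul_incrSer, coeff_one_sub_X_mul_zero]
  have hws : ∀ m, weight α θ (m + 1) = β (m + 1) - β m := by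
    intro m
    rw [weight_eq_coeff hα hθ, ← one_sub_X_mul_incrSer, coeff_one_sub_X_mul_succ]
  have e1 : ∑ k ∈ Finset.Icc 1 n, weight α θ (n - k) • (u k - u 0)
      = ∑ k ∈ Finset.range (n + 1), weight α θ (n - k) • (u k - u 0) := by
    refine Finset.sum_subset (fun k hk => ?_) fun k hk hk' => ?_
    · simp only [Finset.mem_Icc, Finset.mem_range] at hk ⊢
      omega
    · simp only [Finset.mem_Icc, Finset.mem_range] at hk hk'
      obtain rfl : k = 0 := by omega
      simp
  rw [e1]
  cases n with
  | zero => simp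
  | succ n =>
    have e2 : ∑ k ∈ Finset.range (n + 2), β (n + 1 - k) • (u k - u (k - 1))
        = ∑ k ∈ Finset.range (n + 2), β (n + 1 - k) • (u k - u 0)
          - ∑ k ∈ Finset.range (n + 1), β (n - k) • (u k - u 0) := by
      have h : ∑ k ∈ Finset.range (n + 1), β (n - k) • (u k - u 0)
          = ∑ k ∈ Finset.range (n + 2), β (n + 1 - k) • (u (k - 1) - u 0) := by
        rw [Finset.sum_range_succ' _ (n + 1)]
        simp
      rw [h, ← Finset.sum_sub_distrib]
      refine Finset.sum_congr rfl fun k _ => ?_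
      rw [← smul_sub]
      congr 1
      abel
    rw [e2, Finset.sum_range_succ, Finset.sum_range_succ _ (n + 1), Nat.sub_self, hw0,
      add_sub_right_comm, ← Finset.sum_sub_distrib]
    congr 1
    refine Finset.sum_congr rfl fun k hk => ?_
    have hk' : k ≤ n := by simpa [Nat.lt_succ_iff] using hk
    rw [show n + 1 - k = n - k + 1 by omega, hws, sub_smul]

end

/-- Pairing with increments, rather than with values, puts the same sequence on both sides of the
kernel `incrSer`. The term `n = 0` is zero. -/
theorem sum_fracDq_inner_nonneg {F : Type*} [NormedAddCommGroup F] [InnerProductSpace ℝ F]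
    {α θ τ : ℝ} (h0 : 0 < α) (h1 : α < 1) (hθ : α / 2 ≤ θ) (hτ : 0 ≤ τ) (u : ℕ → F) (N : ℕ) :
    0 ≤ ∑ n ∈ Finset.range (N + 1), ⟪fracDq α θ τ u n, u n - u (n - 1)⟫ := by
  have h := sum_incrSer_inner_nonneg h0 h1 hθ (fun k => u k - u (k - 1)) (N + 1)
  have h' := mul_nonneg (Real.rpow_nonneg hτ (-α)) h
  rw [Finset.mul_sum] at h'
  refine h'.trans (le_of_eq (Finset.sum_congr rfl fun n _ => ?_))
  rw [fracDq_eq_incr h0 hθ, real_inner_smul_left, sum_inner]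
  simp only [real_inner_smul_left]

/-! ### Asymptotics of the binomial coefficients -/

/-- The coefficients of `(1 - X) ^ (α - 1)`. -/
def binCoeff (α : ℝ) (k : ℕ) : ℝ := PowerSeries.coeff k (binSer (α - 1) 1)

theorem binCoeff_pos {α : ℝ} (h1 : α < 1) (k : ℕ) : 0 < binCoeff α k :=
  coeff_binSer_pos (by linarith) k

theorem binCoeff_succ (α : ℝ) (k : ℕ) :
    binCoeff α (k + 1) = (1 - α / (k + 1)) * binCoeff α k := by
  rw [binCoeff, coeff_binSer_succ, binCoeff]
  have : (k : ℝ) + 1 ≠ 0 := by positivity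
  field_simp
  ring

/-- `binCoeff α n * n!` is the rising product `∏ (1 - α + j)`, so this is the product formula for
`Γ(1 - α)` inverted. -/
theorem tendsto_binCoeff_mul_rpow {α : ℝ} (h1 : α < 1) :
    Filter.Tendsto (fun k : ℕ => binCoeff α k * (k : ℝ) ^ α) Filter.atTop
      (nhds (Real.Gamma (1 - α))⁻¹) := by
  have hs : 0 < 1 - α := by linarith
  have hΓ : Real.Gamma (1 - α) ≠ 0 := (Real.Gamma_pos_of_pos hs).ne'
  have hprod : ∀ n : ℕ, ∏ j ∈ Finset.range n, ((1 - α) + j) = binCoeff α n * n.factorial := by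
    intro n
    induction n with
    | zero => simp [binCoeff, coeff_binSer_zero]
    | succ n ih =>
      rw [Finset.prod_range_succ, ih, binCoeff_succ, Nat.factorial_succ]
      have : (n : ℝ) + 1 ≠ 0 := by positivity
      push_cast
      field_simp
      ring
  have h := (Real.GammaSeq_tendsto_Gamma (1 - α)).inv₀ hΓ
  have h2 : Filter.Tendsto (fun n : ℕ => ((1 - α) * (n : ℝ)⁻¹ + 1)⁻¹) Filter.atTop (nhds 1) := by
    have := (tendsto_inv_atTop_nhds_zero_nat (𝕜 := ℝ)).const_mul (1 - α)
    have := (this.add_const 1).inv₀ (by simp)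
    simpa using this
  have h3 := h.mul h2
  rw [mul_one] at h3
  refine h3.congr' ?_
  filter_upwards [Filter.eventually_gt_atTop 0] with n hn
  have hn' : (0 : ℝ) < n := by exact_mod_cast hn
  have hc := (binCoeff_pos h1 n).ne'
  rw [Real.GammaSeq, Finset.prod_range_succ, hprod, Real.rpow_sub hn', Real.rpow_one]
  have hr : (n : ℝ) ^ α ≠ 0 := (Real.rpow_pos_of_pos hn' α).ne'
  have : (1 - α) + (n : ℝ) ≠ 0 := by positivity
  have : (1 - α) * (n : ℝ)⁻¹ + 1 ≠ 0 := by positivity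
  field_simp

theorem abs_log_one_sub_le {x : ℝ} (h0 : 0 ≤ x) (h1 : x ≤ 1 / 2) :
    |x + x ^ 2 / 2 + x ^ 3 / 3 + Real.log (1 - x)| ≤ 2 * x ^ 4 := by
  have h := Real.abs_log_sub_add_sum_range_le (x := x) (by rw [abs_of_nonneg h0]; linarith) 3
  rw [abs_of_nonneg h0] at h
  have e : ∑ i ∈ Finset.range 3, x ^ (i + 1) / ((i : ℝ) + 1) = x + x ^ 2 / 2 + x ^ 3 / 3 := by
    simp [Finset.sum_range_succ]; ring
  rw [e] at h
  refine h.trans ?_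
  rw [div_le_iff₀ (by linarith)]
  have : 0 ≤ x ^ 4 * (1 - 2 * x) := mul_nonneg (pow_nonneg h0 4) (by linarith)
  linarith [this, show x ^ (3 + 1) = x ^ 4 from rfl]

/-- For `x = 1/(k+1)` the difference of logarithms is the increment of `log (binCoeff α k * k^α)`;
the terms linear in `x` cancel. -/
theorem binCoeff_log_step {α : ℝ} (h0 : 0 < α) (h1 : α < 1) {x : ℝ} (hx0 : 0 ≤ x)
    (hx1 : x ≤ 1 / 2) :
    |Real.log (1 - α * x) - α * Real.log (1 - x)
      - ((α - α ^ 2) / 2 * x ^ 2 + (α - α ^ 3) / 3 * x ^ 3)| ≤ 4 * x ^ 4 := by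
  have hαx : α * x ≤ x := by nlinarith
  have hαx0 : 0 ≤ α * x := by positivity
  have e1 := abs_log_one_sub_le hαx0 (hαx.trans hx1)
  have e2 := abs_log_one_sub_le hx0 hx1
  have e3 : (α * x) ^ 4 ≤ x ^ 4 := pow_le_pow_left₀ hαx0 hαx 4
  rw [abs_le] at e1 e2 ⊢
  constructor <;> nlinarith [pow_nonneg hx0 4]

/-- Here `x / (1 - x) = 1/k`. The correction `a₁/k + a₂/k²` removes the `x²` and `x³` terms of the
increment, and the remaining `x⁴` is dominated by the telescoping difference `1/k³ - 1/(k+1)³`. -/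
theorem binCoeff_corrected_step {α : ℝ} (h0 : 0 < α) (h1 : α < 1) {x : ℝ} (hx0 : 0 < x)
    (hx1 : x ≤ 1 / 2) {a₁ a₂ : ℝ} (ha₁ : a₁ = (α - α ^ 2) / 2)
    (ha₂ : (α - α ^ 3) / 3 = a₁ + 2 * a₂) :
    |Real.log (1 - α * x) - α * Real.log (1 - x)
        + a₁ * (x - x / (1 - x)) + a₂ * (x ^ 2 - (x / (1 - x)) ^ 2)|
      ≤ (4 + 2 * |a₁| + 12 * |a₂|) * ((x / (1 - x)) ^ 3 - x ^ 3) := by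
  have h1x : 0 < 1 - x := by linarith
  have hx4 : 0 < x ^ 4 := by positivity
  have hmain := binCoeff_log_step h0 h1 hx0.le hx1
  rw [← ha₁, ha₂] at hmain
  have e1 : x - x / (1 - x) = -(x ^ 2 + x ^ 3 + x ^ 4 / (1 - x)) := by field_simp; ring
  have e2 : x ^ 2 - (x / (1 - x)) ^ 2
      = -(2 * x ^ 3) - x ^ 4 * ((3 - 2 * x) / (1 - x) ^ 2) := by field_simp; ring
  have b1 : |a₁ * (x ^ 4 / (1 - x))| ≤ |a₁| * (2 * x ^ 4) := by
    rw [abs_mul, abs_of_pos (a := x ^ 4 / (1 - x)) (by positivity)]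
    refine mul_le_mul_of_nonneg_left ?_ (abs_nonneg _)
    rw [div_le_iff₀ h1x]; nlinarith
  have b2 : |a₂ * (x ^ 4 * ((3 - 2 * x) / (1 - x) ^ 2))| ≤ |a₂| * (12 * x ^ 4) := by
    have hp : 0 ≤ (3 - 2 * x) / (1 - x) ^ 2 := div_nonneg (by linarith) (by positivity)
    have hq : (3 - 2 * x) / (1 - x) ^ 2 ≤ 12 := by
      rw [div_le_iff₀ (by positivity)]; nlinarith
    rw [abs_mul, abs_of_nonneg (a := x ^ 4 * _) (by positivity), mul_comm 12]
    gcongr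
  have b3 : x ^ 4 ≤ (x / (1 - x)) ^ 3 - x ^ 3 := by
    have h : x * (1 + x) ≤ x / (1 - x) := by
      rw [le_div_iff₀ h1x]
      have : 0 < x ^ 3 := by positivity
      linarith [show x * (1 + x) * (1 - x) = x - x ^ 3 by ring]
    have h' := pow_le_pow_left₀ (by positivity) h 3
    have : 0 ≤ 2 * x ^ 4 + 3 * x ^ 5 + x ^ 6 := by positivity
    linarith [show (x * (1 + x)) ^ 3 = x ^ 3 + x ^ 4 + (2 * x ^ 4 + 3 * x ^ 5 + x ^ 6) by ring]
  have e3 : Real.log (1 - α * x) - α * Real.log (1 - x)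
        + a₁ * (x - x / (1 - x)) + a₂ * (x ^ 2 - (x / (1 - x)) ^ 2)
      = (Real.log (1 - α * x) - α * Real.log (1 - x) - (a₁ * x ^ 2 + (a₁ + 2 * a₂) * x ^ 3))
        - a₁ * (x ^ 4 / (1 - x)) - a₂ * (x ^ 4 * ((3 - 2 * x) / (1 - x) ^ 2)) := by
    rw [e1, e2]; ring
  calc _ ≤ 4 * x ^ 4 + |a₁| * (2 * x ^ 4) + |a₂| * (12 * x ^ 4) := by
        rw [e3]
        exact (abs_sub _ _).trans (add_le_add ((abs_sub _ _).trans (add_le_add hmain b1)) b2)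
    _ = (4 + 2 * |a₁| + 12 * |a₂|) * x ^ 4 := by ring
    _ ≤ _ := mul_le_mul_of_nonneg_left b3 (by positivity)

/-- A two-term expansion of `log (binCoeff α k * k ^ α)`. -/
theorem exists_log_binCoeff_expansion {α : ℝ} (h0 : 0 < α) (h1 : α < 1) :
    ∃ a₂ D : ℝ, ∀ k : ℕ, 1 ≤ k →
      |-Real.log (Real.Gamma (1 - α)) - Real.log (binCoeff α k * (k : ℝ) ^ α)
        - ((α - α ^ 2) / 2 * (k : ℝ)⁻¹ + a₂ * (k : ℝ)⁻¹ ^ 2)| ≤ D * (k : ℝ)⁻¹ ^ 3 := by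
  set a₁ := (α - α ^ 2) / 2 with ha₁
  set a₂ := ((α - α ^ 3) / 3 - a₁) / 2 with ha₂
  set D := 4 + 2 * |a₁| + 12 * |a₂| with hD
  refine ⟨a₂, D, ?_⟩
  set ℓ : ℕ → ℝ := fun k => Real.log (binCoeff α k * (k : ℝ) ^ α) with hℓ
  set d : ℕ → ℝ := fun k => ℓ k + (a₁ * (k : ℝ)⁻¹ + a₂ * (k : ℝ)⁻¹ ^ 2) with hd
  have hΓ : 0 < Real.Gamma (1 - α) := Real.Gamma_pos_of_pos (by linarith)
  have hlim : Filter.Tendsto d Filter.atTop (nhds (-Real.log (Real.Gamma (1 - α)))) := by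
    have hl := (tendsto_binCoeff_mul_rpow h1).log (inv_ne_zero hΓ.ne')
    rw [Real.log_inv] at hl
    have hi := tendsto_inv_atTop_nhds_zero_nat (𝕜 := ℝ)
    have := hl.add ((hi.const_mul a₁).add ((hi.pow 2).const_mul a₂))
    simpa [hd, hℓ] using this
  have hinv := tendsto_inv_atTop_nhds_zero_nat (𝕜 := ℝ)
  have hstep : ∀ k : ℕ, 1 ≤ k →
      |d (k + 1) - d k| ≤ D * ((k : ℝ)⁻¹ ^ 3 - ((k + 1 : ℕ) : ℝ)⁻¹ ^ 3) := by
    intro k hk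
    have hk' : (1 : ℝ) ≤ k := by exact_mod_cast hk
    set x : ℝ := ((k + 1 : ℕ) : ℝ)⁻¹ with hx
    have hx' : x = ((k : ℝ) + 1)⁻¹ := by rw [hx]; push_cast; rfl
    have hx0 : 0 < x := by rw [hx']; positivity
    have hx1 : x ≤ 1 / 2 := by
      rw [hx', inv_le_comm₀ (by positivity) (by norm_num)]
      norm_num; linarith
    have hkx : (k : ℝ) = (1 - x) / x := by
      rw [hx']
      have : (k : ℝ) + 1 ≠ 0 := by positivity
      field_simp
      ring
    have hxk : (k : ℝ)⁻¹ = x / (1 - x) := by rw [hkx, inv_div]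
    have h1x : 0 < 1 - x := by linarith
    have hℓs : ℓ (k + 1) - ℓ k = Real.log (1 - α * x) - α * Real.log (1 - x) := by
      have hp := binCoeff_pos h1 k
      have hαx : 0 < 1 - α * x := by nlinarith
      have hk0 : (0 : ℝ) < k := by positivity
      simp only [hℓ]
      rw [binCoeff_succ, Real.log_mul (by
          rw [show (1 - α / ((k : ℝ) + 1)) = 1 - α * x by rw [hx']; rfl]; positivity)
          (by positivity), Real.log_mul hp.ne' (by positivity),
        Real.log_mul (by rw [show (1 - α / ((k : ℝ) + 1)) = 1 - α * x by rw [hx']; rfl]; positivity)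
          hp.ne', Real.log_rpow (by positivity), Real.log_rpow hk0,
        show (1 - α / ((k : ℝ) + 1)) = 1 - α * x by rw [hx']; rfl,
        show (((k + 1 : ℕ) : ℝ)) = x⁻¹ by rw [hx, inv_inv], Real.log_inv, hkx,
        Real.log_div h1x.ne' hx0.ne']
      ring
    have e3 : d (k + 1) - d k = Real.log (1 - α * x) - α * Real.log (1 - x)
        + a₁ * (x - x / (1 - x)) + a₂ * (x ^ 2 - (x / (1 - x)) ^ 2) := by
      rw [← hℓs, ← hxk]
      simp only [hd, hx]; ring
    rw [e3, hxk]
    exact binCoeff_corrected_step h0 h1 hx0 hx1 ha₁ (by rw [ha₂]; ring)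
  -- Adding or subtracting `D/k³` makes the corrected sequence monotone with an unchanged limit, so
  -- the distance to the limit is at most `D/k³`. The shift to `k + 1` avoids the index `0`.
  have hanti : Antitone fun k : ℕ => d (k + 1) + D * ((k + 1 : ℕ) : ℝ)⁻¹ ^ 3 := by
    refine antitone_nat_of_succ_le fun k => ?_
    have := (abs_le.1 (hstep (k + 1) (by omega))).2
    linarith
  have hmono : Monotone fun k : ℕ => d (k + 1) - D * ((k + 1 : ℕ) : ℝ)⁻¹ ^ 3 := by
    refine monotone_nat_of_le_succ fun k => ?_
    have := (abs_le.1 (hstep (k + 1) (by omega))).1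
    linarith
  have hz : Filter.Tendsto (fun k : ℕ => D * (k : ℝ)⁻¹ ^ 3) Filter.atTop (nhds 0) := by
    simpa using (hinv.pow 3).const_mul D
  have l1 := (hlim.add hz).comp (Filter.tendsto_add_atTop_nat 1)
  have l2 := (hlim.sub hz).comp (Filter.tendsto_add_atTop_nat 1)
  rw [add_zero] at l1
  rw [sub_zero] at l2
  intro k hk
  obtain ⟨j, rfl⟩ : ∃ j, k = j + 1 := ⟨k - 1, by omega⟩
  have u1 := hanti.le_of_tendsto l1 j
  have u2 := hmono.ge_of_tendsto l2 j
  have hdj : d (j + 1) = ℓ (j + 1) + (a₁ * ((j + 1 : ℕ) : ℝ)⁻¹ + a₂ * ((j + 1 : ℕ) : ℝ)⁻¹ ^ 2) := rfl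
  rw [abs_le]
  constructor <;> linarith

theorem exists_rpow_div_binCoeff_expansion {α : ℝ} (h0 : 0 < α) (h1 : α < 1) :
    ∃ e C : ℝ, ∃ K : ℕ, 0 ≤ C ∧ ∀ k : ℕ, 1 ≤ k → K ≤ k →
      |(k : ℝ) ^ (-α) / (Real.Gamma (1 - α) * binCoeff α k)
        - (1 + (α - α ^ 2) / 2 * (k : ℝ)⁻¹ + e * (k : ℝ)⁻¹ ^ 2)| ≤ C * (k : ℝ)⁻¹ ^ 3 := by
  obtain ⟨a₂, D, h⟩ := exists_log_binCoeff_expansion h0 h1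
  set a₁ := (α - α ^ 2) / 2 with ha₁
  have hD : 0 ≤ D := by simpa using (abs_nonneg _).trans (h 1 le_rfl)
  set Y := |a₁| + |a₂| + D with hY
  have hY0 : 0 ≤ Y := by positivity
  -- The second-order coefficient of `exp (a₁ x + a₂ x² + O(x³))` is `a₂ + a₁²/2`. The threshold
  -- `⌈Y⌉₊` ensures that the exponent is at most `1` in absolute value, as the exponential remainder
  -- bound requires.
  refine ⟨a₂ + a₁ ^ 2 / 2, Y ^ 3 + D + 2 * Y ^ 2, ⌈Y⌉₊, by positivity, fun k hk hK => ?_⟩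
  have hk0 : (0 : ℝ) < k := by exact_mod_cast hk
  have hΓ : 0 < Real.Gamma (1 - α) := Real.Gamma_pos_of_pos (by linarith)
  have hc := binCoeff_pos h1 k
  have hYk : Y ≤ k := (Nat.le_ceil Y).trans (by exact_mod_cast hK)
  have hk := h k hk
  set y := -Real.log (Real.Gamma (1 - α)) - Real.log (binCoeff α k * (k : ℝ) ^ α) with hy
  have hm : (k : ℝ) ^ (-α) / (Real.Gamma (1 - α) * binCoeff α k) = Real.exp y := by
    rw [hy, Real.exp_sub, Real.exp_neg, Real.exp_log hΓ, Real.exp_log (by positivity),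
      Real.rpow_neg hk0.le]
    field_simp
  set x : ℝ := (k : ℝ)⁻¹ with hx
  have hx0 : 0 < x := by positivity
  have hx1 : x ≤ 1 := inv_le_one_of_one_le₀ (by exact_mod_cast ‹1 ≤ k›)
  have hYx : Y * x ≤ 1 := by rw [hx, ← div_eq_mul_inv, div_le_one hk0]; exact hYk
  have hx2 : x ^ 2 ≤ x := by nlinarith
  have hx3 : x ^ 3 ≤ x ^ 2 := by nlinarith [sq_nonneg x]
  set r := y - (a₁ * x + a₂ * x ^ 2) with hr
  have hw : |a₂ * x ^ 2 + r| ≤ (|a₂| + D) * x ^ 2 := by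
    refine (abs_add_le _ _).trans ?_
    rw [abs_mul, abs_of_pos (a := x ^ 2) (by positivity)]
    nlinarith
  have hax : |a₁ * x| = |a₁| * x := by rw [abs_mul, abs_of_pos hx0]
  have hyY : |y| ≤ Y * x := by
    have : y = a₁ * x + (a₂ * x ^ 2 + r) := by rw [hr]; ring
    rw [this]
    refine (abs_add_le _ _).trans ?_
    rw [hax]
    have : (|a₂| + D) * x ^ 2 ≤ (|a₂| + D) * x := by gcongr
    rw [hY]; linarith
  have hexp : |Real.exp y - (1 + y + y ^ 2 / 2)| ≤ Y ^ 3 * x ^ 3 := by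
    have hb := Real.exp_bound (hyY.trans hYx) (n := 3) (by norm_num)
    have e : ∑ m ∈ Finset.range 3, y ^ m / (m.factorial : ℝ) = 1 + y + y ^ 2 / 2 := by
      simp [Finset.sum_range_succ, Nat.factorial]
    rw [e] at hb
    have h3 : |y| ^ 3 ≤ (Y * x) ^ 3 := pow_le_pow_left₀ (abs_nonneg _) hyY 3
    have h4 : ((Nat.succ 3 : ℕ) : ℝ) / ((Nat.factorial 3 : ℕ) * (3 : ℕ) : ℝ) ≤ 1 := by
      norm_num [Nat.factorial]
    calc _ ≤ _ := hb
      _ ≤ (Y * x) ^ 3 * 1 := by gcongr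
      _ = _ := by ring
  have hsq : |y ^ 2 - (a₁ * x) ^ 2| ≤ 2 * Y ^ 2 * x ^ 3 := by
    have e : y ^ 2 - (a₁ * x) ^ 2 = (a₂ * x ^ 2 + r) * (y + a₁ * x) := by rw [hr]; ring
    have h2 : |y + a₁ * x| ≤ 2 * Y * x := by
      refine (abs_add_le _ _).trans ?_
      rw [hax]
      have : |a₁| * x ≤ Y * x := by gcongr; rw [hY]; linarith [abs_nonneg a₂]
      linarith
    have h3 : |a₂ * x ^ 2 + r| ≤ Y * x ^ 2 := hw.trans (by gcongr; rw [hY]; linarith [abs_nonneg a₁])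
    rw [e, abs_mul]
    calc _ ≤ (Y * x ^ 2) * (2 * Y * x) := by gcongr
      _ = _ := by ring
  rw [hm]
  have e : Real.exp y - (1 + a₁ * x + (a₂ + a₁ ^ 2 / 2) * x ^ 2)
      = (Real.exp y - (1 + y + y ^ 2 / 2)) + r + (y ^ 2 - (a₁ * x) ^ 2) / 2 := by rw [hr]; ring
  rw [e]
  have h5 : |(y ^ 2 - (a₁ * x) ^ 2) / 2| ≤ 2 * Y ^ 2 * x ^ 3 := by
    rw [abs_div, abs_two]
    linarith [abs_nonneg (y ^ 2 - (a₁ * x) ^ 2)]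
  calc _ ≤ |Real.exp y - (1 + y + y ^ 2 / 2)| + |r| + |(y ^ 2 - (a₁ * x) ^ 2) / 2| :=
        abs_add_three _ _ _
    _ ≤ Y ^ 3 * x ^ 3 + D * x ^ 3 + 2 * Y ^ 2 * x ^ 3 := by gcongr
    _ = _ := by ring

theorem exists_one_sub_rpow_expansion (β : ℝ) :
    ∃ C δ : ℝ, 0 ≤ C ∧ 0 < δ ∧ ∀ y : ℝ, |y| < δ →
      |(1 - y) ^ β - (1 - β * y + β * (β - 1) / 2 * y ^ 2)| ≤ C * |y| ^ 3 := by
  have h := (Real.one_add_rpow_hasFPowerSeriesAt_zero (a := β)).isBigO_sub_partialSum_pow 3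
  obtain ⟨C, hC0, hC⟩ := h.exists_nonneg
  rw [Asymptotics.isBigOWith_iff, Metric.eventually_nhds_iff] at hC
  obtain ⟨δ, hδ, hb⟩ := hC
  refine ⟨C, δ, hC0, hδ, fun y hy => ?_⟩
  have h2 : Ring.choose β 2 = β * (β - 1) / 2 := by
    have := succ_mul_choose β 1
    rw [Ring.choose_one_right] at this
    push_cast at this
    linarith
  have := hb (y := -y) (by simpa using hy)
  simp only [FormalMultilinearSeries.partialSum, Finset.sum_range_succ, Finset.sum_range_zero,
    binomialSeries_apply, Ring.choose_zero_right, Ring.choose_one_right, h2] at this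
  simp only [Real.norm_eq_abs, abs_neg, abs_pow, abs_abs] at this
  refine le_trans (le_of_eq ?_) this
  congr 1
  simp only [zero_add, smul_eq_mul, List.ofFn_const, List.prod_replicate, pow_zero,
    pow_one]
  ring_nf

/-- The constant depends on the coefficients only through the bounds `P` and `S`, which keeps the
later expansions uniform in the shift `φ`. -/
theorem abs_mul_sub_expansion_le {h m t p₁ p₂ s₁ s₂ P S C D : ℝ} (h0 : 0 ≤ h) (h1 : h ≤ 1)
    (hm : |m - (1 + p₁ * h + p₂ * h ^ 2)| ≤ C * h ^ 3)
    (ht : |t - (1 + s₁ * h + s₂ * h ^ 2)| ≤ D * h ^ 3)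
    (hp₁ : |p₁| ≤ P) (hp₂ : |p₂| ≤ P) (hs₁ : |s₁| ≤ S) (hs₂ : |s₂| ≤ S)
    (hC : 0 ≤ C) (hD : 0 ≤ D) :
    |m * t - (1 + (p₁ + s₁) * h + (p₂ + s₂ + p₁ * s₁) * h ^ 2)|
      ≤ (3 * (P * S) + C * (1 + 2 * S + D) + (1 + 2 * P) * D) * h ^ 3 := by
  have hP : 0 ≤ P := (abs_nonneg _).trans hp₁
  have hS : 0 ≤ S := (abs_nonneg _).trans hs₁
  have hh2 : h ^ 2 ≤ 1 := pow_le_one₀ h0 h1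
  have hh3 : h ^ 3 ≤ 1 := pow_le_one₀ h0 h1
  have hq : ∀ {u v Q : ℝ}, |u| ≤ Q → |v| ≤ Q → |1 + u * h + v * h ^ 2| ≤ 1 + 2 * Q := by
    intro u v Q hu hv
    have hQ : 0 ≤ Q := (abs_nonneg _).trans hu
    refine (abs_add_three _ _ _).trans ?_
    rw [abs_one, abs_mul, abs_mul, abs_of_nonneg h0, abs_of_nonneg (pow_nonneg h0 2)]
    have i1 : |u| * h ≤ Q * 1 := by gcongr
    have i2 : |v| * h ^ 2 ≤ Q * 1 := by gcongr
    linarith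
  set r := m - (1 + p₁ * h + p₂ * h ^ 2) with hr
  set r' := t - (1 + s₁ * h + s₂ * h ^ 2) with hr'
  have htb : |t| ≤ 1 + 2 * S + D := by
    have : t = (1 + s₁ * h + s₂ * h ^ 2) + r' := by rw [hr']; ring
    rw [this]
    refine (abs_add_le _ _).trans (add_le_add (hq hs₁ hs₂) (ht.trans ?_))
    nlinarith
  have e : m * t - (1 + (p₁ + s₁) * h + (p₂ + s₂ + p₁ * s₁) * h ^ 2)
      = (p₁ * s₂ + p₂ * s₁ + p₂ * s₂ * h) * h ^ 3 + r * t
        + (1 + p₁ * h + p₂ * h ^ 2) * r' := by rw [hr, hr']; ring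
  have b1 : |(p₁ * s₂ + p₂ * s₁ + p₂ * s₂ * h) * h ^ 3| ≤ 3 * (P * S) * h ^ 3 := by
    rw [abs_mul, abs_of_nonneg (pow_nonneg h0 3)]
    gcongr
    refine (abs_add_three _ _ _).trans ?_
    simp only [abs_mul, abs_of_nonneg h0]
    have i1 : |p₁| * |s₂| ≤ P * S := by gcongr
    have i2 : |p₂| * |s₁| ≤ P * S := by gcongr
    have i3 : |p₂| * |s₂| * h ≤ P * S * 1 := by gcongr
    linarith
  have b2 : |r * t| ≤ C * (1 + 2 * S + D) * h ^ 3 := by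
    rw [abs_mul]
    calc _ ≤ (C * h ^ 3) * (1 + 2 * S + D) := by gcongr
      _ = _ := by ring
  have b3 : |(1 + p₁ * h + p₂ * h ^ 2) * r'| ≤ (1 + 2 * P) * D * h ^ 3 := by
    rw [abs_mul]
    calc _ ≤ (1 + 2 * P) * (D * h ^ 3) := by gcongr; exact hq hp₁ hp₂
      _ = _ := by ring
  rw [e]
  refine (abs_add_three _ _ _).trans ?_
  linarith

theorem exists_binCoeff_le {α : ℝ} (h1 : α < 1) :
    ∃ C : ℝ, 0 ≤ C ∧ ∀ k : ℕ, 1 ≤ k → binCoeff α k ≤ C * (k : ℝ) ^ (-α) := by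
  obtain ⟨C, hC⟩ := (tendsto_binCoeff_mul_rpow h1).bddAbove_range
  have hb : ∀ k : ℕ, binCoeff α k * (k : ℝ) ^ α ≤ C := fun k => hC ⟨k, rfl⟩
  have hC0 : 0 ≤ C :=
    le_trans (mul_nonneg (binCoeff_pos h1 1).le (Real.rpow_nonneg (by positivity) _)) (hb 1)
  refine ⟨C, hC0, fun k hk => ?_⟩
  have hk0 : (0 : ℝ) < k := by exact_mod_cast hk
  rw [Real.rpow_neg hk0.le, ← div_eq_mul_inv, le_div_iff₀ (Real.rpow_pos_of_pos hk0 α)]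
  exact hb k

/-- A uniform expansion of `(k - φ) ^ β` relative to `k ^ (β + α)` times `binCoeff α k`. -/
theorem exists_shifted_rpow_expansion {α : ℝ} (h0 : 0 < α) (h1 : α < 1) (β : ℝ) :
    ∃ e C : ℝ, ∃ K : ℕ, 0 ≤ C ∧ ∀ φ : ℝ, 0 ≤ φ → φ ≤ 2 → ∀ k : ℕ, 1 ≤ k → K ≤ k →
      φ ≤ k ∧
      |(k : ℝ) ^ (-α) / (Real.Gamma (1 - α) * binCoeff α k) * (1 - φ * (k : ℝ)⁻¹) ^ β
        - (1 + ((α - α ^ 2) / 2 - β * φ) * (k : ℝ)⁻¹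
          + (e + β * (β - 1) / 2 * φ ^ 2 - (α - α ^ 2) / 2 * (β * φ)) * (k : ℝ)⁻¹ ^ 2)|
      ≤ C * (k : ℝ)⁻¹ ^ 3 := by
  obtain ⟨e, C, K, hC0, hm⟩ := exists_rpow_div_binCoeff_expansion h0 h1
  obtain ⟨D, δ, hD0, hδ, ht⟩ := exists_one_sub_rpow_expansion β
  set a₁ := (α - α ^ 2) / 2 with ha₁
  set P := |a₁| + |e| with hP
  set S := |β| * 2 + |β * (β - 1) / 2| * 4 with hS
  -- The threshold forces `k ≥ 2 ≥ φ` and `φ/k < δ`; the factors `8 = 2³` come from `φ ≤ 2`.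
  refine ⟨e, 3 * (P * S) + C * (1 + 2 * S + 8 * D) + (1 + 2 * P) * (8 * D),
    max (max K 2) (⌊2 / δ⌋₊ + 1), by positivity, fun φ hφ0 hφ2 k hk hK => ?_⟩
  have hk0 : (0 : ℝ) < k := by exact_mod_cast hk
  have hK1 : K ≤ k := (le_max_left _ _).trans ((le_max_left _ _).trans hK)
  have hK2 : 2 ≤ k := (le_max_right _ _).trans ((le_max_left _ _).trans hK)
  have hK3 : 2 / δ < k := (Nat.lt_floor_add_one (2 / δ)).trans_le
    (by exact_mod_cast (le_max_right _ _).trans hK)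
  have hk2 : (2 : ℝ) ≤ k := by exact_mod_cast hK2
  refine ⟨hφ2.trans hk2, ?_⟩
  set x : ℝ := (k : ℝ)⁻¹ with hx
  have hx0 : 0 < x := by positivity
  have hx1 : x ≤ 1 := inv_le_one_of_one_le₀ (by linarith)
  have hy0 : 0 ≤ φ * x := by positivity
  have hyδ : |φ * x| < δ := by
    rw [abs_of_nonneg hy0]
    calc φ * x ≤ 2 * x := by gcongr
      _ < δ := by
        rw [hx, ← div_eq_mul_inv, div_lt_iff₀ hk0]
        rw [div_lt_iff₀ hδ] at hK3
        linarith
  have ht' : |(1 - φ * x) ^ β - (1 + (-(β * φ)) * x + (β * (β - 1) / 2 * φ ^ 2) * x ^ 2)|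
      ≤ 8 * D * x ^ 3 := by
    have := ht (φ * x) hyδ
    rw [abs_of_nonneg hy0] at this
    have e1 : (φ * x) ^ 3 ≤ (2 * x) ^ 3 := pow_le_pow_left₀ hy0 (by gcongr) 3
    calc _ = |(1 - φ * x) ^ β - (1 - β * (φ * x) + β * (β - 1) / 2 * (φ * x) ^ 2)| := by
          congr 1; ring
      _ ≤ D * (φ * x) ^ 3 := this
      _ ≤ D * (2 * x) ^ 3 := by gcongr
      _ = _ := by ring
  have hφsq : φ ^ 2 ≤ 4 := by nlinarith
  have := abs_mul_sub_expansion_le (P := P) (S := S) hx0.le hx1 (hm k hk hK1) ht'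
    (by rw [hP]; linarith [abs_nonneg e]) (by rw [hP]; linarith [abs_nonneg a₁])
    (by
      rw [abs_neg, abs_mul, abs_of_nonneg hφ0, hS]
      have : |β| * φ ≤ |β| * 2 := by gcongr
      linarith [abs_nonneg (β * (β - 1) / 2)])
    (by
      rw [abs_mul, abs_of_nonneg (sq_nonneg φ), hS]
      have : |β * (β - 1) / 2| * φ ^ 2 ≤ |β * (β - 1) / 2| * 4 := by gcongr
      linarith [abs_nonneg β])
    hC0 (by positivity)
  refine le_trans (le_of_eq ?_) this
  congr 1
  ring

/-! ### Sampled fractional kernels expanded in binomial coefficients -/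

theorem sumAbsLE_mk_of_tail {f : ℕ → ℝ} {K : ℕ} {B D s : ℝ} (hs : 1 < s) (hD : 0 ≤ D)
    (hhead : ∑ k ∈ Finset.range K, |f k| ≤ B)
    (htail : ∀ k, K ≤ k → |f k| ≤ D * (k : ℝ) ^ (-s)) :
    SumAbsLE (PowerSeries.mk f) (B + D * ∑' k : ℕ, (k : ℝ) ^ (-s)) := by
  have hsum : Summable fun k : ℕ => (k : ℝ) ^ (-s) := Real.summable_nat_rpow.2 (by linarith)
  intro N
  simp only [PowerSeries.coeff_mk]
  calc ∑ k ∈ Finset.range N, |f k|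
      ≤ ∑ k ∈ Finset.range N, ((if k < K then |f k| else 0) + D * (k : ℝ) ^ (-s)) := by
        refine Finset.sum_le_sum fun k _ => ?_
        have : 0 ≤ D * (k : ℝ) ^ (-s) := by positivity
        split_ifs with h
        · linarith
        · simpa using htail k (not_lt.1 h)
    _ = ∑ k ∈ Finset.range N with k < K, |f k| + D * ∑ k ∈ Finset.range N, (k : ℝ) ^ (-s) := by
        rw [Finset.sum_add_distrib, Finset.mul_sum, Finset.sum_filter]
    _ ≤ ∑ k ∈ Finset.range K, |f k| + D * ∑' k : ℕ, (k : ℝ) ^ (-s) := by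
        refine add_le_add ?_ (mul_le_mul_of_nonneg_left ?_ hD)
        · refine Finset.sum_le_sum_of_subset_of_nonneg (fun k hk => ?_) fun _ _ _ => abs_nonneg _
          simpa using (Finset.mem_filter.1 hk).2
        · exact hsum.sum_le_tsum _ fun k _ => by positivity
    _ ≤ _ := by linarith

theorem coeff_binSer_sub_two {α : ℝ} (h1 : α < 1) (k : ℕ) :
    PowerSeries.coeff k (binSer (α - 2) 1) = (k + (1 - α)) / (1 - α) * binCoeff α k := by
  have := coeff_binSer_sub_one (α - 1) (by linarith) k
  rw [show α - 2 = α - 1 - 1 by ring, this, binCoeff]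
  congr 2 <;> ring

theorem coeff_binSer_sub_three {α : ℝ} (h1 : α < 1) (k : ℕ) :
    PowerSeries.coeff k (binSer (α - 3) 1)
      = (k + (2 - α)) * (k + (1 - α)) / ((2 - α) * (1 - α)) * binCoeff α k := by
  have := coeff_binSer_sub_one (α - 2) (by linarith) k
  rw [show α - 3 = α - 2 - 1 by ring, this, coeff_binSer_sub_two h1]
  have : 1 - α ≠ 0 := by linarith
  have : 2 - α ≠ 0 := by linarith
  rw [show -(α - 2) = 2 - α by ring]
  field_simp
  ring

theorem rpow_neg_mul_pow_inv {α : ℝ} {k : ℝ} (hk : 0 < k) :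
    k ^ (-α) * k⁻¹ = k ^ (-(1 + α)) := by
  rw [← Real.rpow_neg_one, ← Real.rpow_add hk]
  congr 1
  ring

/-- The sampled kernel `(k - φ)₊ ^ (2 - α) / Γ(3 - α)` in terms of binomial coefficients, with an
error that is summable uniformly in `φ`. -/
theorem exists_quadratic_kernel_expansion {α : ℝ} (h0 : 0 < α) (h1 : α < 1) :
    ∃ C : ℝ, ∀ φ : ℝ, 0 ≤ φ → φ ≤ 2 → ∃ ρ : ℝ, |ρ| ≤ C ∧
      SumAbsLE (PowerSeries.mk (fun k : ℕ => (max ((k : ℝ) - φ) 0) ^ (2 - α) / Real.Gamma (3 - α))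
        - (binSer (α - 3) 1 + (-((3 - α) / 2 + φ)) • binSer (α - 2) 1 + ρ • binSer (α - 1) 1)) C := by
  obtain ⟨e, C, K, hC0, hexp⟩ := exists_shifted_rpow_expansion h0 h1 (2 - α)
  obtain ⟨B, hB0, hB⟩ := exists_binCoeff_le h1
  set a₁ := (α - α ^ 2) / 2 with ha₁
  set G := Real.Gamma (1 - α) with hG
  have hG0 : 0 < G := Real.Gamma_pos_of_pos (by linarith)
  have hα1 : 0 < 1 - α := by linarith
  have hα2 : 0 < 2 - α := by linarith
  have hα3 : 0 < 3 - α := by linarith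
  have hΓ3 : Real.Gamma (3 - α) = (2 - α) * (1 - α) * G := by
    rw [show 3 - α = (2 - α) + 1 by ring, Real.Gamma_add_one hα2.ne',
      show 2 - α = (1 - α) + 1 by ring, Real.Gamma_add_one hα1.ne']
    ring
  set g := (2 - α) * (1 - α) with hg
  have hg0 : 0 < g := by positivity
  set R := (|e| + 4 * |(2 - α) * (2 - α - 1) / 2| + |a₁| * (2 * (2 - α))) / g + 1
    + ((3 - α) / 2 + 2) with hR
  set K' := max K 1 with hK'
  -- The asymptotics hold only for `k ≥ K'`; `Hd` bounds the finitely many earlier terms uniformly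
  -- in `φ`.
  set Hd := ∑ k ∈ Finset.range K', ((k : ℝ) ^ (2 - α) / (g * G)
    + |PowerSeries.coeff k (binSer (α - 3) 1)| + ((3 - α) / 2 + 2) *
      |PowerSeries.coeff k (binSer (α - 2) 1)|
    + R * |PowerSeries.coeff k (binSer (α - 1) 1)|) with hHd
  set Z := ∑' k : ℕ, (k : ℝ) ^ (-(1 + α)) with hZ
  refine ⟨max R (Hd + B / g * C * Z), fun φ hφ0 hφ2 => ?_⟩
  set X := e + (2 - α) * (2 - α - 1) / 2 * φ ^ 2 - a₁ * ((2 - α) * φ) with hX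
  -- Divided by `binCoeff α k`, the three binomial sequences are polynomials in `k` of degree `2`,
  -- `1`, `0`. The coefficient `-((3 - α)/2 + φ)` matches the order `k`, and `ρ` is chosen to match
  -- the constant order; what is left is `O(k^(-1-α))`, hence summable.
  set ρ := X / g - 1 + ((3 - α) / 2 + φ) with hρ
  have hρR : |ρ| ≤ R := by
    have hφsq : φ ^ 2 ≤ 4 := by nlinarith
    have hX' : |X| ≤ |e| + 4 * |(2 - α) * (2 - α - 1) / 2| + |a₁| * (2 * (2 - α)) := by
      refine (abs_sub _ _).trans (add_le_add ((abs_add_le _ _).trans (add_le_add le_rfl ?_)) ?_)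
      · rw [abs_mul, abs_of_nonneg (sq_nonneg φ), mul_comm 4]; gcongr
      · rw [abs_mul, abs_of_nonneg (a := (2 - α) * φ) (by positivity), mul_comm 2]; gcongr
    refine (abs_add_le _ _).trans (add_le_add ((abs_sub _ _).trans (add_le_add ?_ ?_)) ?_)
    · rw [abs_div, abs_of_pos hg0]; gcongr
    · simp
    · rw [abs_of_nonneg (by positivity)]; linarith
  refine ⟨ρ, hρR.trans (le_max_left _ _), SumAbsLE.mono ?_ (le_max_right _ _)⟩
  have hser : PowerSeries.mk (fun k : ℕ => (max ((k : ℝ) - φ) 0) ^ (2 - α) / Real.Gamma (3 - α))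
        - (binSer (α - 3) 1 + (-((3 - α) / 2 + φ)) • binSer (α - 2) 1 + ρ • binSer (α - 1) 1)
      = PowerSeries.mk fun k : ℕ => (max ((k : ℝ) - φ) 0) ^ (2 - α) / (g * G)
        - (PowerSeries.coeff k (binSer (α - 3) 1)
          + (-((3 - α) / 2 + φ)) * PowerSeries.coeff k (binSer (α - 2) 1)
          + ρ * PowerSeries.coeff k (binSer (α - 1) 1)) := by
    ext k
    simp only [map_sub, map_add, PowerSeries.coeff_mk, PowerSeries.coeff_smul, smul_eq_mul, hΓ3]
  rw [hser]
  refine sumAbsLE_mk_of_tail (K := K') (by linarith) (by positivity) ?_ ?_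
  · refine Finset.sum_le_sum fun k _ => ?_
    have hmax : (max ((k : ℝ) - φ) 0) ^ (2 - α) ≤ (k : ℝ) ^ (2 - α) :=
      Real.rpow_le_rpow (le_max_right _ _) (max_le (by linarith) (by positivity)) hα2.le
    have b1 : |(max ((k : ℝ) - φ) 0) ^ (2 - α) / (g * G)| ≤ (k : ℝ) ^ (2 - α) / (g * G) := by
      rw [abs_of_nonneg (div_nonneg (Real.rpow_nonneg (le_max_right _ _) _) (by positivity))]
      gcongr
    have b2 : |(-((3 - α) / 2 + φ)) * PowerSeries.coeff k (binSer (α - 2) 1)|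
        ≤ ((3 - α) / 2 + 2) * |PowerSeries.coeff k (binSer (α - 2) 1)| := by
      rw [abs_mul, abs_neg, abs_of_nonneg (by positivity)]
      gcongr
    have b3 : |ρ * PowerSeries.coeff k (binSer (α - 1) 1)|
        ≤ R * |PowerSeries.coeff k (binSer (α - 1) 1)| := by
      rw [abs_mul]; gcongr
    refine (abs_sub _ _).trans ?_
    have := abs_add_three (PowerSeries.coeff k (binSer (α - 3) 1))
      ((-((3 - α) / 2 + φ)) * PowerSeries.coeff k (binSer (α - 2) 1))
      (ρ * PowerSeries.coeff k (binSer (α - 1) 1))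
    linarith
  · intro k hk
    have hk1 : 1 ≤ k := (le_max_right _ _).trans hk
    have hk0 : (0 : ℝ) < k := by exact_mod_cast hk1
    obtain ⟨hφk, hmt⟩ := hexp φ hφ0 hφ2 k hk1 ((le_max_left _ _).trans hk)
    have hc := binCoeff_pos h1 k
    have hcB := hB k hk1
    rw [← hX] at hmt
    rw [coeff_binSer_sub_three h1, coeff_binSer_sub_two h1,
      show PowerSeries.coeff k (binSer (α - 1) 1) = binCoeff α k from rfl]
    have hmax : (max ((k : ℝ) - φ) 0) ^ (2 - α)
        = (k : ℝ) ^ 2 * (k : ℝ) ^ (-α) * (1 - φ * (k : ℝ)⁻¹) ^ (2 - α) := by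
      have e1 : max ((k : ℝ) - φ) 0 = k * (1 - φ * (k : ℝ)⁻¹) := by
        rw [max_eq_left (by linarith)]; field_simp
      have e2 : 0 ≤ 1 - φ * (k : ℝ)⁻¹ := by
        rw [← div_eq_mul_inv, sub_nonneg, div_le_one hk0]; exact hφk
      rw [e1, Real.mul_rpow hk0.le e2]
      congr 1
      rw [← Real.rpow_natCast, ← Real.rpow_add hk0]
      congr 1
    rw [hmax]
    set t := (1 - φ * (k : ℝ)⁻¹) ^ (2 - α) with ht
    set m := (k : ℝ) ^ (-α) / (G * binCoeff α k) with hm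
    have hkm : (k : ℝ) ^ (-α) = m * (G * binCoeff α k) := by rw [hm]; field_simp
    have hkey : (k : ℝ) ^ 2 * (k : ℝ) ^ (-α) * t / (g * G)
        - ((k + (2 - α)) * (k + (1 - α)) / g * binCoeff α k
          + (-((3 - α) / 2 + φ)) * ((k + (1 - α)) / (1 - α) * binCoeff α k) + ρ * binCoeff α k)
        = binCoeff α k / g * (k : ℝ) ^ 2 * (m * t - (1 + (a₁ - (2 - α) * φ) * (k : ℝ)⁻¹
          + X * (k : ℝ)⁻¹ ^ 2)) := by
      rw [hkm, hρ, ha₁]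
      clear_value X m t
      rw [hg]
      field_simp
      ring
    rw [hkey, abs_mul, abs_of_pos (by positivity)]
    calc binCoeff α k / g * (k : ℝ) ^ 2 * _
        ≤ B * (k : ℝ) ^ (-α) / g * (k : ℝ) ^ 2 * (C * (k : ℝ)⁻¹ ^ 3) := by gcongr
      _ = B / g * C * ((k : ℝ) ^ (-α) * (k : ℝ)⁻¹) := by field_simp
      _ = _ := by rw [rpow_neg_mul_pow_inv hk0]

/-- The sampled kernel `(k - φ)₊ ^ (1 - α) / Γ(2 - α)` in terms of binomial coefficients, with a
summable error. -/
theorem exists_linear_kernel_expansion {α : ℝ} (h0 : 0 < α) (h1 : α < 1) {φ : ℝ} (hφ0 : 0 ≤ φ)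
    (hφ2 : φ ≤ 2) :
    ∃ ρ C : ℝ,
      SumAbsLE (PowerSeries.mk (fun k : ℕ => (max ((k : ℝ) - φ) 0) ^ (1 - α) / Real.Gamma (2 - α))
        - (binSer (α - 2) 1 + ρ • binSer (α - 1) 1)) C := by
  obtain ⟨e, C, K, hC0, hexp⟩ := exists_shifted_rpow_expansion h0 h1 (1 - α)
  obtain ⟨B, hB0, hB⟩ := exists_binCoeff_le h1
  set a₁ := (α - α ^ 2) / 2 with ha₁
  set G := Real.Gamma (1 - α) with hG
  have hG0 : 0 < G := Real.Gamma_pos_of_pos (by linarith)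
  have hα1 : 0 < 1 - α := by linarith
  have hΓ2 : Real.Gamma (2 - α) = (1 - α) * G := by
    rw [show 2 - α = (1 - α) + 1 by ring, Real.Gamma_add_one hα1.ne']
  set K' := max K 1 with hK'
  set X := e + (1 - α) * (1 - α - 1) / 2 * φ ^ 2 - a₁ * ((1 - α) * φ) with hX
  -- This choice matches the relative order `1/k`. The relative order `1/k²` is already summable
  -- here and joins the remainder.
  set ρ := (a₁ - (1 - α) * φ) / (1 - α) - 1 with hρ
  have hser : PowerSeries.mk (fun k : ℕ => (max ((k : ℝ) - φ) 0) ^ (1 - α) / Real.Gamma (2 - α))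
        - (binSer (α - 2) 1 + ρ • binSer (α - 1) 1)
      = PowerSeries.mk fun k : ℕ => (max ((k : ℝ) - φ) 0) ^ (1 - α) / ((1 - α) * G)
        - (PowerSeries.coeff k (binSer (α - 2) 1)
          + ρ * PowerSeries.coeff k (binSer (α - 1) 1)) := by
    ext k
    simp only [map_sub, map_add, PowerSeries.coeff_mk, PowerSeries.coeff_smul, smul_eq_mul, hΓ2]
  refine ⟨ρ, _, hser ▸ sumAbsLE_mk_of_tail (K := K') (s := 1 + α) (D := B / (1 - α) * (C + |X|))
    (by linarith) (by positivity) le_rfl ?_⟩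
  intro k hk
  have hk1 : 1 ≤ k := (le_max_right _ _).trans hk
  have hk0 : (0 : ℝ) < k := by exact_mod_cast hk1
  obtain ⟨hφk, hmt⟩ := hexp φ hφ0 hφ2 k hk1 ((le_max_left _ _).trans hk)
  have hc := binCoeff_pos h1 k
  have hcB := hB k hk1
  rw [← hX] at hmt
  rw [coeff_binSer_sub_two h1,
    show PowerSeries.coeff k (binSer (α - 1) 1) = binCoeff α k from rfl]
  have hmax : (max ((k : ℝ) - φ) 0) ^ (1 - α)
      = (k : ℝ) * (k : ℝ) ^ (-α) * (1 - φ * (k : ℝ)⁻¹) ^ (1 - α) := by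
    have e1 : max ((k : ℝ) - φ) 0 = k * (1 - φ * (k : ℝ)⁻¹) := by
      rw [max_eq_left (by linarith)]; field_simp
    have e2 : 0 ≤ 1 - φ * (k : ℝ)⁻¹ := by
      rw [← div_eq_mul_inv, sub_nonneg, div_le_one hk0]; exact hφk
    rw [e1, Real.mul_rpow hk0.le e2]
    congr 1
    nth_rewrite 2 [← Real.rpow_one (k : ℝ)]
    rw [← Real.rpow_add hk0]
    congr 1
  rw [hmax]
  set t := (1 - φ * (k : ℝ)⁻¹) ^ (1 - α) with ht
  set m := (k : ℝ) ^ (-α) / (G * binCoeff α k) with hm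
  have hkm : (k : ℝ) ^ (-α) = m * (G * binCoeff α k) := by rw [hm]; field_simp
  have hkey : (k : ℝ) * (k : ℝ) ^ (-α) * t / ((1 - α) * G)
      - ((k + (1 - α)) / (1 - α) * binCoeff α k + ρ * binCoeff α k)
      = binCoeff α k / (1 - α) * (k : ℝ) * (m * t - (1 + (a₁ - (1 - α) * φ) * (k : ℝ)⁻¹
        + X * (k : ℝ)⁻¹ ^ 2) + X * (k : ℝ)⁻¹ ^ 2) := by
    rw [hkm, hρ]
    clear_value X m t
    field_simp
    ring
  have hx1 : (k : ℝ)⁻¹ ≤ 1 := inv_le_one_of_one_le₀ (by exact_mod_cast hk1)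
  have hb : |m * t - (1 + (a₁ - (1 - α) * φ) * (k : ℝ)⁻¹ + X * (k : ℝ)⁻¹ ^ 2)
      + X * (k : ℝ)⁻¹ ^ 2| ≤ (C + |X|) * (k : ℝ)⁻¹ ^ 2 := by
    refine (abs_add_le _ _).trans ?_
    rw [abs_mul, abs_of_pos (a := (k : ℝ)⁻¹ ^ 2) (by positivity)]
    have : (k : ℝ)⁻¹ ^ 3 ≤ (k : ℝ)⁻¹ ^ 2 := pow_le_pow_of_le_one (by positivity) hx1 (by norm_num)
    nlinarith
  rw [hkey, abs_mul, abs_of_pos (by positivity)]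
  calc binCoeff α k / (1 - α) * (k : ℝ) * _
      ≤ B * (k : ℝ) ^ (-α) / (1 - α) * (k : ℝ) * ((C + |X|) * (k : ℝ)⁻¹ ^ 2) := by gcongr
    _ = B / (1 - α) * (C + |X|) * ((k : ℝ) ^ (-α) * (k : ℝ)⁻¹) := by field_simp
    _ = _ := by rw [rpow_neg_mul_pow_inv hk0]

/-! ### The factor `(A - B X) ^ α` of the generating function -/

/-- The quotient has the partial sums of `F` as coefficients. Since the total is zero, a partial sum
is minus a tail and inherits the geometric decay. -/
theorem exists_eq_one_sub_X_mul {F : PowerSeries ℝ} {C r : ℝ} (hr0 : 0 ≤ r) (hr1 : r < 1)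
    (hF : ∀ n, |PowerSeries.coeff n F| ≤ C * r ^ n)
    (hs : HasSum (fun n => PowerSeries.coeff n F) 0) :
    ∃ G : PowerSeries ℝ, F = (1 - PowerSeries.X) * G ∧
      ∀ n, |PowerSeries.coeff n G| ≤ C / (1 - r) * r ^ n := by
  have hC : 0 ≤ C := by simpa using (abs_nonneg _).trans (hF 0)
  refine ⟨PowerSeries.mk fun n => ∑ j ∈ Finset.range (n + 1), PowerSeries.coeff j F, ?_, fun n => ?_⟩
  · ext n
    cases n with
    | zero => simp
    | succ n =>
      rw [coeff_one_sub_X_mul_succ, PowerSeries.coeff_mk, PowerSeries.coeff_mk,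
        Finset.sum_range_succ _ (n + 1)]
      ring
  · rw [PowerSeries.coeff_mk]
    have h1 := hs.summable.sum_add_tsum_nat_add (n + 1)
    rw [hs.tsum_eq] at h1
    have h2 : ∑ j ∈ Finset.range (n + 1), PowerSeries.coeff j F
        = -∑' j, PowerSeries.coeff (j + (n + 1)) F := by linarith
    rw [h2, abs_neg]
    have h3 : HasSum (fun j : ℕ => C * r ^ (n + 1) * r ^ j) (C * r ^ (n + 1) * (1 - r)⁻¹) :=
      (hasSum_geometric_of_lt_one hr0 hr1).mul_left _
    have h4 := tsum_of_norm_bounded h3 (fun j => by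
      rw [Real.norm_eq_abs]
      refine (hF (j + (n + 1))).trans (le_of_eq ?_)
      rw [pow_add]; ring)
    rw [Real.norm_eq_abs] at h4
    refine h4.trans ?_
    have : 0 ≤ (1 - r)⁻¹ := inv_nonneg.2 (by linarith)
    calc C * r ^ (n + 1) * (1 - r)⁻¹ = C * (1 - r)⁻¹ * r ^ n * r := by rw [pow_succ]; ring
      _ ≤ C * (1 - r)⁻¹ * r ^ n * 1 := by gcongr
      _ = _ := by rw [div_eq_mul_inv, mul_one]

theorem SumAbsLE.of_geometric {F : PowerSeries ℝ} {C r : ℝ} (hr0 : 0 ≤ r) (hr1 : r < 1)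
    (hF : ∀ n, |PowerSeries.coeff n F| ≤ C * r ^ n) : SumAbsLE F (C * (1 - r)⁻¹) := by
  have hC : 0 ≤ C := by simpa using (abs_nonneg _).trans (hF 0)
  have h3 : HasSum (fun j : ℕ => C * r ^ j) (C * (1 - r)⁻¹) :=
    (hasSum_geometric_of_lt_one hr0 hr1).mul_left _
  intro N
  exact (Finset.sum_le_sum fun n _ => hF n).trans
    (sum_le_hasSum _ (fun n _ => by positivity) h3)

theorem abs_coeff_binSer_le {r x : ℝ} (hr0 : 0 ≤ r) (hr1 : r ≤ 1) (hx0 : 0 ≤ x) (n : ℕ) :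
    |PowerSeries.coeff n (binSer r x)| ≤ 1 * x ^ n := by
  induction n with
  | zero => simp [coeff_binSer_zero]
  | succ n ih =>
    rw [coeff_binSer_succ, abs_mul, abs_mul, abs_of_nonneg hx0]
    have hn : (0 : ℝ) < n + 1 := by positivity
    have h : |((n : ℝ) - r) / (n + 1)| ≤ 1 := by
      rw [abs_div, abs_of_pos hn, div_le_one hn, abs_le]
      have : (0 : ℝ) ≤ n := by positivity
      constructor <;> linarith
    calc _ ≤ x * 1 * (1 * x ^ n) := by gcongr
      _ = _ := by rw [pow_succ]; ring

theorem hasSum_coeff_binSer (r : ℝ) {q : ℝ} (hq0 : 0 ≤ q) (hq1 : q < 1) :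
    HasSum (fun n => PowerSeries.coeff n (binSer r q)) ((1 - q) ^ r) := by
  have h := (Real.one_add_rpow_hasFPowerSeriesOnBall_zero (a := r)).hasSum (y := -q) (by
    rw [← ENNReal.ofReal_one, Metric.eball_ofReal, mem_ball_zero_iff]
    simpa [abs_of_nonneg hq0] using hq1)
  simp only [binomialSeries_apply, zero_add] at h
  rw [sub_eq_add_neg]
  refine h.congr_fun fun n => ?_
  rw [coeff_binSer]
  simp [mul_comm]

/-- `(A - B X) ^ α = 1 + α B (1 - X) + (1 - X)² Y` with `A - B = 1`. -/
theorem exists_binSer_factor {α B : ℝ} (h0 : 0 < α) (h1 : α < 1) (hB : 0 ≤ B) :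
    ∃ (Y : PowerSeries ℝ) (C : ℝ), SumAbsLE Y C ∧
      ((1 + B) ^ α) • binSer α (B / (1 + B))
        = 1 + (α * B) • (1 - PowerSeries.X) + (1 - PowerSeries.X) ^ 2 * Y := by
  set A := 1 + B with hA
  set q := B / A with hq
  have hA0 : 0 < A := by positivity
  have hq0 : 0 ≤ q := by positivity
  have hq1 : q < 1 := by rw [hq, div_lt_one hA0, hA]; linarith
  have hAq : A * (1 - q) = 1 := by rw [hq, hA]; field_simp; ring
  set F : PowerSeries ℝ := (A ^ α) • binSer α q with hF
  have hFc : ∀ n, PowerSeries.coeff n F = A ^ α * PowerSeries.coeff n (binSer α q) := by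
    intro n; simp [hF]
  have hAα : 0 < A ^ α := Real.rpow_pos_of_pos hA0 α
  have hFb : ∀ n, |PowerSeries.coeff n F| ≤ A ^ α * q ^ n := by
    intro n
    rw [hFc, abs_mul, abs_of_pos hAα]
    have := abs_coeff_binSer_le h0.le h1.le hq0 n
    rw [one_mul] at this
    gcongr
  have hFs : HasSum (fun n => PowerSeries.coeff n F) 1 := by
    have := (hasSum_coeff_binSer α hq0 hq1).mul_left (A ^ α)
    rw [← Real.mul_rpow hA0.le (by linarith), hAq, Real.one_rpow] at this
    simpa only [hFc] using this
  have hq' : ‖q‖ < 1 := by rwa [Real.norm_of_nonneg hq0]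
  have hnq : Summable fun n : ℕ => (n : ℝ) * q ^ n := by
    simpa using summable_pow_mul_geometric_of_norm_lt_one 1 hq'
  -- Subtracting the value at `X = 1` allows division by `1 - X`. This is done twice, with the
  -- values `F(1) = 1` and `α B`.
  have hsub : ∀ (G : PowerSeries ℝ) (C c s : ℝ),
      (∀ n, |PowerSeries.coeff n G| ≤ C * q ^ n) → HasSum (fun n => PowerSeries.coeff n G) s →
      (∀ n, |PowerSeries.coeff n (G - c • 1)| ≤ (C + |c|) * q ^ n) ∧
      HasSum (fun n => PowerSeries.coeff n (G - c • 1)) (s - c) := by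
    intro G C c s hG hs
    constructor
    · intro n
      rw [map_sub, PowerSeries.coeff_smul, PowerSeries.coeff_one, add_mul, smul_eq_mul]
      refine (abs_sub _ _).trans (add_le_add (hG n) ?_)
      split_ifs with h
      · subst h; simp
      · simp only [mul_zero, abs_zero]; positivity
    · have h1 : HasSum (fun n => c * PowerSeries.coeff n (1 : PowerSeries ℝ)) c := by
        simp only [PowerSeries.coeff_one]
        simpa using hasSum_ite_eq (0 : ℕ) c
      simpa using hs.sub h1
  obtain ⟨hb1, hs1⟩ := hsub F (A ^ α) 1 1 hFb hFs
  rw [sub_self] at hs1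
  obtain ⟨G, hG, hGb⟩ := exists_eq_one_sub_X_mul hq0 hq1 hb1 hs1
  set C₁ := (A ^ α + |(1 : ℝ)|) / (1 - q) with hC₁
  have hGsum : Summable fun n => PowerSeries.coeff n G :=
    Summable.of_norm_bounded ((summable_geometric_of_lt_one hq0 hq1).mul_left C₁)
      fun n => by rw [Real.norm_eq_abs]; exact hGb n
  have hnG : Summable fun n : ℕ => (n : ℝ) * PowerSeries.coeff n G :=
    Summable.of_norm_bounded (hnq.mul_left C₁) fun n => by
      rw [norm_mul, Real.norm_natCast, Real.norm_eq_abs]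
      calc (n : ℝ) * _ ≤ n * (C₁ * q ^ n) := by gcongr; exact hGb n
        _ = _ := by ring
  have hnF : Summable fun n : ℕ => (n : ℝ) * PowerSeries.coeff n F :=
    Summable.of_norm_bounded (hnq.mul_left (A ^ α)) fun n => by
      rw [norm_mul, Real.norm_natCast, Real.norm_eq_abs]
      calc (n : ℝ) * _ ≤ n * (A ^ α * q ^ n) := by gcongr; exact hFb n
        _ = _ := by ring
  set M := ∑' n : ℕ, (n : ℝ) * PowerSeries.coeff n F with hM
  have hMs : HasSum (fun n : ℕ => ((n : ℝ) + 1) * PowerSeries.coeff (n + 1) F) M := by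
    have := (hasSum_nat_add_iff' 1).2 hnF.hasSum
    simpa using this
  -- `M` is the derivative of `F` at `1`. Summing the recursion `(n + 1) F (n+1) = q (n - α) F n`
  -- and using `A (1 - q) = 1` gives `-M = α B`.
  have hMq : M = q * (M - α * 1) := by
    refine hMs.unique ?_
    have := (hnF.hasSum.sub (hFs.mul_left α)).mul_left q
    refine this.congr_fun fun n => ?_
    rw [hFc, hFc, coeff_binSer_succ]
    have : (n : ℝ) + 1 ≠ 0 := by positivity
    field_simp
  have hGF : HasSum (fun n : ℕ => ((n : ℝ) + 1) * PowerSeries.coeff (n + 1) F)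
      (-∑' n, PowerSeries.coeff n G) := by
    have e1 : HasSum (fun n : ℕ => ((n : ℝ) + 1) * PowerSeries.coeff (n + 1) G)
        (∑' n : ℕ, (n : ℝ) * PowerSeries.coeff n G) := by
      have := (hasSum_nat_add_iff' 1).2 hnG.hasSum
      simpa using this
    have := e1.sub (hnG.hasSum.add hGsum.hasSum)
    rw [sub_add_cancel_left] at this
    refine this.congr_fun fun n => ?_
    have hF' : F = 1 + (1 - PowerSeries.X) * G := by rw [← hG, one_smul]; ring
    rw [hF', map_add, coeff_one_sub_X_mul_succ, PowerSeries.coeff_one, if_neg (by omega)]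
    ring
  have hGs : HasSum (fun n => PowerSeries.coeff n G) (α * B) := by
    have e := hMs.unique hGF
    have : ∑' n, PowerSeries.coeff n G = α * B := by
      have h2 : -M = α * B := by
        have hBq : B = A * q := by rw [hq]; field_simp
        rw [hBq]
        linear_combination (-A) * hMq + M * hAq
      linarith
    rw [← this]
    exact hGsum.hasSum
  obtain ⟨hb2, hs2⟩ := hsub G C₁ (α * B) (α * B) hGb hGs
  rw [sub_self] at hs2
  obtain ⟨Y, hY, hYb⟩ := exists_eq_one_sub_X_mul hq0 hq1 hb2 hs2
  refine ⟨Y, _, SumAbsLE.of_geometric hq0 hq1 hYb, ?_⟩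
  have hF' : F = 1 + (1 - PowerSeries.X) * G := by rw [← hG, one_smul]; ring
  have hG' : G = (α * B) • 1 + (1 - PowerSeries.X) * Y := by rw [← hY]; ring
  rw [hF', hG', mul_add, mul_smul_comm, mul_one]
  ring

/-! ### Total variation of the quadrature error -/

/-- The inverse of the series of the weights: a discrete fractional integral. -/
def kappaSer (α θ : ℝ) : PowerSeries ℝ :=
  ((1 / 2 + θ / α) ^ α) •
    (binSer (-α) 1 * binSer α ((θ / α - 1 / 2) / (1 / 2 + θ / α)))

theorem omegaSer_mul_kappaSer {α θ : ℝ} (hα : 0 < α) (hθ : α / 2 ≤ θ) :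
    omegaSer α θ * kappaSer α θ = 1 := by
  have hθα : 1 / 2 ≤ θ / α := by rw [le_div_iff₀ hα]; linarith
  have hA0 : 0 < 1 / 2 + θ / α := by linarith
  rw [omegaSer, kappaSer, smul_mul_smul_comm, ← Real.rpow_add hA0, neg_add_cancel, Real.rpow_zero,
    one_smul, mul_mul_mul_comm, ← binSer_add, ← binSer_add]
  simp [binSer_zero]

/-- Taking increments of a convolution with `κ` costs the factor `(1 - X)^(1-α)`, which turns the
exponents `α - 3`, `α - 2`, `α - 1` of the sampled kernels into `-2`, `-1`, `0`. -/
theorem one_sub_X_mul_kappaSer {α θ : ℝ} :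
    (1 - PowerSeries.X) * kappaSer α θ = (((1 + (θ / α - 1 / 2)) ^ α) •
      binSer α ((θ / α - 1 / 2) / (1 + (θ / α - 1 / 2)))) * binSer (1 - α) 1 := by
  rw [kappaSer, mul_smul_comm, ← mul_assoc, one_sub_X_mul_binSer, smul_mul_assoc,
    show 1 + (θ / α - 1 / 2) = 1 / 2 + θ / α by ring, show -α + 1 = 1 - α by ring, mul_comm]

/-- An integer delay is multiplication by a power of `X`, which does not change `ℓ¹` bounds.
Uniformity in `s ≥ 0` is thus reduced to the fractional part of `s`. -/
theorem mk_shift {f : ℝ → ℝ} (hf : ∀ x ≤ 0, f x = 0) (j : ℕ) {σ : ℝ} (hσ : 0 ≤ σ) :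
    PowerSeries.mk (fun k : ℕ => f (k - (j + σ)))
      = PowerSeries.X ^ j * PowerSeries.mk (fun k : ℕ => f (k - σ)) := by
  ext k
  rw [PowerSeries.coeff_mk, PowerSeries.coeff_X_pow_mul']
  split_ifs with h
  · rw [PowerSeries.coeff_mk, Nat.cast_sub h]
    congr 1
    ring
  · refine hf _ ?_
    have : (k : ℝ) ≤ j := by exact_mod_cast (not_le.1 h).le
    linarith

theorem one_sub_X_mul_binSer_neg_one : (1 - PowerSeries.X) * binSer (-1) 1 = 1 := by
  rw [one_sub_X_mul_binSer, neg_add_cancel, binSer_zero]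

theorem one_sub_X_mul_binSer_neg_two :
    (1 - PowerSeries.X) * binSer (-2) 1 = binSer (-1) 1 := by
  rw [one_sub_X_mul_binSer]; norm_num

/-- From index `2` on the increments of the sampled parabola are affine in the index and agree
exactly with the subtracted series; only the first two coefficients, `1/2 + σ` and `σ²/2`, remain.
-/
theorem one_sub_X_mul_mk_sq {σ : ℝ} (h0 : 0 ≤ σ) (h1 : σ ≤ 1) :
    SumAbsLE ((1 - PowerSeries.X) * PowerSeries.mk (fun k : ℕ => (max ((k : ℝ) - σ) 0) ^ 2 / 2)
      - (binSer (-2) 1 - (3 / 2 + σ) • binSer (-1) 1)) 2 := by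
  set Z := (1 - PowerSeries.X) * PowerSeries.mk (fun k : ℕ => (max ((k : ℝ) - σ) 0) ^ 2 / 2)
      - (binSer (-2) 1 - (3 / 2 + σ) • binSer (-1) 1) with hZ
  have z0 : PowerSeries.coeff 0 Z = 1 / 2 + σ := by
    rw [hZ, map_sub, map_sub, coeff_one_sub_X_mul_zero, PowerSeries.coeff_smul, coeff_binSer_zero,
      coeff_binSer_zero, PowerSeries.coeff_mk, Nat.cast_zero, max_eq_right (by linarith), smul_eq_mul]
    ring
  have zs : ∀ n : ℕ, PowerSeries.coeff (n + 1) Z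
      = (max ((n : ℝ) + 1 - σ) 0) ^ 2 / 2 - (max ((n : ℝ) - σ) 0) ^ 2 / 2
        - ((n : ℝ) + 1 + 1 - (3 / 2 + σ)) := by
    intro n
    rw [hZ, map_sub, map_sub, coeff_one_sub_X_mul_succ, PowerSeries.coeff_smul,
      coeff_binSer_neg_one, coeff_binSer_neg_two, PowerSeries.coeff_mk, PowerSeries.coeff_mk,
      smul_eq_mul]
    push_cast
    ring
  have z1 : PowerSeries.coeff 1 Z = σ ^ 2 / 2 := by
    rw [zs 0, Nat.cast_zero, max_eq_left (by linarith), max_eq_right (by linarith)]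
    ring
  have z2 : ∀ n : ℕ, PowerSeries.coeff (n + 2) Z = 0 := by
    intro n
    have : (0 : ℝ) ≤ n := by positivity
    rw [zs (n + 1)]
    push_cast
    rw [max_eq_left (by linarith), max_eq_left (by linarith)]
    ring
  intro N
  refine (Finset.sum_le_sum_of_subset_of_nonneg (t := Finset.range (N + 1 + 1))
    (Finset.range_mono (by omega)) fun _ _ _ => abs_nonneg _).trans ?_
  rw [Finset.sum_range_succ', Finset.sum_range_succ']
  simp only [z2, zero_add, z0, z1, abs_zero, Finset.sum_const_zero]
  rw [abs_of_nonneg (by positivity), abs_of_nonneg (by positivity)]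
  nlinarith

/-- The increments of the quadrature error for `t ↦ (t - s)₊² / 2` are summable, uniformly in
`s`. -/
theorem exists_quadratic_error_bound {α θ : ℝ} (h0 : 0 < α) (h1 : α < 1)
    (hθ : θ ∈ Icc (α / 2) (1 / 2)) :
    ∃ C : ℝ, ∀ s : ℝ, 0 ≤ s → SumAbsLE ((1 - PowerSeries.X) *
      (kappaSer α θ * PowerSeries.mk
          (fun k : ℕ => (max ((k : ℝ) - s - θ) 0) ^ (2 - α) / Real.Gamma (3 - α))
        - PowerSeries.mk (fun k : ℕ => (max ((k : ℝ) - s) 0) ^ 2 / 2))) C := by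
  have hθ0 : 0 < θ := by linarith [hθ.1]
  set B := θ / α - 1 / 2 with hB
  have hB0 : 0 ≤ B := by
    have : 1 / 2 ≤ θ / α := by rw [le_div_iff₀ h0]; linarith [hθ.1]
    rw [hB]; linarith
  have hαB : α * B = θ - α / 2 := by rw [hB]; field_simp
  obtain ⟨Y, CY, hY, hW⟩ := exists_binSer_factor h0 h1 hB0
  obtain ⟨C, hC⟩ := exists_quadratic_kernel_expansion h0 h1
  set W := ((1 + B) ^ α) • binSer α (B / (1 + B)) with hWdef
  have hWs : SumAbsLE W (|(1 + B) ^ α| * 2) :=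
    (sumAbsLE_binSer h0.le h1.le (by positivity)
      (by rw [div_le_one (by positivity)]; linarith)).smul _
  set CW := |(1 + B) ^ α| * 2 with hCW
  have hCY := hY.nonneg
  have hCW0 := hWs.nonneg
  have hbin : SumAbsLE (binSer (1 - α) 1) 2 :=
    sumAbsLE_binSer (by linarith) (by linarith) zero_le_one le_rfl
  refine ⟨CY + 4 * (α * B) * 1 + 4 * (2 * CY) + C * CW + CW * 2 * C + 2, fun s hs => ?_⟩
  set j := ⌊s⌋₊ with hj
  set σ := s - j with hσ
  have hσ0 : 0 ≤ σ := by rw [hσ, sub_nonneg]; exact Nat.floor_le hs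
  have hσ1 : σ < 1 := by rw [hσ]; linarith [Nat.lt_floor_add_one s]
  have hsσ : s = j + σ := by rw [hσ]; ring
  obtain ⟨ρ, hρC, hS⟩ := hC (σ + θ) (by positivity) (by linarith [hθ.2])
  set Aser := PowerSeries.mk
    (fun k : ℕ => (max ((k : ℝ) - (σ + θ)) 0) ^ (2 - α) / Real.Gamma (3 - α)) with hAser
  set Q := PowerSeries.mk (fun k : ℕ => (max ((k : ℝ) - σ) 0) ^ 2 / 2) with hQ
  have e1 : PowerSeries.mk
      (fun k : ℕ => (max ((k : ℝ) - s - θ) 0) ^ (2 - α) / Real.Gamma (3 - α))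
      = PowerSeries.X ^ j * Aser := by
    rw [hAser, ← mk_shift (f := fun x => (max x 0) ^ (2 - α) / Real.Gamma (3 - α))
      (fun x hx => by rw [max_eq_right hx, Real.zero_rpow (by linarith), zero_div]) j (by positivity)]
    congr 1; funext k; rw [hsσ]; congr 3; ring
  have e2 : PowerSeries.mk (fun k : ℕ => (max ((k : ℝ) - s) 0) ^ 2 / 2)
      = PowerSeries.X ^ j * Q := by
    rw [hQ, ← mk_shift (f := fun x => (max x 0) ^ 2 / 2)
      (fun x hx => by rw [max_eq_right hx]; norm_num) j hσ0, ← hsσ]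
  have e3 : (1 - PowerSeries.X) * (kappaSer α θ * (PowerSeries.X ^ j * Aser)
      - PowerSeries.X ^ j * Q)
      = PowerSeries.X ^ j * ((1 - PowerSeries.X) * kappaSer α θ * Aser
        - (1 - PowerSeries.X) * Q) := by ring
  rw [e1, e2, e3]
  refine sumAbsLE_X_pow_mul ?_ j
  rw [one_sub_X_mul_kappaSer, ← hB, ← hWdef]
  set ρ₁ := -((3 - α) / 2 + (σ + θ)) with hρ₁
  set S := Aser - (binSer (α - 3) 1 + ρ₁ • binSer (α - 2) 1 + ρ • binSer (α - 1) 1) with hSdef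
  have hZ := one_sub_X_mul_mk_sq hσ0 hσ1.le
  rw [← hQ] at hZ
  set Z := (1 - PowerSeries.X) * Q - (binSer (-2) 1 - (3 / 2 + σ) • binSer (-1) 1) with hZdef
  have b2 : binSer (1 - α) 1 * binSer (α - 3) 1 = binSer (-2) 1 := by
    rw [← binSer_add]; congr 1; ring
  have b1 : binSer (1 - α) 1 * binSer (α - 2) 1 = binSer (-1) 1 := by
    rw [← binSer_add]; congr 1; ring
  have b0 : binSer (1 - α) 1 * binSer (α - 1) 1 = 1 := by
    rw [← binSer_add, ← binSer_zero 1]; congr 1; ring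
  have hfin : W * binSer (1 - α) 1 * Aser - (1 - PowerSeries.X) * Q
      = Y + (ρ₁ * (α * B)) • 1 + ρ₁ • ((1 - PowerSeries.X) * Y) + ρ • W
        + W * binSer (1 - α) 1 * S - Z := by
    have hA' : Aser = binSer (α - 3) 1 + ρ₁ • binSer (α - 2) 1 + ρ • binSer (α - 1) 1 + S := by
      rw [hSdef]; ring
    have hQ' : (1 - PowerSeries.X) * Q = binSer (-2) 1 - (3 / 2 + σ) • binSer (-1) 1 + Z := by
      rw [hZdef]; ring
    have hprod : W * binSer (1 - α) 1 * Aser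
        = W * (binSer (-2) 1 + ρ₁ • binSer (-1) 1 + ρ • 1) + W * binSer (1 - α) 1 * S := by
      rw [hA', ← b2, ← b1, ← b0]
      simp only [PowerSeries.smul_eq_C_mul]
      ring
    have hW2 : W * binSer (-2) 1 = binSer (-2) 1 + (α * B) • binSer (-1) 1 + Y := by
      have i1 := one_sub_X_mul_binSer_neg_one
      have i2 := one_sub_X_mul_binSer_neg_two
      rw [hW]
      simp only [PowerSeries.smul_eq_C_mul]
      linear_combination (PowerSeries.C (α * B) + (1 - PowerSeries.X) * Y) * i2 + Y * i1
    have hW1 : W * binSer (-1) 1 = binSer (-1) 1 + (α * B) • 1 + (1 - PowerSeries.X) * Y := by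
      have i1 := one_sub_X_mul_binSer_neg_one
      rw [hW]
      simp only [PowerSeries.smul_eq_C_mul]
      linear_combination (PowerSeries.C (α * B) + (1 - PowerSeries.X) * Y) * i1
    -- The total coefficient of `(1 - X)^(-1)`. It vanishes because sampling at `k - θ` contributes
    -- `-θ`, which `α B = θ - α/2` compensates; this is the second-order consistency of the
    -- quadrature.
    have hcoef : PowerSeries.C (α * B) + PowerSeries.C ρ₁ + PowerSeries.C (3 / 2 + σ) = 0 := by
      rw [← map_add, ← map_add, hαB, hρ₁, ← map_zero PowerSeries.C]
      congr 1; ring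
    have hmulC : PowerSeries.C (ρ₁ * (α * B)) = PowerSeries.C ρ₁ * PowerSeries.C (α * B) :=
      map_mul _ _ _
    rw [hprod, hQ']
    simp only [PowerSeries.smul_eq_C_mul] at hW1 hW2 ⊢
    rw [hmulC]
    linear_combination hW2 + PowerSeries.C ρ₁ * hW1 + binSer (-1) 1 * hcoef
  rw [hfin]
  have hρ₁4 : |ρ₁| ≤ 4 := by
    rw [hρ₁, abs_neg, abs_of_nonneg (by linarith)]
    linarith [hθ.2]
  have hαB0 : 0 ≤ α * B := by positivity
  have t1 := (((hY.add (sumAbsLE_one.smul (ρ₁ * (α * B)))).add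
    ((sumAbsLE_one_sub_X.mul hY).smul ρ₁)).add (hWs.smul ρ)).add ((hWs.mul hbin).mul hS)
  refine (t1.sub hZ).mono ?_
  rw [abs_mul, abs_of_nonneg hαB0]
  gcongr

/-- The increments of the quadrature error for `t ↦ t` are summable. -/
theorem exists_linear_error_bound {α θ : ℝ} (h0 : 0 < α) (h1 : α < 1)
    (hθ : θ ∈ Icc (α / 2) (1 / 2)) :
    ∃ C : ℝ, SumAbsLE ((1 - PowerSeries.X) *
      (kappaSer α θ * PowerSeries.mk
          (fun k : ℕ => (max ((k : ℝ) - θ) 0) ^ (1 - α) / Real.Gamma (2 - α))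
        - PowerSeries.mk (fun k : ℕ => (k : ℝ)))) C := by
  have hθ0 : 0 < θ := by linarith [hθ.1]
  set B := θ / α - 1 / 2 with hB
  have hB0 : 0 ≤ B := by
    have : 1 / 2 ≤ θ / α := by rw [le_div_iff₀ h0]; linarith [hθ.1]
    rw [hB]; linarith
  obtain ⟨Y, CY, hY, hW⟩ := exists_binSer_factor h0 h1 hB0
  obtain ⟨ρ, C, hS⟩ := exists_linear_kernel_expansion h0 h1 hθ0.le (by linarith [hθ.2])
  set W := ((1 + B) ^ α) • binSer α (B / (1 + B)) with hWdef
  have hWs : SumAbsLE W (|(1 + B) ^ α| * 2) :=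
    (sumAbsLE_binSer h0.le h1.le (by positivity)
      (by rw [div_le_one (by positivity)]; linarith)).smul _
  have hbin : SumAbsLE (binSer (1 - α) 1) 2 :=
    sumAbsLE_binSer (by linarith) (by linarith) zero_le_one le_rfl
  set Aser := PowerSeries.mk
    (fun k : ℕ => (max ((k : ℝ) - θ) 0) ^ (1 - α) / Real.Gamma (2 - α)) with hAser
  set Q := PowerSeries.mk (fun k : ℕ => (k : ℝ)) with hQ
  have hQ' : (1 - PowerSeries.X) * Q = binSer (-1) 1 - 1 := by
    ext n
    cases n with
    | zero => rw [coeff_one_sub_X_mul_zero, map_sub, coeff_binSer_neg_one]; simp [hQ]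
    | succ n =>
      rw [coeff_one_sub_X_mul_succ, map_sub, coeff_binSer_neg_one, PowerSeries.coeff_one,
        if_neg (by omega), hQ, PowerSeries.coeff_mk, PowerSeries.coeff_mk]
      push_cast; ring
  set S := Aser - (binSer (α - 2) 1 + ρ • binSer (α - 1) 1) with hSdef
  have b1 : binSer (1 - α) 1 * binSer (α - 2) 1 = binSer (-1) 1 := by
    rw [← binSer_add]; congr 1; ring
  have b0 : binSer (1 - α) 1 * binSer (α - 1) 1 = 1 := by
    rw [← binSer_add, ← binSer_zero 1]; congr 1; ring
  -- Only one singular term, `(1 - X)^(-1)`, occurs here, and it cancels because `W(1) = 1`.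
  have hfin : (1 - PowerSeries.X) * (kappaSer α θ * Aser - Q)
      = (α * B) • 1 + (1 - PowerSeries.X) * Y + ρ • W + W * binSer (1 - α) 1 * S + 1 := by
    have hA' : Aser = binSer (α - 2) 1 + ρ • binSer (α - 1) 1 + S := by
      rw [hSdef]; ring
    have hprod : W * binSer (1 - α) 1 * Aser
        = W * (binSer (-1) 1 + ρ • 1) + W * binSer (1 - α) 1 * S := by
      rw [hA', ← b1, ← b0]
      simp only [PowerSeries.smul_eq_C_mul]
      ring
    have hW1 : W * binSer (-1) 1 = binSer (-1) 1 + (α * B) • 1 + (1 - PowerSeries.X) * Y := by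
      have i1 := one_sub_X_mul_binSer_neg_one
      rw [hW]
      simp only [PowerSeries.smul_eq_C_mul]
      linear_combination (PowerSeries.C (α * B) + (1 - PowerSeries.X) * Y) * i1
    rw [mul_sub, ← mul_assoc, one_sub_X_mul_kappaSer, ← hB, ← hWdef, hprod, hQ']
    simp only [PowerSeries.smul_eq_C_mul] at hW1 ⊢
    linear_combination hW1
  rw [hfin]
  exact ⟨_, ((((sumAbsLE_one.smul (α * B)).add (sumAbsLE_one_sub_X.mul hY)).add
    (hWs.smul ρ)).add ((hWs.mul hbin).mul hS)).add sumAbsLE_one⟩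

/-! ### Calculus for vector-valued curves -/

section

variable {F : Type*} [NormedAddCommGroup F] [NormedSpace ℝ F]

/-- Induction on the order: extend the derivative and integrate it. With curves defined on all of
`ℝ`, two-sided derivatives are available at the endpoints of the time interval. -/
theorem exists_contDiff_extension [CompleteSpace F] {T : ℝ} (hT : 0 < T) (n : ℕ) :
    ∀ u : ℝ → F, ContDiffOn ℝ n u (Icc 0 T) →
      ∃ U : ℝ → F, ContDiff ℝ n U ∧ EqOn U u (Icc 0 T) := by
  induction n with
  | zero =>
    intro u hu
    refine ⟨IccExtend hT.le (Set.domRestrict (Icc 0 T) u), ?_, fun t ht => ?_⟩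
    · rw [Nat.cast_zero, contDiff_zero]
      exact (continuousOn_iff_continuous_domRestrict.1 hu.continuousOn).Icc_extend'
    · rw [IccExtend_of_mem hT.le _ ht, domRestrict_apply]
  | succ n ih =>
    intro u hu
    have hun := uniqueDiffOn_Icc hT
    have hu' : ContDiffOn ℝ ((n : WithTop ℕ∞) + 1) u (Icc 0 T) := by exact_mod_cast hu
    obtain ⟨hd, -, hu1⟩ := (contDiffOn_succ_iff_derivWithin hun).1 hu'
    obtain ⟨V, hV, hVu⟩ := ih _ hu1
    have hder : ∀ t, HasDerivAt (fun t => u 0 + ∫ s in (0 : ℝ)..t, V s) (V t) t := fun t =>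
      ((hV.continuous.integral_hasStrictDerivAt 0 t).hasDerivAt).const_add _
    refine ⟨fun t => u 0 + ∫ s in (0 : ℝ)..t, V s, ?_, fun t ht => ?_⟩
    · have : ContDiff ℝ ((n : WithTop ℕ∞) + 1) (fun t => u 0 + ∫ s in (0 : ℝ)..t, V s) := by
        rw [contDiff_succ_iff_deriv]
        refine ⟨fun t => (hder t).differentiableAt, by simp, ?_⟩
        rw [show deriv (fun t => u 0 + ∫ s in (0 : ℝ)..t, V s) = V from
          funext fun t => (hder t).deriv]
        exact hV
      exact_mod_cast this
    · have h := intervalIntegral.integral_eq_sub_of_hasDerivAt_of_le (f := u) (f' := V) ht.1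
        (hu.continuousOn.mono (Icc_subset_Icc_right ht.2)) (fun s hs => by
          have hs' : s ∈ Icc 0 T := ⟨hs.1.le, hs.2.le.trans ht.2⟩
          have h1 := (hd s hs').hasDerivWithinAt.hasDerivAt
            (Icc_mem_nhds hs.1 (hs.2.trans_le ht.2))
          rwa [← hVu hs'] at h1) (hV.continuous.intervalIntegrable _ _)
      simp only [h]
      abel

theorem norm_image_sub_le_uIcc {f f' : ℝ → F} {x y K : ℝ}
    (hf : ∀ z ∈ uIcc x y, HasDerivAt f (f' z) z) (hb : ∀ z ∈ uIcc x y, ‖f' z‖ ≤ K) :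
    ‖f y - f x‖ ≤ K * |y - x| :=
  (convex_uIcc x y).norm_image_sub_le_of_norm_hasDerivWithin_le
    (fun z hz => (hf z hz).hasDerivWithinAt) hb left_mem_uIcc right_mem_uIcc

theorem norm_taylor_one_le {u u₁ u₂ : ℝ → F} {T M : ℝ}
    (h1 : ∀ t, HasDerivAt u (u₁ t) t) (h2 : ∀ t, HasDerivAt u₁ (u₂ t) t)
    (hM : ∀ t ∈ Icc 0 T, ‖u₂ t‖ ≤ M) {x y : ℝ} (hx : x ∈ Icc 0 T) (hy : y ∈ Icc 0 T) :
    ‖u y - u x - (y - x) • u₁ x‖ ≤ M * |y - x| ^ 2 := by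
  have hM0 : 0 ≤ M := (norm_nonneg _).trans (hM x hx)
  have hsub : uIcc x y ⊆ Icc 0 T := uIcc_subset_Icc hx hy
  have key := norm_image_sub_le_uIcc (f := fun z => u z - (z - x) • u₁ x)
    (f' := fun z => u₁ z - u₁ x) (x := x) (y := y) (K := M * |y - x|) (fun z _ => by
      have := ((hasDerivAt_id z).sub_const x).smul_const (u₁ x)
      simpa using (h1 z).fun_sub this) (fun z hz => by
      have hxz : uIcc x z ⊆ uIcc x y := uIcc_subset_uIcc left_mem_uIcc hz
      refine (norm_image_sub_le_uIcc (fun w _ => h2 w)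
        (fun w hw => hM w (hsub (hxz hw)))).trans ?_
      exact mul_le_mul_of_nonneg_left (abs_sub_left_of_mem_uIcc hz) hM0)
  simp only [sub_self, zero_smul, sub_zero] at key
  calc _ = ‖u y - (y - x) • u₁ x - u x‖ := by congr 1; abel
    _ ≤ _ := key
    _ = _ := by ring

theorem norm_taylor_two_le {u u₁ u₂ u₃ : ℝ → F} {T M : ℝ}
    (h1 : ∀ t, HasDerivAt u (u₁ t) t) (h2 : ∀ t, HasDerivAt u₁ (u₂ t) t)
    (h3 : ∀ t, HasDerivAt u₂ (u₃ t) t)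
    (hM : ∀ t ∈ Icc 0 T, ‖u₃ t‖ ≤ M) {x y : ℝ} (hx : x ∈ Icc 0 T) (hy : y ∈ Icc 0 T) :
    ‖u y - u x - (y - x) • u₁ x - ((y - x) ^ 2 / 2) • u₂ x‖ ≤ M * |y - x| ^ 3 := by
  have hM0 : 0 ≤ M := (norm_nonneg _).trans (hM x hx)
  have hsub : uIcc x y ⊆ Icc 0 T := uIcc_subset_Icc hx hy
  have key := norm_image_sub_le_uIcc
    (f := fun z => u z - (z - x) • u₁ x - ((z - x) ^ 2 / 2) • u₂ x)
    (f' := fun z => u₁ z - u₁ x - (z - x) • u₂ x) (x := x) (y := y) (K := M * |y - x| ^ 2)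
    (fun z _ => by
      have e1 := ((hasDerivAt_id z).sub_const x).smul_const (u₁ x)
      have e2 := ((((hasDerivAt_id z).sub_const x).pow 2).div_const 2).smul_const (u₂ x)
      simpa using ((h1 z).fun_sub e1).fun_sub e2) (fun z hz => by
      refine (norm_taylor_one_le h2 h3 hM hx (hsub hz)).trans ?_
      exact mul_le_mul_of_nonneg_left
        (pow_le_pow_left₀ (abs_nonneg _) (abs_sub_left_of_mem_uIcc hz) 2) hM0)
  simp only [sub_self, zero_smul, sub_zero, zero_pow two_ne_zero, zero_div] at key
  calc _ = ‖u y - (y - x) • u₁ x - ((y - x) ^ 2 / 2) • u₂ x - u x‖ := by congr 1; abel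
    _ ≤ _ := key
    _ = _ := by ring

/-- The error of the `θ`-average of a curve over `[s, s + τ]`. -/
def avgErr (θ τ : ℝ) (u : ℝ → F) (s : ℝ) : F :=
  (1 - θ) • u (s + τ) + θ • u s - u (s + (1 - θ) * τ)

/-- The evaluation point is the `θ`-weighted mean of the two endpoints, so the first-order Taylor
terms cancel for every `θ`. -/
theorem norm_avgErr_le {u u₁ u₂ : ℝ → F} {T M θ τ s : ℝ}
    (h1 : ∀ t, HasDerivAt u (u₁ t) t) (h2 : ∀ t, HasDerivAt u₁ (u₂ t) t)
    (hM : ∀ t ∈ Icc 0 T, ‖u₂ t‖ ≤ M) (hθ : θ ∈ Icc (0 : ℝ) 1) (hτ : 0 ≤ τ) (hs : 0 ≤ s)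
    (hsT : s + τ ≤ T) : ‖avgErr θ τ u s‖ ≤ M * τ ^ 2 := by
  obtain ⟨hθ0, hθ1⟩ := hθ
  have hθ1' : 0 ≤ 1 - θ := by linarith
  have ht : s + (1 - θ) * τ ∈ Icc 0 T := ⟨by positivity, by nlinarith⟩
  have hM0 : 0 ≤ M := (norm_nonneg _).trans (hM _ ht)
  have e1 := norm_taylor_one_le h1 h2 hM ht (y := s + τ) ⟨by positivity, hsT⟩
  have e2 := norm_taylor_one_le h1 h2 hM ht (y := s) ⟨hs, by linarith⟩
  set t := s + (1 - θ) * τ with htdef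
  have d1 : s + τ - t = θ * τ := by rw [htdef]; ring
  have d2 : s - t = -((1 - θ) * τ) := by rw [htdef]; ring
  have a1 : |s + τ - t| ≤ τ := by rw [d1, abs_of_nonneg (by positivity)]; nlinarith
  have a2 : |s - t| ≤ τ := by rw [d2, abs_neg, abs_of_nonneg (by positivity)]; nlinarith
  have e : avgErr θ τ u s = (1 - θ) • (u (s + τ) - u t - (s + τ - t) • u₁ t)
      + θ • (u s - u t - (s - t) • u₁ t) := by
    rw [avgErr, d1, d2]
    module
  rw [e]
  refine (norm_add_le _ _).trans ?_
  rw [norm_smul, norm_smul, Real.norm_of_nonneg hθ0, Real.norm_of_nonneg hθ1']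
  have f1 : M * |s + τ - t| ^ 2 ≤ M * τ ^ 2 := by gcongr
  have f2 : M * |s - t| ^ 2 ≤ M * τ ^ 2 := by gcongr
  calc _ ≤ (1 - θ) * (M * τ ^ 2) + θ * (M * τ ^ 2) := by
        gcongr
        · exact e1.trans f1
        · exact e2.trans f2
    _ = _ := by ring

/-- The averaging error commutes with differentiation in `s`, so the mean value inequality gains one
more power of `τ`. This is what controls the variation of the residuals. -/
theorem norm_avgErr_sub_le {u u₁ u₂ u₃ : ℝ → F} {T M θ τ s : ℝ}
    (h1 : ∀ t, HasDerivAt u (u₁ t) t) (h2 : ∀ t, HasDerivAt u₁ (u₂ t) t)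
    (h3 : ∀ t, HasDerivAt u₂ (u₃ t) t)
    (hM : ∀ t ∈ Icc 0 T, ‖u₃ t‖ ≤ M) (hθ : θ ∈ Icc (0 : ℝ) 1) (hτ : 0 ≤ τ) (hs : 0 ≤ s)
    (hsT : s + τ + τ ≤ T) : ‖avgErr θ τ u (s + τ) - avgErr θ τ u s‖ ≤ M * τ ^ 3 := by
  have key := norm_image_sub_le_uIcc (f := avgErr θ τ u) (f' := avgErr θ τ u₁) (x := s)
    (y := s + τ) (K := M * τ ^ 2) (fun z _ => by
      unfold avgErr
      exact ((((h1 _).comp_add_const z τ).const_smul (1 - θ)).add ((h1 z).const_smul θ)).sub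
        ((h1 _).comp_add_const z _)) (fun z hz => by
      rw [uIcc_of_le (by linarith)] at hz
      exact norm_avgErr_le h2 h3 hM hθ hτ (hs.trans hz.1) (by linarith [hz.2]))
  rw [add_sub_cancel_left, abs_of_nonneg hτ] at key
  calc _ ≤ _ := key
    _ = _ := by ring

theorem norm_dq_sub_le {u u₁ u₂ : ℝ → F} {T M θ τ s : ℝ}
    (h1 : ∀ t, HasDerivAt u (u₁ t) t) (h2 : ∀ t, HasDerivAt u₁ (u₂ t) t)
    (hM : ∀ t ∈ Icc 0 T, ‖u₂ t‖ ≤ M) (hθ : θ ∈ Icc (0 : ℝ) 1) (hτ : 0 < τ) (hs : 0 ≤ s)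
    (hsT : s + τ ≤ T) :
    ‖τ⁻¹ • (u (s + τ) - u s) - u₁ (s + (1 - θ) * τ)‖ ≤ 2 * M * τ := by
  obtain ⟨hθ0, hθ1⟩ := hθ
  have hθ1' : 0 ≤ 1 - θ := by linarith
  have ht : s + (1 - θ) * τ ∈ Icc 0 T := ⟨by positivity, by nlinarith⟩
  have hM0 : 0 ≤ M := (norm_nonneg _).trans (hM _ ht)
  have e1 := norm_taylor_one_le h1 h2 hM ht (y := s + τ) ⟨by positivity, hsT⟩
  have e2 := norm_taylor_one_le h1 h2 hM ht (y := s) ⟨hs, by linarith⟩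
  set t := s + (1 - θ) * τ with htdef
  have d1 : s + τ - t = θ * τ := by rw [htdef]; ring
  have d2 : s - t = -((1 - θ) * τ) := by rw [htdef]; ring
  have a1 : |s + τ - t| ≤ τ := by rw [d1, abs_of_nonneg (by positivity)]; nlinarith
  have a2 : |s - t| ≤ τ := by rw [d2, abs_neg, abs_of_nonneg (by positivity)]; nlinarith
  have e : τ⁻¹ • (u (s + τ) - u s) - u₁ t
      = τ⁻¹ • ((u (s + τ) - u t - (s + τ - t) • u₁ t) - (u s - u t - (s - t) • u₁ t)) := by
    have : u₁ t = τ⁻¹ • (τ • u₁ t) := by rw [smul_smul, inv_mul_cancel₀ hτ.ne', one_smul]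
    nth_rewrite 1 [this]
    rw [d1, d2]
    module
  rw [e, norm_smul, Real.norm_of_nonneg (by positivity)]
  have f1 : M * |s + τ - t| ^ 2 ≤ M * τ ^ 2 := by gcongr
  have f2 : M * |s - t| ^ 2 ≤ M * τ ^ 2 := by gcongr
  calc _ ≤ τ⁻¹ * (M * τ ^ 2 + M * τ ^ 2) := by
        gcongr
        exact (norm_sub_le _ _).trans (add_le_add (e1.trans f1) (e2.trans f2))
    _ = _ := by field_simp; ring

/-- At the midpoint the quadratic Taylor terms of the two endpoints coincide and drop out of the
difference, whence the extra order for `θ = 1/2`. -/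
theorem norm_dq_sub_midpoint_le {u u₁ u₂ u₃ : ℝ → F} {T M τ s : ℝ}
    (h1 : ∀ t, HasDerivAt u (u₁ t) t) (h2 : ∀ t, HasDerivAt u₁ (u₂ t) t)
    (h3 : ∀ t, HasDerivAt u₂ (u₃ t) t)
    (hM : ∀ t ∈ Icc 0 T, ‖u₃ t‖ ≤ M) (hτ : 0 < τ) (hs : 0 ≤ s) (hsT : s + τ ≤ T) :
    ‖τ⁻¹ • (u (s + τ) - u s) - u₁ (s + (1 - 1 / 2) * τ)‖ ≤ 2 * M * τ ^ 2 := by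
  have ht : s + (1 - 1 / 2) * τ ∈ Icc 0 T := ⟨by norm_num; positivity, by linarith⟩
  have hM0 : 0 ≤ M := (norm_nonneg _).trans (hM _ ht)
  have e1 := norm_taylor_two_le h1 h2 h3 hM ht (y := s + τ) ⟨by positivity, hsT⟩
  have e2 := norm_taylor_two_le h1 h2 h3 hM ht (y := s) ⟨hs, by linarith⟩
  set t := s + (1 - 1 / 2) * τ with htdef
  have d1 : s + τ - t = τ / 2 := by rw [htdef]; ring
  have d2 : s - t = -(τ / 2) := by rw [htdef]; ring
  have a1 : |s + τ - t| ≤ τ := by rw [d1, abs_of_nonneg (by positivity)]; linarith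
  have a2 : |s - t| ≤ τ := by rw [d2, abs_neg, abs_of_nonneg (by positivity)]; linarith
  have e : τ⁻¹ • (u (s + τ) - u s) - u₁ t
      = τ⁻¹ • ((u (s + τ) - u t - (s + τ - t) • u₁ t - ((s + τ - t) ^ 2 / 2) • u₂ t)
        - (u s - u t - (s - t) • u₁ t - ((s - t) ^ 2 / 2) • u₂ t)) := by
    have : u₁ t = τ⁻¹ • (τ • u₁ t) := by rw [smul_smul, inv_mul_cancel₀ hτ.ne', one_smul]
    nth_rewrite 1 [this]
    rw [d1, d2]
    module
  rw [e, norm_smul, Real.norm_of_nonneg (by positivity)]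
  have f1 : M * |s + τ - t| ^ 3 ≤ M * τ ^ 3 := by gcongr
  have f2 : M * |s - t| ^ 3 ≤ M * τ ^ 3 := by gcongr
  calc _ ≤ τ⁻¹ * (M * τ ^ 3 + M * τ ^ 3) := by
        gcongr
        exact (norm_sub_le _ _).trans (add_le_add (e1.trans f1) (e2.trans f2))
    _ = _ := by field_simp; ring

/-- A `C³` curve given together with its derivatives. -/
structure IsC3 (u u₁ u₂ u₃ : ℝ → F) : Prop where
  h1 : ∀ t, HasDerivAt u (u₁ t) t
  h2 : ∀ t, HasDerivAt u₁ (u₂ t) t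
  h3 : ∀ t, HasDerivAt u₂ (u₃ t) t
  h4 : Continuous u₃

theorem exists_isC3_extension [CompleteSpace F] {T : ℝ} (hT : 0 < T) {u : ℝ → F}
    (hu : ContDiffOn ℝ 3 u (Icc 0 T)) :
    ∃ U U₁ U₂ U₃ : ℝ → F, IsC3 U U₁ U₂ U₃ ∧ EqOn U u (Icc 0 T) := by
  obtain ⟨U, hU, hUu⟩ := exists_contDiff_extension hT 3 u (by exact_mod_cast hu)
  have e3 : ((3 : ℕ) : WithTop ℕ∞) = ((2 : ℕ) : WithTop ℕ∞) + 1 := by norm_num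
  have e2 : ((2 : ℕ) : WithTop ℕ∞) = ((1 : ℕ) : WithTop ℕ∞) + 1 := by norm_num
  have e1 : ((1 : ℕ) : WithTop ℕ∞) = ((0 : ℕ) : WithTop ℕ∞) + 1 := by norm_num
  rw [e3, contDiff_succ_iff_deriv] at hU
  obtain ⟨d0, -, hU⟩ := hU
  rw [e2, contDiff_succ_iff_deriv] at hU
  obtain ⟨d1, -, hU⟩ := hU
  rw [e1, contDiff_succ_iff_deriv] at hU
  obtain ⟨d2, -, hU⟩ := hU
  exact ⟨U, deriv U, deriv (deriv U), deriv (deriv (deriv U)),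
    ⟨fun t => (d0 t).hasDerivAt, fun t => (d1 t).hasDerivAt, fun t => (d2 t).hasDerivAt,
      hU.continuous⟩, hUu⟩

theorem IsC3.deriv_eq {u U U₁ U₂ U₃ : ℝ → F} {T : ℝ} (hU : IsC3 U U₁ U₂ U₃)
    (h : EqOn U u (Icc 0 T)) {t : ℝ} (ht : t ∈ Ioo 0 T) : deriv u t = U₁ t := by
  have : u =ᶠ[nhds t] U := by
    filter_upwards [Icc_mem_nhds ht.1 ht.2] with s hs
    exact (h hs).symm
  rw [this.deriv_eq]
  exact (hU.h1 t).deriv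

theorem IsC3.exists_bounds {u u₁ u₂ u₃ : ℝ → F} (hu : IsC3 u u₁ u₂ u₃) {T θ : ℝ}
    (hθ : θ ∈ Icc (0 : ℝ) 1) :
    ∃ M : ℝ, 0 ≤ M ∧ ∀ τ s : ℝ, 0 < τ → 0 ≤ s → s + τ ≤ T →
      ‖avgErr θ τ u s‖ ≤ M * τ ^ 2 ∧
      (s + τ + τ ≤ T → ‖avgErr θ τ u (s + τ) - avgErr θ τ u s‖ ≤ M * τ ^ 3) ∧
      ‖τ⁻¹ • (u (s + τ) - u s) - u₁ (s + (1 - θ) * τ)‖ ≤ M * τ ^ order θ := by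
  have c2 : Continuous u₂ := continuous_iff_continuousAt.2 fun t => (hu.h3 t).continuousAt
  obtain ⟨M₂, hM₂⟩ := (isCompact_Icc (a := (0 : ℝ)) (b := T)).exists_bound_of_continuousOn
    c2.continuousOn
  obtain ⟨M₃, hM₃⟩ := (isCompact_Icc (a := (0 : ℝ)) (b := T)).exists_bound_of_continuousOn
    hu.h4.continuousOn
  refine ⟨2 * (|M₂| + |M₃|), by positivity, fun τ s hτ hs hsT => ?_⟩
  have l2 := le_abs_self M₂
  have l3 := le_abs_self M₃
  have n2 := abs_nonneg M₂
  have n3 := abs_nonneg M₃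
  refine ⟨(norm_avgErr_le hu.h1 hu.h2 hM₂ hθ hτ.le hs hsT).trans ?_, fun h =>
    (norm_avgErr_sub_le hu.h1 hu.h2 hu.h3 hM₃ hθ hτ.le hs h).trans ?_, ?_⟩
  · gcongr; linarith
  · gcongr; linarith
  · unfold order
    split_ifs with h
    · subst h
      refine (norm_dq_sub_midpoint_le hu.h1 hu.h2 hu.h3 hM₃ hτ hs hsT).trans ?_
      gcongr; linarith
    · rw [pow_one]
      refine (norm_dq_sub_le hu.h1 hu.h2 hM₂ hθ hτ hs hsT).trans ?_
      gcongr; linarith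

end

/-! ### Taylor and Caputo formulas, and the discrete comparison curve -/

section

variable {F : Type*} [NormedAddCommGroup F] [NormedSpace ℝ F]

theorem intervalIntegrable_sub_rpow {γ : ℝ} (hγ : -1 < γ) (t : ℝ) :
    IntervalIntegrable (fun s : ℝ => (t - s) ^ γ) volume 0 t := by
  have h := (intervalIntegral.intervalIntegrable_rpow' (a := 0) (b := t) hγ).comp_sub_left t
  simpa using h.symm

/-- Integration by parts against a possibly singular kernel. The primitive is continuous up to `s =
t` because `γ + 1 > 0`, and the fundamental theorem needs its derivative only in the interior. -/
theorem integral_sub_rpow_smul [CompleteSpace F] {γ : ℝ} (hγ : -1 < γ) {V V₁ : ℝ → F}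
    (hV : ∀ t, HasDerivAt V (V₁ t) t) (hV₁ : Continuous V₁) {t : ℝ} (ht : 0 ≤ t) :
    ∫ s in (0 : ℝ)..t, (t - s) ^ γ • V s
      = (t ^ (γ + 1) / (γ + 1)) • V 0
        + ∫ s in (0 : ℝ)..t, ((t - s) ^ (γ + 1) / (γ + 1)) • V₁ s := by
  have hγ1 : 0 < γ + 1 := by linarith
  have cV : Continuous V := continuous_iff_continuousAt.2 fun t => (hV t).continuousAt
  have ccoef : Continuous fun s : ℝ => (t - s) ^ (γ + 1) / (γ + 1) :=
    ((continuous_const.sub continuous_id).rpow_const fun _ => Or.inr hγ1.le).div_const _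
  have i1 : IntervalIntegrable (fun s => (t - s) ^ γ • V s) volume 0 t :=
    (intervalIntegrable_sub_rpow hγ t).smul_continuousOn cV.continuousOn
  have i2 : IntervalIntegrable (fun s => ((t - s) ^ (γ + 1) / (γ + 1)) • V₁ s) volume 0 t :=
    (ccoef.smul hV₁).intervalIntegrable _ _
  have key := intervalIntegral.integral_eq_sub_of_hasDerivAt_of_le
    (f := fun s => -(((t - s) ^ (γ + 1) / (γ + 1)) • V s))
    (f' := fun s => (t - s) ^ γ • V s - ((t - s) ^ (γ + 1) / (γ + 1)) • V₁ s) ht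
    (ccoef.smul cV).neg.continuousOn (fun s hs => by
      have hts : t - s ≠ 0 := by linarith [hs.2]
      have e1 : HasDerivAt (fun s : ℝ => (t - s) ^ (γ + 1) / (γ + 1)) (-(t - s) ^ γ) s := by
        have := (((hasDerivAt_id s).const_sub t).rpow_const (p := γ + 1) (Or.inl hts)).div_const
          (γ + 1)
        refine this.congr_deriv ?_
        simp only [id_eq, add_sub_cancel_right]
        field_simp
      refine ((e1.smul (hV s)).neg).congr_deriv ?_
      module) (i1.sub i2)
  rw [intervalIntegral.integral_sub i1 i2] at key
  simp only [sub_self, Real.zero_rpow hγ1.ne', zero_div, zero_smul, neg_zero, sub_zero,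
    zero_sub, neg_neg] at key
  rw [← key]
  abel

/-- A range of integration independent of `t` lets discrete convolutions over different times pass
under a single integral. -/
theorem integral_sub_rpow_eq_max {γ : ℝ} (hγ : 0 < γ) (c : ℝ) {W : ℝ → F} (hW : Continuous W)
    {t T : ℝ} (ht : 0 ≤ t) (htT : t ≤ T) :
    ∫ s in (0 : ℝ)..t, ((t - s) ^ γ / c) • W s
      = ∫ s in (0 : ℝ)..T, ((max (t - s) 0) ^ γ / c) • W s := by
  have hc : Continuous fun s : ℝ => ((max (t - s) 0) ^ γ / c) • W s :=
    ((((continuous_const.sub continuous_id).max continuous_const).rpow_const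
      fun _ => Or.inr hγ.le).div_const _).smul hW
  rw [← intervalIntegral.integral_add_adjacent_intervals (hc.intervalIntegrable 0 t)
    (hc.intervalIntegrable t T)]
  have e2 : ∫ s in t..T, ((max (t - s) 0) ^ γ / c) • W s = 0 := by
    rw [← intervalIntegral.integral_zero (a := t) (b := T) (μ := volume) (E := F)]
    refine intervalIntegral.integral_congr fun s hs => ?_
    rw [uIcc_of_le htT] at hs
    simp [max_eq_right (show t - s ≤ 0 by linarith [hs.1]), Real.zero_rpow hγ.ne']
  rw [e2, add_zero]
  refine intervalIntegral.integral_congr fun s hs => ?_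
  rw [uIcc_of_le ht] at hs
  rw [max_eq_left (by linarith [hs.2])]

/-- Taylor's formula for a curve vanishing at `0`. -/
theorem IsC3.eq_taylor [CompleteSpace F] {u u₁ u₂ u₃ : ℝ → F} (hu : IsC3 u u₁ u₂ u₃)
    (h0 : u 0 = 0) {t T : ℝ} (ht : 0 ≤ t) (htT : t ≤ T) :
    u t = t • u₁ 0 + (t ^ 2 / 2) • u₂ 0
      + ∫ s in (0 : ℝ)..T, ((max (t - s) 0) ^ 2 / 2) • u₃ s := by
  have c1 : Continuous u₁ := continuous_iff_continuousAt.2 fun t => (hu.h2 t).continuousAt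
  have c2 : Continuous u₂ := continuous_iff_continuousAt.2 fun t => (hu.h3 t).continuousAt
  have e0 : u t = ∫ s in (0 : ℝ)..t, (t - s) ^ (0 : ℝ) • u₁ s := by
    simp only [Real.rpow_zero, one_smul]
    rw [intervalIntegral.integral_eq_sub_of_hasDerivAt (fun s _ => hu.h1 s)
      (c1.intervalIntegrable _ _), h0, sub_zero]
  have e1 := integral_sub_rpow_smul (γ := 0) (by norm_num) hu.h2 c2 ht
  have e2 := integral_sub_rpow_smul (γ := 1) (by norm_num) hu.h3 hu.h4 ht
  simp only [zero_add, div_one] at e1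
  rw [e0, e1, e2, integral_sub_rpow_eq_max (by norm_num) _ hu.h4 ht htT]
  simp only [Real.rpow_one, show (1 : ℝ) + 1 = 2 by norm_num, Real.rpow_two, add_assoc]

/-- The Caputo derivative of a `C³` curve. -/
theorem IsC3.caputo_eq [CompleteSpace F] {u u₁ u₂ u₃ : ℝ → F} (hu : IsC3 u u₁ u₂ u₃)
    {α : ℝ} (hα0 : 0 < α) (hα1 : α < 1) {t T : ℝ} (ht : 0 ≤ t) (htT : t ≤ T) :
    caputo α u t = (t ^ (1 - α) / Real.Gamma (2 - α)) • u₁ 0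
      + (t ^ (2 - α) / Real.Gamma (3 - α)) • u₂ 0
      + ∫ s in (0 : ℝ)..T, ((max (t - s) 0) ^ (2 - α) / Real.Gamma (3 - α)) • u₃ s := by
  have c2 : Continuous u₂ := continuous_iff_continuousAt.2 fun t => (hu.h3 t).continuousAt
  have hα1' : 0 < 1 - α := by linarith
  have hα2' : 0 < 2 - α := by linarith
  have hG0 : Real.Gamma (1 - α) ≠ 0 := (Real.Gamma_pos_of_pos hα1').ne'
  have hΓ2 : Real.Gamma (2 - α) = (1 - α) * Real.Gamma (1 - α) := by
    rw [show 2 - α = (1 - α) + 1 by ring, Real.Gamma_add_one hα1'.ne']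
  have hΓ3 : Real.Gamma (3 - α) = (2 - α) * ((1 - α) * Real.Gamma (1 - α)) := by
    rw [show 3 - α = (2 - α) + 1 by ring, Real.Gamma_add_one hα2'.ne', hΓ2]
  have hd : deriv u = u₁ := funext fun t => (hu.h1 t).deriv
  rw [caputo, rlIntegral, hd, show 1 - α - 1 = -α by ring]
  rw [integral_sub_rpow_smul (γ := -α) (by linarith) hu.h2 c2 ht]
  have e2 : ∫ s in (0 : ℝ)..t, ((t - s) ^ (-α + 1) / (-α + 1)) • u₂ s
      = (-α + 1)⁻¹ • ∫ s in (0 : ℝ)..t, (t - s) ^ (-α + 1) • u₂ s := by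
    rw [← intervalIntegral.integral_smul]
    refine intervalIntegral.integral_congr fun s _ => ?_
    rw [smul_smul]; congr 1; ring
  rw [e2, integral_sub_rpow_smul (γ := -α + 1) (by linarith) hu.h3 hu.h4 ht,
    integral_sub_rpow_eq_max (by linarith) _ hu.h4 ht htT]
  have e3 : ∫ s in (0 : ℝ)..T, ((max (t - s) 0) ^ (2 - α) / Real.Gamma (3 - α)) • u₃ s
      = ((Real.Gamma (1 - α))⁻¹ * (-α + 1)⁻¹) •
        ∫ s in (0 : ℝ)..T, ((max (t - s) 0) ^ (-α + 1 + 1) / (-α + 1 + 1)) • u₃ s := by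
    rw [← intervalIntegral.integral_smul]
    refine intervalIntegral.integral_congr fun s _ => ?_
    rw [smul_smul, hΓ3, show -α + 1 + 1 = 2 - α by ring, show -α + 1 = 1 - α by ring]
    congr 1; field_simp
  rw [e3, hΓ3, hΓ2, show -α + 1 + 1 = 2 - α by ring, show -α + 1 = 1 - α by ring]
  simp only [smul_add, smul_smul]
  rw [← add_assoc]
  congr 3
  · field_simp
  · field_simp

/-- Composition of two discrete convolutions. -/
theorem sum_coeff_smul_sum_coeff_smul (P Q : PowerSeries ℝ) (g : ℕ → F) (n : ℕ) :
    ∑ k ∈ Finset.range (n + 1), PowerSeries.coeff (n - k) P •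
        ∑ j ∈ Finset.range (k + 1), PowerSeries.coeff (k - j) Q • g j
      = ∑ j ∈ Finset.range (n + 1), PowerSeries.coeff (n - j) (P * Q) • g j := by
  simp only [Finset.smul_sum, smul_smul]
  rw [Finset.sum_comm' (t' := Finset.range (n + 1)) (s' := fun j => Finset.Ico j (n + 1))
    (fun k j => by simp only [Finset.mem_range, Finset.mem_Ico]; omega)]
  refine Finset.sum_congr rfl fun j hj => ?_
  have hj' : j ≤ n := by simpa [Nat.lt_succ_iff] using hj
  rw [mul_comm P Q, PowerSeries.coeff_mul, Finset.Nat.sum_antidiagonal_eq_sum_range_succ_mk,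
    Finset.sum_smul, Finset.sum_Ico_eq_sum_range, show n + 1 - j = (n - j).succ by omega]
  refine Finset.sum_congr rfl fun i _ => ?_
  rw [show j + i - j = i by omega, show n - (j + i) = n - j - i by omega, mul_comm]

/-- This is `ω κ = 1`. Since `g 0 = 0`, the discrete integral starts from zero, and the missing
index `k = 0` of the quotient can be added freely. -/
theorem fracDq_conv {α θ τ : ℝ} (hα : 0 < α) (hθ : α / 2 ≤ θ) (hτ : 0 < τ) (g : ℕ → F)
    (hg : g 0 = 0) (n : ℕ) :
    fracDq α θ τ (fun n => τ ^ α • ∑ k ∈ Finset.range (n + 1),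
      PowerSeries.coeff (n - k) (kappaSer α θ) • g k) n = g n := by
  rw [fracDq]
  have e1 : ∀ k, (τ ^ α • ∑ j ∈ Finset.range (k + 1),
        PowerSeries.coeff (k - j) (kappaSer α θ) • g j)
      - τ ^ α • ∑ j ∈ Finset.range (0 + 1), PowerSeries.coeff (0 - j) (kappaSer α θ) • g j
      = τ ^ α • ∑ j ∈ Finset.range (k + 1), PowerSeries.coeff (k - j) (kappaSer α θ) • g j := by
    intro k; simp [hg]
  simp only [e1]
  have e2 : ∑ k ∈ Finset.Icc 1 n, weight α θ (n - k) • τ ^ α •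
        ∑ j ∈ Finset.range (k + 1), PowerSeries.coeff (k - j) (kappaSer α θ) • g j
      = ∑ k ∈ Finset.range (n + 1), weight α θ (n - k) • τ ^ α •
        ∑ j ∈ Finset.range (k + 1), PowerSeries.coeff (k - j) (kappaSer α θ) • g j := by
    refine Finset.sum_subset (fun k hk => ?_) fun k hk hk' => ?_
    · simp only [Finset.mem_Icc, Finset.mem_range] at hk ⊢
      omega
    · simp only [Finset.mem_Icc, Finset.mem_range] at hk hk'
      obtain rfl : k = 0 := by omega
      simp [hg]
  have e3 : ∀ (k : ℕ) (z : F), weight α θ (n - k) • τ ^ α • z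
      = τ ^ α • PowerSeries.coeff (n - k) (omegaSer α θ) • z := fun k z => by
    rw [weight_eq_coeff hα hθ, smul_comm]
  rw [e2]
  simp only [e3, ← Finset.smul_sum]
  rw [smul_smul, ← Real.rpow_add hτ, neg_add_cancel, Real.rpow_zero, one_smul,
    sum_coeff_smul_sum_coeff_smul, omegaSer_mul_kappaSer hα hθ, Finset.sum_range_succ,
    Finset.sum_eq_zero]
  · simp
  · intro j hj
    have : j < n := by simpa using hj
    rw [PowerSeries.coeff_one, if_neg (by omega), zero_smul]

theorem coeff_mul_mk (P : PowerSeries ℝ) (f : ℕ → ℝ) (n : ℕ) :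
    PowerSeries.coeff n (P * PowerSeries.mk f)
      = ∑ k ∈ Finset.range (n + 1), PowerSeries.coeff (n - k) P * f k := by
  rw [mul_comm, PowerSeries.coeff_mul, Finset.Nat.sum_antidiagonal_eq_sum_range_succ_mk]
  refine Finset.sum_congr rfl fun k _ => ?_
  rw [PowerSeries.coeff_mk, mul_comm]

/-- A discrete curve whose fractional difference quotients are the exact Caputo derivatives, and
which differs from the curve `u` by a sequence of small total variation. -/
theorem IsC3.exists_discrete_comparison [CompleteSpace F] {u u₁ u₂ u₃ : ℝ → F}
    (hu : IsC3 u u₁ u₂ u₃) (hu0 : u 0 = 0) {α θ T : ℝ} (h0 : 0 < α) (h1 : α < 1)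
    (hθ : θ ∈ Icc (α / 2) (1 / 2)) (hT : 0 < T) :
    ∃ C : ℝ, 0 ≤ C ∧ ∀ (N : ℕ) (τ : ℝ), 0 < τ → N * τ ≤ T → ∃ p : ℕ → F, p 0 = 0 ∧
      (∀ n, 1 ≤ n → n ≤ N → fracDq α θ τ p n = caputo α u ((n - θ) * τ)) ∧
      ∑ n ∈ Finset.range N, ‖(p (n + 1) - u ((n + 1 : ℕ) * τ)) - (p n - u (n * τ))‖
        ≤ C * (τ * ‖u₁ 0‖ + τ ^ 2) := by
  have hθ0 : 0 < θ := by linarith [hθ.1]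
  obtain ⟨C₁, hC₁⟩ := exists_linear_error_bound h0 h1 hθ
  obtain ⟨C₂, hC₂⟩ := exists_quadratic_error_bound h0 h1 hθ
  obtain ⟨M, hM⟩ := (isCompact_Icc (a := (0 : ℝ)) (b := T)).exists_bound_of_continuousOn
    hu.h4.continuousOn
  have hM0 : 0 ≤ M := (norm_nonneg _).trans (hM 0 ⟨le_rfl, hT.le⟩)
  have hC₁0 := hC₁.nonneg
  have hC₂0 := (hC₂ 0 le_rfl).nonneg
  refine ⟨C₁ + (C₂ * ‖u₂ 0‖ + C₂ * M * T), by positivity, fun N τ hτ hN => ?_⟩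
  have hα1 : 0 < 1 - α := by linarith
  have hα2 : 0 < 2 - α := by linarith
  set a₁ : ℕ → ℝ := fun k => (max ((k : ℝ) - θ) 0) ^ (1 - α) / Real.Gamma (2 - α) with ha₁
  set a₂ : ℝ → ℕ → ℝ := fun s k => (max ((k : ℝ) - s - θ) 0) ^ (2 - α) / Real.Gamma (3 - α)
    with ha₂
  set b₂ : ℝ → ℕ → ℝ := fun s k => (max ((k : ℝ) - s) 0) ^ 2 / 2 with hb₂
  set d₁ : ℕ → ℝ := fun n => PowerSeries.coeff n (kappaSer α θ * PowerSeries.mk a₁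
    - PowerSeries.mk (fun k : ℕ => (k : ℝ))) with hd₁
  set d₂ : ℝ → ℕ → ℝ := fun s n => PowerSeries.coeff n (kappaSer α θ * PowerSeries.mk (a₂ s)
    - PowerSeries.mk (b₂ s)) with hd₂
  have hd₁' : ∀ n, d₁ n = ∑ k ∈ Finset.range (n + 1),
      PowerSeries.coeff (n - k) (kappaSer α θ) * a₁ k - n := fun n => by
    simp only [hd₁]; rw [map_sub, coeff_mul_mk, PowerSeries.coeff_mk]
  have hd₂' : ∀ s n, d₂ s n = ∑ k ∈ Finset.range (n + 1),
      PowerSeries.coeff (n - k) (kappaSer α θ) * a₂ s k - b₂ s n := fun s n => by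
    simp only [hd₂]; rw [map_sub, coeff_mul_mk, PowerSeries.coeff_mk]
  have ca₂ : ∀ k, Continuous fun s : ℝ => a₂ (s / τ) k := fun k =>
    ((Continuous.max (by fun_prop) continuous_const).rpow_const
      fun _ => Or.inr hα2.le).div_const _
  have cb₂ : ∀ k, Continuous fun s : ℝ => b₂ (s / τ) k := fun k =>
    ((Continuous.max (by fun_prop) continuous_const).pow 2).div_const _
  have cd₂ : ∀ n, Continuous fun s : ℝ => d₂ (s / τ) n := fun n => by
    simp only [hd₂']
    exact (continuous_finsetSum _ fun k _ => continuous_const.mul (ca₂ k)).sub (cb₂ n)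
  -- The Caputo derivative at `t_{k-θ}` as a superposition of unit-step kernels with the powers of
  -- `τ` scaled out. The truncation by `max` makes it vanish at `k = 0`, where `k - θ < 0`.
  set g : ℕ → F := fun k => (τ ^ (1 - α) * a₁ k) • u₁ 0 + (τ ^ (2 - α) * a₂ 0 k) • u₂ 0
    + ∫ s in (0 : ℝ)..T, (τ ^ (2 - α) * a₂ (s / τ) k) • u₃ s with hg
  have hscale : ∀ (γ x : ℝ), (max (x * τ) 0) ^ γ = τ ^ γ * (max x 0) ^ γ := by
    intro γ x
    have : max (x * τ) 0 = τ * max x 0 := by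
      rw [mul_max_of_nonneg _ _ hτ.le, mul_zero, mul_comm]
    rw [this, Real.mul_rpow hτ.le (le_max_right _ _)]
  have hgc : ∀ n : ℕ, 1 ≤ n → n ≤ N → g n = caputo α u ((n - θ) * τ) := by
    intro n hn hnN
    have hn' : (1 : ℝ) ≤ n := by exact_mod_cast hn
    have hnN' : (n : ℝ) ≤ N := by exact_mod_cast hnN
    have hnθ : 0 ≤ (n : ℝ) - θ := by linarith [hθ.2]
    have ht0 : 0 ≤ ((n : ℝ) - θ) * τ := by positivity
    rw [hu.caputo_eq h0 h1 (T := T) ht0 (by nlinarith)]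
    simp only [hg, ha₁, ha₂]
    congr 1
    · congr 2
      · rw [max_eq_left hnθ, Real.mul_rpow hnθ hτ.le]; ring
      · rw [sub_zero, max_eq_left hnθ, Real.mul_rpow hnθ hτ.le]; ring
    · refine intervalIntegral.integral_congr fun s _ => ?_
      have e : ((n : ℝ) - θ) * τ - s = ((n : ℝ) - s / τ - θ) * τ := by field_simp; ring
      rw [e, hscale]
      congr 1; ring
  have hg0 : g 0 = 0 := by
    simp only [hg, ha₁, ha₂]
    have e1 : max (((0 : ℕ) : ℝ) - θ) 0 = 0 := max_eq_right (by push_cast; linarith)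
    have e2 : ∫ s in (0 : ℝ)..T, (τ ^ (2 - α) *
        ((max (((0 : ℕ) : ℝ) - s / τ - θ) 0) ^ (2 - α) / Real.Gamma (3 - α))) • u₃ s = 0 := by
      rw [← intervalIntegral.integral_zero (a := 0) (b := T) (μ := volume) (E := F)]
      refine intervalIntegral.integral_congr fun s hs => ?_
      rw [uIcc_of_le hT.le] at hs
      have : 0 ≤ s / τ := div_nonneg hs.1 hτ.le
      simp [max_eq_right (show -(s / τ) - θ ≤ 0 by linarith), Real.zero_rpow hα2.ne']
    rw [e2, sub_zero, e1, Real.zero_rpow hα1.ne', Real.zero_rpow hα2.ne']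
    simp
  set p : ℕ → F := fun n => τ ^ α • ∑ k ∈ Finset.range (n + 1),
      PowerSeries.coeff (n - k) (kappaSer α θ) • g k with hp
  refine ⟨p, by simp [hp, hg0], fun n hn hnN => ?_, ?_⟩
  · rw [hp, fracDq_conv h0 hθ.1 hτ g hg0, hgc n hn hnN]
  have hτ1 : τ ^ α * τ ^ (1 - α) = τ := by
    rw [← Real.rpow_add hτ, show α + (1 - α) = 1 by ring, Real.rpow_one]
  have hτ2 : τ ^ α * τ ^ (2 - α) = τ ^ 2 := by
    rw [← Real.rpow_add hτ, show α + (2 - α) = 2 by ring, Real.rpow_two]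
  -- Subtracting Taylor's formula term by term leaves the scalar quadrature errors, with weight `τ`
  -- for the linear part and `τ²` for the other two.
  have hδ : ∀ n : ℕ, n ≤ N → p n - u (n * τ) = (τ * d₁ n) • u₁ 0 + (τ ^ 2 * d₂ 0 n) • u₂ 0
      + ∫ s in (0 : ℝ)..T, (τ ^ 2 * d₂ (s / τ) n) • u₃ s := by
    intro n hnN
    have hnN' : (n : ℝ) ≤ N := by exact_mod_cast hnN
    have hut := hu.eq_taylor hu0 (t := n * τ) (T := T) (by positivity) (by nlinarith)
    have eI : ∫ s in (0 : ℝ)..T, (τ ^ 2 * d₂ (s / τ) n) • u₃ s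
        = (∑ k ∈ Finset.range (n + 1), (τ ^ α * PowerSeries.coeff (n - k) (kappaSer α θ)) •
            ∫ s in (0 : ℝ)..T, (τ ^ (2 - α) * a₂ (s / τ) k) • u₃ s)
          - ∫ s in (0 : ℝ)..T, ((max (n * τ - s) 0) ^ 2 / 2) • u₃ s := by
      simp only [← intervalIntegral.integral_smul]
      rw [← intervalIntegral.integral_finsetSum, ← intervalIntegral.integral_sub]
      · refine intervalIntegral.integral_congr fun s _ => ?_
        simp only [smul_smul]
        rw [← Finset.sum_smul, ← sub_smul, hd₂', mul_sub, Finset.mul_sum]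
        congr 2
        · refine Finset.sum_congr rfl fun k _ => ?_
          rw [← hτ2]; ring
        · simp only [hb₂]
          have e : (n : ℝ) * τ - s = ((n : ℝ) - s / τ) * τ := by field_simp
          rw [e]
          have := hscale 2 ((n : ℝ) - s / τ)
          rw [Real.rpow_two, Real.rpow_two, Real.rpow_two] at this
          rw [this]; ring
      · refine Continuous.intervalIntegrable ?_ _ _
        refine continuous_finsetSum _ fun k _ => ?_
        exact ((continuous_const.mul (ca₂ k)).smul hu.h4).const_smul _
      · refine Continuous.intervalIntegrable ?_ _ _
        exact ((((continuous_const.sub continuous_id).max continuous_const).pow 2).div_const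
          _).smul hu.h4
      · intro k _
        refine Continuous.intervalIntegrable ?_ _ _
        exact ((continuous_const.mul (ca₂ k)).smul hu.h4).const_smul _
    have e1 : (τ * d₁ n) = ∑ k ∈ Finset.range (n + 1),
        (τ ^ α * PowerSeries.coeff (n - k) (kappaSer α θ)) * (τ ^ (1 - α) * a₁ k) - n * τ := by
      rw [hd₁', mul_sub, Finset.mul_sum, mul_comm τ (n : ℝ)]
      congr 1
      refine Finset.sum_congr rfl fun k _ => ?_
      nth_rewrite 1 [← hτ1]; ring
    have e2 : (τ ^ 2 * d₂ 0 n) = ∑ k ∈ Finset.range (n + 1),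
        (τ ^ α * PowerSeries.coeff (n - k) (kappaSer α θ)) * (τ ^ (2 - α) * a₂ 0 k)
          - (n * τ) ^ 2 / 2 := by
      rw [hd₂', mul_sub, Finset.mul_sum]
      congr 1
      · refine Finset.sum_congr rfl fun k _ => ?_
        nth_rewrite 1 [← hτ2]; ring
      · simp only [hb₂]
        rw [sub_zero, max_eq_left (by positivity)]; ring
    rw [hut, eI, e1, e2]
    simp only [hp, hg]
    simp only [smul_add, Finset.smul_sum, Finset.sum_add_distrib, sub_smul, Finset.sum_smul,
      smul_smul, mul_assoc]
    abel
  have hinc : ∀ n ∈ Finset.range N, ‖(p (n + 1) - u ((n + 1 : ℕ) * τ)) - (p n - u (n * τ))‖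
      ≤ τ * |d₁ (n + 1) - d₁ n| * ‖u₁ 0‖ + τ ^ 2 * |d₂ 0 (n + 1) - d₂ 0 n| * ‖u₂ 0‖
        + ∫ s in (0 : ℝ)..T, τ ^ 2 * |d₂ (s / τ) (n + 1) - d₂ (s / τ) n| * M := by
    intro n hn
    have hn' : n < N := by simpa using hn
    rw [hδ (n + 1) (by omega), hδ n (by omega)]
    have e : ∀ A B C A' B' C' : F, A + B + C - (A' + B' + C') = (A - A') + (B - B') + (C - C') :=
      fun _ _ _ _ _ _ => by abel
    have ci : ∀ m, IntervalIntegrable (fun s => (τ ^ 2 * d₂ (s / τ) m) • u₃ s) volume 0 T :=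
      fun m => ((continuous_const.mul (cd₂ m)).smul hu.h4).intervalIntegrable _ _
    rw [e, ← sub_smul, ← sub_smul, ← mul_sub, ← mul_sub,
      ← intervalIntegral.integral_sub (ci (n + 1)) (ci n)]
    refine (norm_add₃_le).trans (add_le_add (add_le_add (le_of_eq ?_) (le_of_eq ?_)) ?_)
    · rw [norm_smul, norm_mul, Real.norm_of_nonneg hτ.le, Real.norm_eq_abs]
    · rw [norm_smul, norm_mul, Real.norm_of_nonneg (by positivity), Real.norm_eq_abs]
    · refine intervalIntegral.norm_integral_le_of_norm_le hT.le
        (Filter.Eventually.of_forall fun s hs => ?_)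
        ((((continuous_const.mul ((cd₂ (n + 1)).sub (cd₂ n)).abs).mul
          continuous_const)).intervalIntegrable _ _)
      rw [← sub_smul, ← mul_sub, norm_smul, norm_mul, Real.norm_of_nonneg (by positivity),
        Real.norm_eq_abs]
      gcongr
      exact hM s ⟨hs.1.le, hs.2⟩
  have hsum : ∀ {G : PowerSeries ℝ} {C : ℝ}, SumAbsLE ((1 - PowerSeries.X) * G) C →
      ∑ n ∈ Finset.range N, |PowerSeries.coeff (n + 1) G - PowerSeries.coeff n G| ≤ C := by
    intro G C h
    have := h (N + 1)
    rw [Finset.sum_range_succ'] at this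
    simp only [coeff_one_sub_X_mul_succ] at this
    linarith [abs_nonneg (PowerSeries.coeff 0 ((1 - PowerSeries.X) * G))]
  have hs₁ : ∑ n ∈ Finset.range N, |d₁ (n + 1) - d₁ n| ≤ C₁ := hsum hC₁
  have hs₂ : ∀ s, 0 ≤ s → ∑ n ∈ Finset.range N, |d₂ s (n + 1) - d₂ s n| ≤ C₂ :=
    fun s hs => hsum (hC₂ s hs)
  have hs₂0 : ∑ n ∈ Finset.range N, |d₂ 0 (n + 1) - d₂ 0 n| ≤ C₂ := hs₂ 0 le_rfl
  -- The sum over `n` is taken inside the integral, where the variation bound holds uniformly in the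
  -- delay `s / τ`.
  have hI : ∑ n ∈ Finset.range N,
      ∫ s in (0 : ℝ)..T, τ ^ 2 * |d₂ (s / τ) (n + 1) - d₂ (s / τ) n| * M ≤ τ ^ 2 * C₂ * M * T := by
    have ci : ∀ n : ℕ, Continuous fun s => τ ^ 2 * |d₂ (s / τ) (n + 1) - d₂ (s / τ) n| * M :=
      fun n => (continuous_const.mul ((cd₂ (n + 1)).sub (cd₂ n)).abs).mul continuous_const
    rw [← intervalIntegral.integral_finsetSum fun n _ => (ci n).intervalIntegrable _ _]
    calc _ ≤ ∫ _ in (0 : ℝ)..T, τ ^ 2 * C₂ * M := by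
          refine intervalIntegral.integral_mono_on hT.le
            ((continuous_finsetSum _ fun n _ => ci n).intervalIntegrable _ _)
            (continuous_const.intervalIntegrable _ _) fun s hs => ?_
          rw [← Finset.sum_mul, ← Finset.mul_sum]
          gcongr
          exact hs₂ _ (div_nonneg hs.1 hτ.le)
      _ = _ := by rw [intervalIntegral.integral_const]; simp; ring
  refine (Finset.sum_le_sum hinc).trans ?_
  rw [Finset.sum_add_distrib, Finset.sum_add_distrib, ← Finset.sum_mul, ← Finset.sum_mul,
    ← Finset.mul_sum, ← Finset.mul_sum]
  calc _ ≤ τ * C₁ * ‖u₁ 0‖ + τ ^ 2 * C₂ * ‖u₂ 0‖ + τ ^ 2 * C₂ * M * T := by gcongr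
    _ ≤ _ := by
      have : 0 ≤ (C₂ * ‖u₂ 0‖ + C₂ * M * T) * (τ * ‖u₁ 0‖) := by positivity
      have : 0 ≤ C₁ * τ ^ 2 := by positivity
      nlinarith

end

/-! ### The energy estimate -/

section

variable {F : Type*} [NormedAddCommGroup F] [InnerProductSpace ℝ F]

/-- The defect is exactly `(1/2 - θ) ‖u - v‖²`; this is where `θ ≤ 1/2` yields dissipation. -/
theorem inner_sub_avg_ge {θ : ℝ} (hθ : θ ≤ 1 / 2) (u v : F) :
    ‖u‖ ^ 2 / 2 - ‖v‖ ^ 2 / 2 ≤ ⟪u - v, (1 - θ) • u + θ • v⟫ := by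
  have e : ⟪u - v, (1 - θ) • u + θ • v⟫
      = ‖u‖ ^ 2 / 2 - ‖v‖ ^ 2 / 2 + (1 / 2 - θ) * ‖u - v‖ ^ 2 := by
    rw [inner_sub_left, inner_add_right, inner_add_right, real_inner_smul_right,
      real_inner_smul_right, real_inner_smul_right, real_inner_smul_right,
      real_inner_self_eq_norm_sq, real_inner_self_eq_norm_sq, real_inner_comm u v,
      norm_sub_sq_real]
    ring
  rw [e]
  nlinarith [sq_nonneg ‖u - v‖]

theorem sum_inner_increment_eq (u r : ℕ → F) (hu : u 0 = 0) (m : ℕ) :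
    ∑ n ∈ Finset.range (m + 1), ⟪u (n + 1) - u n, r n⟫
      = ⟪u (m + 1), r m⟫ - ∑ n ∈ Finset.range m, ⟪u (n + 1), r (n + 1) - r n⟫ := by
  induction m with
  | zero => simp [hu]
  | succ m ih =>
    rw [Finset.sum_range_succ, ih, Finset.sum_range_succ _ m]
    simp only [inner_sub_left, inner_sub_right]
    ring

/-- Summation by parts moves the differences from `u`, whose increments are not controlled, to `r`,
whose variation is small. -/
theorem sum_inner_increment_le {u r : ℕ → F} {B K : ℝ} {N m : ℕ} (hu : u 0 = 0)
    (hm : m ≤ N) (hK : 0 ≤ K) (hB : ∀ n ≤ N, ‖u n‖ ≤ B) (hr : ∀ n < N, ‖r n‖ ≤ K)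
    (hrv : ∑ n ∈ Finset.range (N - 1), ‖r (n + 1) - r n‖ ≤ K) :
    ∑ n ∈ Finset.range m, ⟪u (n + 1) - u n, r n⟫ ≤ B * (2 * K) := by
  have hB0 : 0 ≤ B := (norm_nonneg _).trans (hB 0 (Nat.zero_le _))
  cases m with
  | zero => simp; positivity
  | succ m =>
    rw [sum_inner_increment_eq u r hu]
    have h1 : ⟪u (m + 1), r m⟫ ≤ B * K :=
      (real_inner_le_norm _ _).trans
        (mul_le_mul (hB _ hm) (hr _ (by omega)) (norm_nonneg _) hB0)
    have h2 : -∑ n ∈ Finset.range m, ⟪u (n + 1), r (n + 1) - r n⟫ ≤ B * K := by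
      rw [← Finset.sum_neg_distrib]
      calc _ ≤ ∑ n ∈ Finset.range m, B * ‖r (n + 1) - r n‖ := by
            refine Finset.sum_le_sum fun n hn => ?_
            have hn' : n < m := by simpa using hn
            rw [← inner_neg_left]
            refine (real_inner_le_norm _ _).trans ?_
            rw [norm_neg]
            gcongr
            exact hB _ (by omega)
        _ ≤ ∑ n ∈ Finset.range (N - 1), B * ‖r (n + 1) - r n‖ :=
            Finset.sum_le_sum_of_subset_of_nonneg (Finset.range_mono (by omega))
              fun _ _ _ => by positivity
        _ ≤ B * K := by
            rw [← Finset.mul_sum]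
            gcongr
    linarith

theorem norm_avg_le {θ B : ℝ} (h0 : 0 ≤ θ) (h1 : θ ≤ 1) {u v : F} (hu : ‖u‖ ≤ B) (hv : ‖v‖ ≤ B) :
    ‖(1 - θ) • u + θ • v‖ ≤ B := by
  refine (norm_add_le _ _).trans ?_
  rw [norm_smul, norm_smul, Real.norm_of_nonneg h0, Real.norm_of_nonneg (by linarith)]
  calc _ ≤ (1 - θ) * B + θ * B := by gcongr
    _ = B := by ring

end

theorem add_three_sq_le (x y z : ℝ) : (x + y + z) ^ 2 ≤ 3 * (x ^ 2 + y ^ 2 + z ^ 2) := by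
  linarith [sq_nonneg (x - y), sq_nonneg (x - z), sq_nonneg (y - z)]

/-- If `B` exceeded the bound, then `K ≤ B`, and `b K²` could be absorbed into `b K B`. -/
theorem le_of_sq_le {a b B K : ℝ} (ha : 0 ≤ a) (hb : 0 ≤ b) (hB : 0 ≤ B) (hK : 0 ≤ K)
    (h : B ^ 2 ≤ a * K * B + b * K ^ 2) : B ≤ (a + b + 1) * K := by
  by_contra hlt
  push Not at hlt
  have hKB : K ≤ B := by nlinarith [mul_nonneg ha hK, mul_nonneg hb hK]
  have hB0 : 0 < B := lt_of_le_of_lt (by positivity) hlt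
  have h1 : b * K ^ 2 ≤ b * (K * B) := by
    have : K ^ 2 ≤ K * B := by nlinarith
    gcongr
  have h2 : (a + b + 1) * K * B < B * B := mul_lt_mul_of_pos_right hlt hB0
  nlinarith [mul_nonneg hK hB]

section

variable {V S D : Type*} [NormedAddCommGroup V] [InnerProductSpace ℝ V]
  [NormedAddCommGroup S] [InnerProductSpace ℝ S] [AddCommGroup D] [Module ℝ D]

/-- Stability of the scheme: errors that solve the scheme with residuals `R₁`, `R₂ + ∇ × ρ`, `R₃`
are bounded by the sizes of the residuals. -/
theorem scheme_stability {ε μ c a α θ τ : ℝ} (hε : 0 < ε) (hμ : 0 < μ) (hc : 0 < c) (ha : 0 ≤ a)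
    (hα0 : 0 < α) (hα1 : α < 1) (hθ : θ ∈ Icc (α / 2) (1 / 2)) (hτ : 0 < τ)
    (ι : D →ₗ[ℝ] V) (cu : D →ₗ[ℝ] S) {N : ℕ} {K : ℝ} (hK : 0 ≤ K)
    {eE ρ : ℕ → D} {eP R₁ R₃ : ℕ → V} {eH R₂ : ℕ → S}
    (hE0 : ι (eE 0) = 0) (hP0 : eP 0 = 0) (hH0 : eH 0 = 0)
    (hA : ∀ n < N, ∀ χ : D, ε * ⟪ι (dq τ eE (n + 1)), ι χ⟫ + ⟪dq τ eP (n + 1), ι χ⟫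
      - ⟪avg θ eH (n + 1), cu χ⟫ = ⟪R₁ n, ι χ⟫)
    (hF : ∀ n < N, ∀ φ : S, μ * ⟪dq τ eH (n + 1), φ⟫ + ⟪cu (avg θ eE (n + 1)), φ⟫
      = ⟪R₂ n, φ⟫ + ⟪cu (ρ n), φ⟫)
    (hQ : ∀ n < N, ∀ ψ : V, a * ⟪fracDq α θ τ eP (n + 1), ψ⟫ + ⟪avg θ eP (n + 1), ψ⟫
      - c * ⟪ι (avg θ eE (n + 1)), ψ⟫ = ⟪R₃ n, ψ⟫)
    (hR₁ : ∑ n ∈ Finset.range N, τ * ‖R₁ n‖ ≤ K)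
    (hR₂ : ∑ n ∈ Finset.range N, τ * ‖R₂ n‖ ≤ K)
    (hρ : ∀ n < N, ‖ι (ρ n)‖ ≤ K)
    (hρv : ∑ n ∈ Finset.range (N - 1), ‖ι (ρ (n + 1)) - ι (ρ n)‖ ≤ K)
    (hR₃ : ∀ n < N, ‖R₃ n‖ ≤ K)
    (hR₃v : ∑ n ∈ Finset.range (N - 1), ‖R₃ (n + 1) - R₃ n‖ ≤ K) {n : ℕ} (hn : n ≤ N) :
    ‖ι (eE n)‖ + ‖eP n‖ + ‖eH n‖
      ≤ (6 / min (min (c * ε) (c * μ)) 1 * (4 * c + 2 * (c * ε) + 2)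
        + 6 / min (min (c * ε) (c * μ)) 1 * c + 1) * K := by
  have hθ0 : 0 ≤ θ := by linarith [hθ.1]
  have hθ1 : θ ≤ 1 := by linarith [hθ.2]
  set c₀ := min (min (c * ε) (c * μ)) 1 with hc₀
  have hc₀pos : 0 < c₀ := lt_min (lt_min (by positivity) (by positivity)) one_pos
  have c1 : c₀ ≤ c * ε := (min_le_left _ _).trans (min_le_left _ _)
  have c2 : c₀ ≤ c * μ := (min_le_left _ _).trans (min_le_right _ _)
  have c3 : c₀ ≤ 1 := min_le_right _ _
  set x : ℕ → V := fun n => ι (eE n) with hx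
  set f : ℕ → ℝ := fun n => ‖x n‖ + ‖eP n‖ + ‖eH n‖ with hf
  -- The energy is evaluated at the step where the error is largest. Every residual contribution is
  -- then at most a multiple of `K B` or `K²`, and a quadratic inequality for `B` replaces
  -- Gronwall's.
  obtain ⟨m, hmN, hmax⟩ := Finset.exists_max_image (Finset.range (N + 1)) f ⟨0, by simp⟩
  have hmN' : m ≤ N := by simpa [Nat.lt_succ_iff] using hmN
  set B := f m with hB
  have hfB : ∀ n ≤ N, f n ≤ B := fun n hn => hmax n (by simpa [Nat.lt_succ_iff] using hn)
  have hB0 : 0 ≤ B := by simp only [hB, hf]; positivity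
  have hxB : ∀ n ≤ N, ‖x n‖ ≤ B := fun n hn => by
    have := hfB n hn; simp only [hf] at this
    linarith [norm_nonneg (eP n), norm_nonneg (eH n)]
  have hpB : ∀ n ≤ N, ‖eP n‖ ≤ B := fun n hn => by
    have := hfB n hn; simp only [hf] at this
    linarith [norm_nonneg (x n), norm_nonneg (eH n)]
  have hhB : ∀ n ≤ N, ‖eH n‖ ≤ B := fun n hn => by
    have := hfB n hn; simp only [hf] at this
    linarith [norm_nonneg (x n), norm_nonneg (eP n)]
  set W : ℕ → ℝ := fun n => c * ε * (‖x n‖ ^ 2 / 2) + c * μ * (‖eH n‖ ^ 2 / 2) + ‖eP n‖ ^ 2 / 2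
    with hW
  have hstep : ∀ n < N, W (n + 1) - W n + a * ⟪fracDq α θ τ eP (n + 1), eP (n + 1) - eP n⟫
      ≤ c * (B + K) * (τ * ‖R₁ n‖) + c * B * (τ * ‖R₂ n‖)
        + c * ε * ⟪x (n + 1) - x n, ι (ρ n)⟫ + c * ⟪eP (n + 1) - eP n, ι (ρ n)⟫
        + ⟪eP (n + 1) - eP n, R₃ n⟫ := by
    intro n hn
    have dqx : ι (dq τ eE (n + 1)) = τ⁻¹ • (x (n + 1) - x n) := by
      simp [dq, hx]
    have avx : ι (avg θ eE (n + 1)) = (1 - θ) • x (n + 1) + θ • x n := by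
      simp [avg, hx]
    have dqp : dq τ eP (n + 1) = τ⁻¹ • (eP (n + 1) - eP n) := by simp [dq]
    have avp : avg θ eP (n + 1) = (1 - θ) • eP (n + 1) + θ • eP n := by simp [avg]
    have dqh : dq τ eH (n + 1) = τ⁻¹ • (eH (n + 1) - eH n) := by simp [dq]
    have avh : avg θ eH (n + 1) = (1 - θ) • eH (n + 1) + θ • eH n := by simp [avg]
    -- The combination `τ c (E1 - E2 + E3) + E4` eliminates all curl terms, including `cu (ρ n)`,
    -- and the coupling between the `E` and `P` errors.
    have E1 := hA n hn (avg θ eE (n + 1))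
    have E2 := hA n hn (ρ n)
    have E3 := hF n hn (avg θ eH (n + 1))
    have E4 := hQ n hn (eP (n + 1) - eP n)
    rw [real_inner_comm (cu (avg θ eE (n + 1))) (avg θ eH (n + 1))] at E1
    rw [real_inner_comm (cu (ρ n)) (avg θ eH (n + 1))] at E2
    rw [avh] at E1 E2 E3
    rw [dqx, dqp] at E1 E2
    rw [dqh] at E3
    rw [avx] at E1 E4
    rw [avp] at E4
    set X := (1 - θ) • x (n + 1) + θ • x n with hX
    set Hh := (1 - θ) • eH (n + 1) + θ • eH n with hHh
    set Pp := (1 - θ) • eP (n + 1) + θ • eP n with hPp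
    simp only [real_inner_smul_left] at E1 E2 E3
    rw [real_inner_comm (eP (n + 1) - eP n) Pp, real_inner_comm (eP (n + 1) - eP n) X,
      real_inner_comm (eP (n + 1) - eP n) (R₃ n)] at E4
    have i1 := inner_sub_avg_ge hθ.2 (x (n + 1)) (x n)
    have i2 := inner_sub_avg_ge hθ.2 (eH (n + 1)) (eH n)
    have i3 := inner_sub_avg_ge hθ.2 (eP (n + 1)) (eP n)
    rw [← hX] at i1
    rw [← hHh] at i2
    rw [← hPp] at i3
    have hXB : ‖X‖ ≤ B := norm_avg_le hθ0 hθ1 (hxB _ (by omega)) (hxB _ (by omega))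
    have hHB : ‖Hh‖ ≤ B := norm_avg_le hθ0 hθ1 (hhB _ (by omega)) (hhB _ (by omega))
    have j1 : ⟪R₁ n, X⟫ ≤ ‖R₁ n‖ * B := (real_inner_le_norm _ _).trans (by gcongr)
    have j2 : -⟪R₁ n, ι (ρ n)⟫ ≤ ‖R₁ n‖ * K := by
      rw [← inner_neg_left]
      refine (real_inner_le_norm _ _).trans ?_
      rw [norm_neg]
      gcongr
      exact hρ n hn
    have j3 : ⟪R₂ n, Hh⟫ ≤ ‖R₂ n‖ * B := (real_inner_le_norm _ _).trans (by gcongr)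
    have hττ : τ * τ⁻¹ = 1 := mul_inv_cancel₀ hτ.ne'
    have key : c * ε * ⟪x (n + 1) - x n, X⟫ + c * μ * ⟪eH (n + 1) - eH n, Hh⟫
        + ⟪eP (n + 1) - eP n, Pp⟫ + a * ⟪fracDq α θ τ eP (n + 1), eP (n + 1) - eP n⟫
        = τ * c * ⟪R₁ n, X⟫ + τ * c * ⟪R₂ n, Hh⟫ + τ * c * (-⟪R₁ n, ι (ρ n)⟫)
          + c * ε * ⟪x (n + 1) - x n, ι (ρ n)⟫ + c * ⟪eP (n + 1) - eP n, ι (ρ n)⟫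
          + ⟪eP (n + 1) - eP n, R₃ n⟫ := by
      linear_combination τ * c * E1 + τ * c * E3 + E4 - τ * c * E2
        - (c * ε * ⟪x (n + 1) - x n, X⟫ + c * μ * ⟪eH (n + 1) - eH n, Hh⟫
          + c * ⟪eP (n + 1) - eP n, X⟫
          - c * ε * ⟪x (n + 1) - x n, ι (ρ n)⟫ - c * ⟪eP (n + 1) - eP n, ι (ρ n)⟫) * hττ
    have k1 : τ * c * ⟪R₁ n, X⟫ ≤ τ * c * (‖R₁ n‖ * B) := by gcongr
    have k2 : τ * c * ⟪R₂ n, Hh⟫ ≤ τ * c * (‖R₂ n‖ * B) := by gcongr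
    have k3 : τ * c * (-⟪R₁ n, ι (ρ n)⟫) ≤ τ * c * (‖R₁ n‖ * K) := by gcongr
    have l1 : c * ε * (‖x (n + 1)‖ ^ 2 / 2 - ‖x n‖ ^ 2 / 2)
        ≤ c * ε * ⟪x (n + 1) - x n, X⟫ := by gcongr
    have l2 : c * μ * (‖eH (n + 1)‖ ^ 2 / 2 - ‖eH n‖ ^ 2 / 2)
        ≤ c * μ * ⟪eH (n + 1) - eH n, Hh⟫ := by gcongr
    simp only [hW]
    linarith
  have hsum := Finset.sum_le_sum fun n (hn : n ∈ Finset.range m) =>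
    hstep n (by have := Finset.mem_range.1 hn; omega)
  simp only [Finset.sum_add_distrib, ← Finset.mul_sum] at hsum
  have hW0 : W 0 = 0 := by simp [hW, hx, hE0, hP0, hH0]
  rw [Finset.sum_range_sub, hW0, sub_zero] at hsum
  have hpos : 0 ≤ ∑ n ∈ Finset.range m, ⟪fracDq α θ τ eP (n + 1), eP (n + 1) - eP n⟫ := by
    have := sum_fracDq_inner_nonneg hα0 hα1 hθ.1 hτ.le eP m
    rw [Finset.sum_range_succ'] at this
    simpa using this
  have hmono : ∀ g : ℕ → ℝ, (∀ n, 0 ≤ g n) →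
      ∑ n ∈ Finset.range m, g n ≤ ∑ n ∈ Finset.range N, g n := fun g hg =>
    Finset.sum_le_sum_of_subset_of_nonneg (Finset.range_mono hmN') fun n _ _ => hg n
  have s1 := (hmono (fun n => τ * ‖R₁ n‖) fun n => by positivity).trans hR₁
  have s2 := (hmono (fun n => τ * ‖R₂ n‖) fun n => by positivity).trans hR₂
  rw [← Finset.mul_sum] at s1 s2
  have s3 := sum_inner_increment_le (u := x) (r := fun n => ι (ρ n)) hE0 hmN' hK hxB hρ hρv
  have s4 := sum_inner_increment_le (u := eP) (r := fun n => ι (ρ n)) hP0 hmN' hK hpB hρ hρv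
  have s5 := sum_inner_increment_le (u := eP) (r := R₃) hP0 hmN' hK hpB hR₃ hR₃v
  have hWm : W m ≤ (4 * c + 2 * (c * ε) + 2) * K * B + c * K ^ 2 := by
    have t1 : c * (B + K) * (τ * ∑ n ∈ Finset.range m, ‖R₁ n‖) ≤ c * (B + K) * K := by gcongr
    have t2 : c * B * (τ * ∑ n ∈ Finset.range m, ‖R₂ n‖) ≤ c * B * K := by gcongr
    have t3 := mul_le_mul_of_nonneg_left s3 (show 0 ≤ c * ε by positivity)
    have t4 := mul_le_mul_of_nonneg_left s4 hc.le
    have t6 := mul_nonneg ha hpos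
    linarith
  have hBsq : B ^ 2 ≤ 6 / c₀ * (4 * c + 2 * (c * ε) + 2) * K * B + 6 / c₀ * c * K ^ 2 := by
    have u1 : B ^ 2 ≤ 3 * (‖x m‖ ^ 2 + ‖eP m‖ ^ 2 + ‖eH m‖ ^ 2) := by
      exact add_three_sq_le _ _ _
    have u2 : c₀ * (‖x m‖ ^ 2 + ‖eP m‖ ^ 2 + ‖eH m‖ ^ 2) ≤ 2 * W m := by
      simp only [hW]
      have v1 := mul_le_mul_of_nonneg_right c1 (sq_nonneg ‖x m‖)
      have v2 := mul_le_mul_of_nonneg_right c2 (sq_nonneg ‖eH m‖)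
      have v3 := mul_le_mul_of_nonneg_right c3 (sq_nonneg ‖eP m‖)
      linarith
    have u3 : B ^ 2 ≤ 6 / c₀ * W m := by
      rw [div_mul_eq_mul_div, le_div_iff₀ hc₀pos]
      have u4 := mul_le_mul_of_nonneg_left u1 hc₀pos.le
      linarith
    calc B ^ 2 ≤ 6 / c₀ * W m := u3
      _ ≤ 6 / c₀ * ((4 * c + 2 * (c * ε) + 2) * K * B + c * K ^ 2) := by gcongr
      _ = _ := by ring
  exact (hfB n hn).trans (le_of_sq_le (by positivity) (by positivity) hB0 hK hBsq)

end

/-! ### Convergence -/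

section

variable {F : Type*} [NormedAddCommGroup F] [NormedSpace ℝ F]

/-- If the Caputo derivative of a `C³` curve extends to a `C¹` curve, then the derivative of the
curve vanishes at `0`. -/
theorem IsC3.deriv_zero_of_caputo_eq [CompleteSpace F] {u u₁ u₂ u₃ : ℝ → F}
    (hu : IsC3 u u₁ u₂ u₃) {α T k : ℝ} (h0 : 0 < α) (h1 : α < 1) (hT : 0 < T) (hk : 0 < k)
    {R : ℝ → F} (hR : ContDiff ℝ 1 R) (hRc : ∀ t ∈ Ioo 0 T, k • caputo α u t = R t) :
    u₁ 0 = 0 := by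
  have hα1 : 0 < 1 - α := by linarith
  have hα2 : 0 < 2 - α := by linarith
  have hΓ2 : 0 < Real.Gamma (2 - α) := Real.Gamma_pos_of_pos hα2
  have hΓ3 : 0 < Real.Gamma (3 - α) := Real.Gamma_pos_of_pos (by linarith)
  obtain ⟨M, hM⟩ := (isCompact_Icc (a := (0 : ℝ)) (b := T)).exists_bound_of_continuousOn
    hu.h4.continuousOn
  have hM0 : 0 ≤ M := (norm_nonneg _).trans (hM 0 ⟨le_rfl, hT.le⟩)
  obtain ⟨L, hL⟩ := (isCompact_Icc (a := (0 : ℝ)) (b := T)).exists_bound_of_continuousOn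
    (hR.continuous_deriv le_rfl).continuousOn
  set A := (‖u₂ 0‖ + M * T) / Real.Gamma (3 - α) with hA
  -- Near `0` the Caputo derivative is its leading term `t^(1-α) u₁ 0 / Γ(2-α)` up to `O(t^(2-α))`.
  -- In particular it tends to zero, so `R 0 = 0` and `R t = O(t)`.
  have hw : ∀ t ∈ Ioo 0 T,
      ‖caputo α u t - (t ^ (1 - α) / Real.Gamma (2 - α)) • u₁ 0‖ ≤ A * t ^ (2 - α) := by
    intro t ht
    have htp : 0 ≤ t ^ (2 - α) := Real.rpow_nonneg ht.1.le _
    rw [hu.caputo_eq h0 h1 ht.1.le ht.2.le, add_assoc, add_sub_cancel_left]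
    refine (norm_add_le _ _).trans ?_
    have e1 : ‖(t ^ (2 - α) / Real.Gamma (3 - α)) • u₂ 0‖
        = t ^ (2 - α) / Real.Gamma (3 - α) * ‖u₂ 0‖ := by
      rw [norm_smul, Real.norm_of_nonneg (by positivity)]
    have e2 : ‖∫ s in (0 : ℝ)..T, ((max (t - s) 0) ^ (2 - α) / Real.Gamma (3 - α)) • u₃ s‖
        ≤ t ^ (2 - α) / Real.Gamma (3 - α) * M * |T - 0| := by
      refine intervalIntegral.norm_integral_le_of_norm_le_const fun s hs => ?_
      rw [uIoc_of_le hT.le] at hs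
      have hm : (max (t - s) 0) ^ (2 - α) ≤ t ^ (2 - α) :=
        Real.rpow_le_rpow (le_max_right _ _) (max_le (by linarith [hs.1]) ht.1.le) hα2.le
      have hm0 : 0 ≤ (max (t - s) 0) ^ (2 - α) := Real.rpow_nonneg (le_max_right _ _) _
      rw [norm_smul, Real.norm_of_nonneg (by positivity)]
      gcongr
      exact hM s ⟨hs.1.le, hs.2⟩
    rw [sub_zero, abs_of_pos hT] at e2
    rw [e1]
    calc _ ≤ t ^ (2 - α) / Real.Gamma (3 - α) * ‖u₂ 0‖
          + t ^ (2 - α) / Real.Gamma (3 - α) * M * T := by gcongr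
      _ = _ := by rw [hA]; ring
  have hmem : ∀ᶠ t in nhdsWithin (0 : ℝ) (Ioi 0), t ∈ Ioo 0 T := Ioo_mem_nhdsGT hT
  have hpow : ∀ γ : ℝ, 0 < γ →
      Filter.Tendsto (fun t : ℝ => t ^ γ) (nhdsWithin 0 (Ioi 0)) (nhds 0) := by
    intro γ hγ
    have := (Real.continuousAt_rpow_const 0 γ (Or.inr hγ.le)).tendsto
    rw [Real.zero_rpow hγ.ne'] at this
    exact this.mono_left nhdsWithin_le_nhds
  have hR0 : R 0 = 0 := by
    have l1 : Filter.Tendsto R (nhdsWithin 0 (Ioi 0)) (nhds (R 0)) :=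
      hR.continuous.continuousAt.tendsto.mono_left nhdsWithin_le_nhds
    have l2 : Filter.Tendsto R (nhdsWithin 0 (Ioi 0)) (nhds 0) := by
      have b := ((((hpow _ hα2).const_mul A).add
        (((hpow _ hα1).div_const (Real.Gamma (2 - α))).mul_const ‖u₁ 0‖))).const_mul k
      simp only [mul_zero, zero_div, zero_mul, add_zero] at b
      refine squeeze_zero_norm' ?_ b
      filter_upwards [hmem] with t ht
      rw [← hRc t ht, norm_smul, Real.norm_of_nonneg hk.le]
      have htp : 0 ≤ t ^ (1 - α) := Real.rpow_nonneg ht.1.le _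
      gcongr
      have := norm_add_le (caputo α u t - (t ^ (1 - α) / Real.Gamma (2 - α)) • u₁ 0)
        ((t ^ (1 - α) / Real.Gamma (2 - α)) • u₁ 0)
      rw [sub_add_cancel, norm_smul, Real.norm_of_nonneg (by positivity)] at this
      exact this.trans (by gcongr; exact hw t ht)
    exact tendsto_nhds_unique l1 l2
  have hRL : ∀ t ∈ Ioo 0 T, ‖R t‖ ≤ L * t := by
    intro t ht
    have := norm_image_sub_le_uIcc (f := R) (f' := deriv R) (x := 0) (y := t) (K := L)
      (fun z _ => (hR.differentiable one_ne_zero z).hasDerivAt) (fun z hz => by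
        rw [uIcc_of_le ht.1.le] at hz
        exact hL z ⟨hz.1, hz.2.trans ht.2.le⟩)
    rwa [hR0, sub_zero, sub_zero, abs_of_pos ht.1] at this
  -- Division by `t^(1-α)`: the bound `R t = O(t)` becomes `O(t^α)` and the remainder `O(t)`, both
  -- of which tend to zero.
  have hfin : ∀ᶠ t in nhdsWithin (0 : ℝ) (Ioi 0),
      ‖u₁ 0‖ ≤ Real.Gamma (2 - α) * (k⁻¹ * L * t ^ α + A * t ^ (1 : ℝ)) := by
    filter_upwards [hmem] with t ht
    have htp : 0 < t ^ (1 - α) := Real.rpow_pos_of_pos ht.1 _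
    have e1 : t ^ (1 - α) / Real.Gamma (2 - α) * ‖u₁ 0‖ ≤ k⁻¹ * (L * t) + A * t ^ (2 - α) := by
      have hc : ‖caputo α u t‖ ≤ k⁻¹ * (L * t) := by
        rw [le_inv_mul_iff₀ hk]
        have := hRL t ht
        rwa [← hRc t ht, norm_smul, Real.norm_of_nonneg hk.le] at this
      have := norm_sub_le (caputo α u t)
        (caputo α u t - (t ^ (1 - α) / Real.Gamma (2 - α)) • u₁ 0)
      rw [sub_sub_cancel, norm_smul, Real.norm_of_nonneg (by positivity)] at this
      linarith [hw t ht]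
    have e2 : t = t ^ (1 - α) * t ^ α := by
      rw [← Real.rpow_add ht.1, sub_add_cancel, Real.rpow_one]
    have e3 : t ^ (2 - α) = t ^ (1 - α) * t ^ (1 : ℝ) := by
      rw [← Real.rpow_add ht.1]; congr 1; ring
    have e4 : t ^ (1 - α) * (‖u₁ 0‖ / Real.Gamma (2 - α))
        ≤ t ^ (1 - α) * (k⁻¹ * L * t ^ α + A * t ^ (1 : ℝ)) := by
      calc _ = t ^ (1 - α) / Real.Gamma (2 - α) * ‖u₁ 0‖ := by ring
        _ ≤ k⁻¹ * (L * t) + A * t ^ (2 - α) := e1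
        _ = k⁻¹ * (L * (t ^ (1 - α) * t ^ α)) + A * (t ^ (1 - α) * t ^ (1 : ℝ)) := by
          rw [← e2, e3]
        _ = _ := by ring
    have e5 := le_of_mul_le_mul_left e4 htp
    rw [div_le_iff₀ hΓ2] at e5
    linarith
  have hlim := (((hpow α h0).const_mul (k⁻¹ * L)).add ((hpow 1 one_pos).const_mul A)).const_mul
    (Real.Gamma (2 - α))
  simp only [mul_zero, add_zero] at hlim
  exact norm_le_zero_iff.1 (ge_of_tendsto hlim hfin)

end

/-! ### Error equations in abstract Hilbert spaces -/

section

variable {V S D : Type*} [NormedAddCommGroup V] [InnerProductSpace ℝ V] [CompleteSpace V]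
  [NormedAddCommGroup S] [InnerProductSpace ℝ S] [AddCommGroup D] [Module ℝ D]

theorem norm_le_sum_increments {F : Type*} [NormedAddCommGroup F] {δ : ℕ → F} (h0 : δ 0 = 0)
    {N n : ℕ} (hn : n ≤ N) : ‖δ n‖ ≤ ∑ k ∈ Finset.range N, ‖δ (k + 1) - δ k‖ := by
  have h : δ n = ∑ k ∈ Finset.range n, (δ (k + 1) - δ k) := by
    rw [Finset.sum_range_sub, h0, sub_zero]
  rw [h]
  exact (norm_sum_le _ _).trans
    (Finset.sum_le_sum_of_subset_of_nonneg (Finset.range_mono hn) fun _ _ _ => norm_nonneg _)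

theorem sq_le_order {τ T θ : ℝ} (hτ : 0 ≤ τ) (hτT : τ ≤ T) :
    τ ^ 2 ≤ (1 + T) * τ ^ order θ := by
  unfold order
  split_ifs
  · nlinarith [sq_nonneg τ]
  · rw [pow_one]; nlinarith

set_option maxHeartbeats 2000000 in
/-- Convergence of the scheme in abstract form: `ι` embeds the test fields into the Hilbert space
`V` and `cu` is the curl, with `k` the curl of `h` in the sense of Green's formula. -/
theorem scheme_convergence {ε μ c a α θ T : ℝ} (hε : 0 < ε) (hμ : 0 < μ) (hc : 0 < c) (ha : 0 ≤ a)
    (hα0 : 0 < α) (hα1 : α < 1) (hθ : θ ∈ Icc (α / 2) (1 / 2)) (hT : 0 < T)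
    (ι : D →ₗ[ℝ] V) (cu : D →ₗ[ℝ] S)
    {e e₁ e₂ e₃ p p₁ p₂ p₃ k k₁ k₂ k₃ : ℝ → V} {h h₁ h₂ h₃ : ℝ → S} {E : ℝ → D}
    {f₁ f₃ : ℝ → V} {f₂ : ℝ → S}
    (he : IsC3 e e₁ e₂ e₃) (hp : IsC3 p p₁ p₂ p₃) (hk : IsC3 k k₁ k₂ k₃) (hh : IsC3 h h₁ h₂ h₃)
    (hEe : ∀ t ∈ Icc 0 T, ι (E t) = e t)
    (hgreen : ∀ t ∈ Icc 0 T, ∀ χ : D, ⟪h t, cu χ⟫ = ⟪k t, ι χ⟫)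
    (hampere : ∀ t ∈ Ioo 0 T, ε • e₁ t = k t - p₁ t + f₁ t)
    (hfaraday : ∀ t ∈ Ioo 0 T, μ • h₁ t = -cu (E t) + f₂ t)
    (hpol : ∀ t ∈ Ioo 0 T, a • caputo α p t + p t = c • e t + f₃ t)
    (hp0 : p 0 = 0) (hp₁0 : θ = 1 / 2 → p₁ 0 = 0) :
    ∃ C > 0, ∀ (N : ℕ) (τ : ℝ), 1 ≤ N → τ = T / N →
      ∀ (Eτ : ℕ → D) (Pτ : ℕ → V) (Hτ : ℕ → S), Eτ 0 = E 0 → Pτ 0 = 0 → Hτ 0 = h 0 →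
      (∀ n, 1 ≤ n → n ≤ N → ∀ χ : D, ε * ⟪ι (dq τ Eτ n), ι χ⟫ + ⟪dq τ Pτ n, ι χ⟫
        - ⟪avg θ Hτ n, cu χ⟫ = ⟪f₁ ((n - θ) * τ), ι χ⟫) →
      (∀ n, 1 ≤ n → n ≤ N → ∀ φ : S, μ * ⟪dq τ Hτ n, φ⟫ + ⟪cu (avg θ Eτ n), φ⟫
        = ⟪f₂ ((n - θ) * τ), φ⟫) →
      (∀ n, 1 ≤ n → n ≤ N → ∀ ψ : V, a * ⟪fracDq α θ τ Pτ n, ψ⟫ + ⟪avg θ Pτ n, ψ⟫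
        - c * ⟪ι (avg θ Eτ n), ψ⟫ = ⟪f₃ ((n - θ) * τ), ψ⟫) →
      ∀ n ≤ N, ‖e (n * τ) - ι (Eτ n)‖ + ‖p (n * τ) - Pτ n‖ + ‖h (n * τ) - Hτ n‖
        ≤ C * τ ^ order θ := by
  have hθ0 : 0 < θ := by linarith [hθ.1]
  have hθI : θ ∈ Icc (0 : ℝ) 1 := ⟨hθ0.le, by linarith [hθ.2]⟩
  have hθ1 : 0 ≤ 1 - θ := by linarith [hθ.2]
  obtain ⟨Me, hMe0, hMe⟩ := he.exists_bounds (T := T) hθI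
  obtain ⟨Mp, hMp0, hMp⟩ := hp.exists_bounds (T := T) hθI
  obtain ⟨Mk, hMk0, hMk⟩ := hk.exists_bounds (T := T) hθI
  obtain ⟨Mh, hMh0, hMh⟩ := hh.exists_bounds (T := T) hθI
  obtain ⟨Cδ, hCδ0, hδ⟩ := hp.exists_discrete_comparison hp0 hα0 hα1 hθ hT
  set L := 1 + T with hL
  have hL0 : 0 < L := by rw [hL]; positivity
  set Dδ := Cδ * (‖p₁ 0‖ + L) with hDδ
  have hDδ0 : 0 ≤ Dδ := by positivity
  -- The summands bound, in order, the time sums of `R₁` and of `R₂`, the size and variation of `ρ`,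
  -- the size of `R₃`, and the variation of `R₃`.
  set Kc := (T * (ε * Me + Mp + L * Mk) + Dδ) + T * (μ * Mh) + (L * Me + T * L * Me)
    + (Dδ + L * Mp + c * (L * Me)) + (Dδ + T * L * (Mp + c * Me)) with hKc
  have hKc0 : 0 ≤ Kc := by positivity
  set Cs := 6 / min (min (c * ε) (c * μ)) 1 * (4 * c + 2 * (c * ε) + 2)
        + 6 / min (min (c * ε) (c * μ)) 1 * c + 1 with hCs
  have hCs0 : 0 < Cs := by
    have : 0 < min (min (c * ε) (c * μ)) 1 := lt_min (lt_min (by positivity) (by positivity)) one_pos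
    positivity
  refine ⟨Cs * Kc + Dδ + 1, by positivity, ?_⟩
  intro N τ hN hτN Eτ Pτ Hτ hE0 hP0 hH0 hA hF hQ
  have hN0 : (0 : ℝ) < N := by exact_mod_cast hN
  have hτ : 0 < τ := by rw [hτN]; positivity
  have hNτ : N * τ = T := by rw [hτN]; field_simp
  have hτT : τ ≤ T := by
    rw [← hNτ]
    have : (1 : ℝ) ≤ N := by exact_mod_cast hN
    nlinarith
  set ts := τ ^ order θ with hts
  have hts0 : 0 < ts := by positivity
  have hτ2 : τ ^ 2 ≤ L * ts := sq_le_order hτ.le hτT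
  obtain ⟨pt, hpt0, hptc, hptv⟩ := hδ N τ hτ hNτ.le
  set δ : ℕ → V := fun n => pt n - p (n * τ) with hδdef
  have hδv : ∑ n ∈ Finset.range N, ‖δ (n + 1) - δ n‖ ≤ Dδ * ts := by
    refine hptv.trans ?_
    rw [hDδ, mul_assoc]
    gcongr
    rw [add_mul]
    refine add_le_add ?_ hτ2
    -- For `θ = 1/2` the term `τ ‖p₁ 0‖` is zero; for other `θ` it already has the required first
    -- order.
    by_cases hh : θ = 1 / 2
    · rw [hp₁0 hh]; simp
    · have : ts = τ := by rw [hts, order, if_neg hh, pow_one]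
      rw [this, mul_comm]
  have hδ0 : δ 0 = 0 := by simp [hδdef, hpt0, hp0]
  have hδn : ∀ n ≤ N, ‖δ n‖ ≤ Dδ * ts := fun n hn => (norm_le_sum_increments hδ0 hn).trans hδv
  have hs0 : ∀ n : ℕ, 0 ≤ (n : ℝ) * τ := fun n => by positivity
  have hsτ : ∀ n : ℕ, ((n + 1 : ℕ) : ℝ) * τ = n * τ + τ := fun n => by push_cast; ring
  have hsθ : ∀ n : ℕ, (((n + 1 : ℕ) : ℝ) - θ) * τ = n * τ + (1 - θ) * τ := fun n => by
    push_cast; ring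
  have hsT : ∀ n < N, (n : ℝ) * τ + τ ≤ T := fun n hn => by
    rw [← hsτ, ← hNτ]
    have : ((n + 1 : ℕ) : ℝ) ≤ N := by exact_mod_cast hn
    gcongr
  have hmemI : ∀ n ≤ N, (n : ℝ) * τ ∈ Icc 0 T := fun n hn => ⟨hs0 n, by
    rw [← hNτ]
    have : (n : ℝ) ≤ N := by exact_mod_cast hn
    gcongr⟩
  -- The equations hold only on the open interval, and `0 < θ < 1` keeps every sampling point
  -- strictly inside.
  have hmemO : ∀ n < N, (n : ℝ) * τ + (1 - θ) * τ ∈ Ioo 0 T := fun n hn => by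
    have h1 : 0 < (1 - θ) * τ := mul_pos (by linarith [hθ.2]) hτ
    have h2 : (1 - θ) * τ < τ := by nlinarith
    exact ⟨by linarith [hs0 n], by linarith [hsT n hn]⟩
  set eE : ℕ → D := fun n => E (n * τ) - Eτ n with heE
  -- The comparison curve `pt` replaces the exact `p`, so the fractional term has no truncation
  -- error; the price is `δ` in the other residuals.
  set eP : ℕ → V := fun n => pt n - Pτ n with heP
  set eH : ℕ → S := fun n => h (n * τ) - Hτ n with heH
  set ρ : ℕ → D := fun n => (1 - θ) • E (n * τ + τ) + θ • E (n * τ) - E (n * τ + (1 - θ) * τ)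
    with hρdef
  have hιρ : ∀ n < N, ι (ρ n) = avgErr θ τ e (n * τ) := fun n hn => by
    have m1 : (n : ℝ) * τ + τ ∈ Icc 0 T := by rw [← hsτ]; exact hmemI _ hn
    simp only [hρdef, map_sub, map_add, map_smul, avgErr]
    rw [hEe _ m1, hEe _ (hmemI n hn.le), hEe _ (Ioo_subset_Icc_self (hmemO n hn))]
  -- The term `τ⁻¹ • (δ (n + 1) - δ n)` has no small pointwise bound; after multiplication by `τ`
  -- and summation it is the total variation of `δ`.
  set R₁ : ℕ → V := fun n => ε • (τ⁻¹ • (e (n * τ + τ) - e (n * τ)) - e₁ (n * τ + (1 - θ) * τ))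
    + (τ⁻¹ • (p (n * τ + τ) - p (n * τ)) - p₁ (n * τ + (1 - θ) * τ))
    + τ⁻¹ • (δ (n + 1) - δ n) - avgErr θ τ k (n * τ) with hR₁def
  set R₂ : ℕ → S := fun n => μ • (τ⁻¹ • (h (n * τ + τ) - h (n * τ)) - h₁ (n * τ + (1 - θ) * τ))
    with hR₂def
  set R₃ : ℕ → V := fun n => (1 - θ) • δ (n + 1) + θ • δ n + avgErr θ τ p (n * τ)
    - c • avgErr θ τ e (n * τ) with hR₃def
  have hEqA : ∀ n < N, ∀ χ : D, ε * ⟪ι (dq τ eE (n + 1)), ι χ⟫ + ⟪dq τ eP (n + 1), ι χ⟫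
      - ⟪avg θ eH (n + 1), cu χ⟫ = ⟪R₁ n, ι χ⟫ := by
    intro n hn χ
    have m1 : (n : ℝ) * τ + τ ∈ Icc 0 T := by rw [← hsτ]; exact hmemI _ hn
    have S1 := hA (n + 1) (by omega) hn χ
    have PDE := hampere _ (hmemO n hn)
    have g1 := hgreen _ m1 χ
    have g0 := hgreen _ (hmemI n hn.le) χ
    rw [hsθ] at S1
    have v1 : ι (dq τ eE (n + 1)) = τ⁻¹ • (e (n * τ + τ) - e (n * τ)) - ι (dq τ Eτ (n + 1)) := by
      simp only [dq, heE, Nat.add_sub_cancel, hsτ, map_smul, map_sub]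
      rw [hEe _ m1, hEe _ (hmemI n hn.le)]
      module
    have v2 : dq τ eP (n + 1) = τ⁻¹ • (p (n * τ + τ) - p (n * τ)) + τ⁻¹ • (δ (n + 1) - δ n)
        - dq τ Pτ (n + 1) := by
      simp only [dq, heP, hδdef, Nat.add_sub_cancel, hsτ]
      module
    have v3 : avg θ eH (n + 1) = (1 - θ) • h (n * τ + τ) + θ • h (n * τ) - avg θ Hτ (n + 1) := by
      simp only [avg, heH, Nat.add_sub_cancel, hsτ]
      module
    have hf : f₁ (n * τ + (1 - θ) * τ) = ε • e₁ (n * τ + (1 - θ) * τ)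
        - k (n * τ + (1 - θ) * τ) + p₁ (n * τ + (1 - θ) * τ) := by rw [PDE]; abel
    rw [hf] at S1
    rw [v1, v2, v3]
    simp only [hR₁def, avgErr]
    simp only [inner_sub_left, inner_add_left, real_inner_smul_left] at S1 ⊢
    rw [g1, g0]
    linear_combination -S1
  have hEqF : ∀ n < N, ∀ φ : S, μ * ⟪dq τ eH (n + 1), φ⟫ + ⟪cu (avg θ eE (n + 1)), φ⟫
      = ⟪R₂ n, φ⟫ + ⟪cu (ρ n), φ⟫ := by
    intro n hn φ
    have S1 := hF (n + 1) (by omega) hn φ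
    have PDE := hfaraday _ (hmemO n hn)
    rw [hsθ] at S1
    have v1 : dq τ eH (n + 1) = τ⁻¹ • (h (n * τ + τ) - h (n * τ)) - dq τ Hτ (n + 1) := by
      simp only [dq, heH, Nat.add_sub_cancel, hsτ]
      module
    have v2 : cu (avg θ eE (n + 1)) = cu (ρ n) + cu (E (n * τ + (1 - θ) * τ))
        - cu (avg θ Eτ (n + 1)) := by
      rw [← map_add, ← map_sub]
      congr 1
      simp only [avg, heE, hρdef, Nat.add_sub_cancel, hsτ]
      module
    have hf : f₂ (n * τ + (1 - θ) * τ) = μ • h₁ (n * τ + (1 - θ) * τ)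
        + cu (E (n * τ + (1 - θ) * τ)) := by rw [PDE]; abel
    rw [hf] at S1
    rw [v1, v2]
    simp only [hR₂def]
    simp only [inner_sub_left, inner_add_left, real_inner_smul_left] at S1 ⊢
    linear_combination -S1
  have hEqQ : ∀ n < N, ∀ ψ : V, a * ⟪fracDq α θ τ eP (n + 1), ψ⟫ + ⟪avg θ eP (n + 1), ψ⟫
      - c * ⟪ι (avg θ eE (n + 1)), ψ⟫ = ⟪R₃ n, ψ⟫ := by
    intro n hn ψ
    have m1 : (n : ℝ) * τ + τ ∈ Icc 0 T := by rw [← hsτ]; exact hmemI _ hn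
    have S1 := hQ (n + 1) (by omega) hn ψ
    have PDE := hpol _ (hmemO n hn)
    rw [hsθ] at S1
    have v1 : fracDq α θ τ eP (n + 1) = caputo α p (n * τ + (1 - θ) * τ)
        - fracDq α θ τ Pτ (n + 1) := by
      rw [← hsθ, ← hptc (n + 1) (by omega) hn]
      simp only [fracDq, heP]
      rw [← smul_sub, ← Finset.sum_sub_distrib]
      congr 1
      refine Finset.sum_congr rfl fun j _ => ?_
      module
    have v2 : avg θ eP (n + 1) = (1 - θ) • δ (n + 1) + θ • δ n + (1 - θ) • p (n * τ + τ)
        + θ • p (n * τ) - avg θ Pτ (n + 1) := by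
      simp only [avg, heP, hδdef, Nat.add_sub_cancel, hsτ]
      module
    have v3 : ι (avg θ eE (n + 1)) = (1 - θ) • e (n * τ + τ) + θ • e (n * τ)
        - ι (avg θ Eτ (n + 1)) := by
      simp only [avg, heE, Nat.add_sub_cancel, hsτ, map_smul, map_sub, map_add]
      rw [hEe _ m1, hEe _ (hmemI n hn.le)]
      module
    have hf : f₃ (n * τ + (1 - θ) * τ) = a • caputo α p (n * τ + (1 - θ) * τ)
        + p (n * τ + (1 - θ) * τ) - c • e (n * τ + (1 - θ) * τ) := by rw [PDE]; abel
    rw [hf] at S1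
    rw [v1, v2, v3]
    simp only [hR₃def, avgErr]
    simp only [inner_sub_left, inner_add_left, real_inner_smul_left] at S1 ⊢
    linear_combination -S1
  have hNts : ∀ x : ℝ, ∑ _n ∈ Finset.range N, τ * x = T * x := fun x => by
    rw [Finset.sum_const, Finset.card_range, nsmul_eq_mul, ← mul_assoc, hNτ]
  have bR₁ : ∑ n ∈ Finset.range N, τ * ‖R₁ n‖ ≤ Kc * ts := by
    have hb : ∀ n ∈ Finset.range N,
        τ * ‖R₁ n‖ ≤ τ * ((ε * Me + Mp + L * Mk) * ts) + ‖δ (n + 1) - δ n‖ := by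
      intro n hn
      have hn' : n < N := by simpa using hn
      obtain ⟨-, -, x1⟩ := hMe τ _ hτ (hs0 n) (hsT n hn')
      obtain ⟨-, -, x2⟩ := hMp τ _ hτ (hs0 n) (hsT n hn')
      obtain ⟨x3, -, -⟩ := hMk τ _ hτ (hs0 n) (hsT n hn')
      have x3' : ‖avgErr θ τ k (n * τ)‖ ≤ L * Mk * ts :=
        x3.trans (by
          calc Mk * τ ^ 2 ≤ Mk * (L * ts) := by gcongr
            _ = L * Mk * ts := by ring)
      have hb1 : ‖R₁ n‖ ≤ ε * (Me * ts) + Mp * ts + τ⁻¹ * ‖δ (n + 1) - δ n‖ + L * Mk * ts := by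
        simp only [hR₁def]
        refine (norm_sub_le _ _).trans (add_le_add ?_ x3')
        refine (norm_add₃_le).trans (add_le_add (add_le_add ?_ x2) ?_)
        · rw [norm_smul, Real.norm_of_nonneg hε.le]; gcongr
        · rw [norm_smul, Real.norm_of_nonneg (by positivity)]
      calc τ * ‖R₁ n‖ ≤ τ * (ε * (Me * ts) + Mp * ts + τ⁻¹ * ‖δ (n + 1) - δ n‖ + L * Mk * ts) := by
            gcongr
        _ = _ := by field_simp; ring
    refine (Finset.sum_le_sum hb).trans ?_
    rw [Finset.sum_add_distrib, hNts]
    have : (T * (ε * Me + Mp + L * Mk) + Dδ) * ts ≤ Kc * ts := by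
      gcongr
      have := mul_nonneg hT.le (mul_nonneg hμ.le hMh0)
      have : 0 ≤ L * Me + T * L * Me := by positivity
      have : 0 ≤ Dδ + L * Mp + c * (L * Me) := by positivity
      have : 0 ≤ Dδ + T * L * (Mp + c * Me) := by positivity
      rw [hKc]; linarith
    linarith
  have bR₂ : ∑ n ∈ Finset.range N, τ * ‖R₂ n‖ ≤ Kc * ts := by
    have hb : ∀ n ∈ Finset.range N, τ * ‖R₂ n‖ ≤ τ * (μ * Mh * ts) := by
      intro n hn
      have hn' : n < N := by simpa using hn
      obtain ⟨-, -, x1⟩ := hMh τ _ hτ (hs0 n) (hsT n hn')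
      simp only [hR₂def]
      rw [norm_smul, Real.norm_of_nonneg hμ.le, mul_assoc μ]
      gcongr
    refine (Finset.sum_le_sum hb).trans ?_
    rw [hNts, ← mul_assoc]
    gcongr
    have : 0 ≤ T * (ε * Me + Mp + L * Mk) + Dδ := by positivity
    have : 0 ≤ L * Me + T * L * Me := by positivity
    have : 0 ≤ Dδ + L * Mp + c * (L * Me) := by positivity
    have : 0 ≤ Dδ + T * L * (Mp + c * Me) := by positivity
    rw [hKc]; linarith
  have hKc1 : L * Me + T * L * Me ≤ Kc := by
    have : 0 ≤ T * (ε * Me + Mp + L * Mk) + Dδ := by positivity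
    have : 0 ≤ T * (μ * Mh) := by positivity
    have : 0 ≤ Dδ + L * Mp + c * (L * Me) := by positivity
    have : 0 ≤ Dδ + T * L * (Mp + c * Me) := by positivity
    rw [hKc]; linarith
  have hKc2 : (Dδ + L * Mp + c * (L * Me)) + (Dδ + T * L * (Mp + c * Me)) ≤ Kc := by
    have : 0 ≤ T * (ε * Me + Mp + L * Mk) + Dδ := by positivity
    have : 0 ≤ T * (μ * Mh) := by positivity
    have : 0 ≤ L * Me + T * L * Me := by positivity
    rw [hKc]; linarith
  have hae : ∀ {F : Type _} [NormedAddCommGroup F] {x : F} {M : ℝ}, 0 ≤ M → ‖x‖ ≤ M * τ ^ 2 →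
      ‖x‖ ≤ L * M * ts := by
    intro F _ x M hM hx
    refine hx.trans ?_
    calc M * τ ^ 2 ≤ M * (L * ts) := by gcongr
      _ = _ := by ring
  have hsum3 : ∀ {M : ℝ}, 0 ≤ M → ∑ _n ∈ Finset.range (N - 1), M * τ ^ 3 ≤ T * L * M * ts := by
    intro M hM
    calc ∑ _n ∈ Finset.range (N - 1), M * τ ^ 3 ≤ ∑ _n ∈ Finset.range N, M * τ ^ 3 :=
          Finset.sum_le_sum_of_subset_of_nonneg (Finset.range_mono (by omega))
            fun _ _ _ => by positivity
      _ = ∑ _n ∈ Finset.range N, τ * (M * τ ^ 2) :=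
          Finset.sum_congr rfl fun _ _ => by ring
      _ = T * (M * τ ^ 2) := hNts _
      _ ≤ T * (M * (L * ts)) := by gcongr
      _ = _ := by ring
  have bρ : ∀ n < N, ‖ι (ρ n)‖ ≤ Kc * ts := by
    intro n hn
    rw [hιρ n hn]
    refine (hae hMe0 (hMe τ _ hτ (hs0 n) (hsT n hn)).1).trans ?_
    gcongr
    have : 0 ≤ T * L * Me := by positivity
    linarith
  have havgv : ∀ n ∈ Finset.range (N - 1), (n : ℝ) * τ + τ + τ ≤ T := fun n hn => by
    have hn' : n + 1 < N := by have := Finset.mem_range.1 hn; omega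
    have := hsT (n + 1) hn'
    rwa [hsτ] at this
  have bρv : ∑ n ∈ Finset.range (N - 1), ‖ι (ρ (n + 1)) - ι (ρ n)‖ ≤ Kc * ts := by
    have hb : ∀ n ∈ Finset.range (N - 1), ‖ι (ρ (n + 1)) - ι (ρ n)‖ ≤ Me * τ ^ 3 := by
      intro n hn
      have hn' : n + 1 < N := by have := Finset.mem_range.1 hn; omega
      rw [hιρ _ hn', hιρ n (by omega), hsτ]
      exact (hMe τ _ hτ (hs0 n) (hsT n (by omega))).2.1 (havgv n hn)
    refine (Finset.sum_le_sum hb).trans ((hsum3 hMe0).trans ?_)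
    gcongr
    have : 0 ≤ L * Me := by positivity
    linarith
  have bR₃ : ∀ n < N, ‖R₃ n‖ ≤ Kc * ts := by
    intro n hn
    have y1 := hae hMp0 (hMp τ _ hτ (hs0 n) (hsT n hn)).1
    have y2 := hae hMe0 (hMe τ _ hτ (hs0 n) (hsT n hn)).1
    have y3 := norm_avg_le hθ0.le hθI.2 (hδn (n + 1) hn) (hδn n hn.le)
    simp only [hR₃def]
    have y4 : ‖c • avgErr θ τ e (n * τ)‖ ≤ c * (L * Me * ts) := by
      rw [norm_smul, Real.norm_of_nonneg hc.le]; gcongr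
    refine (norm_sub_le _ _).trans ((add_le_add ((norm_add_le _ _).trans (add_le_add y3 y1))
      y4).trans ?_)
    calc _ = (Dδ + L * Mp + c * (L * Me)) * ts := by ring
      _ ≤ Kc * ts := by
        gcongr
        have : 0 ≤ Dδ + T * L * (Mp + c * Me) := by positivity
        linarith
  have bR₃v : ∑ n ∈ Finset.range (N - 1), ‖R₃ (n + 1) - R₃ n‖ ≤ Kc * ts := by
    have hb : ∀ n ∈ Finset.range (N - 1), ‖R₃ (n + 1) - R₃ n‖
        ≤ (1 - θ) * ‖δ (n + 1 + 1) - δ (n + 1)‖ + θ * ‖δ (n + 1) - δ n‖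
          + (Mp + c * Me) * τ ^ 3 := by
      intro n hn
      have hn' : n + 1 < N := by have := Finset.mem_range.1 hn; omega
      have z1 := (hMp τ _ hτ (hs0 n) (hsT n (by omega))).2.1 (havgv n hn)
      have z2 := (hMe τ _ hτ (hs0 n) (hsT n (by omega))).2.1 (havgv n hn)
      have e0 : R₃ (n + 1) - R₃ n = ((1 - θ) • (δ (n + 1 + 1) - δ (n + 1)) + θ • (δ (n + 1) - δ n))
          + (avgErr θ τ p (n * τ + τ) - avgErr θ τ p (n * τ))
          - c • (avgErr θ τ e (n * τ + τ) - avgErr θ τ e (n * τ)) := by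
        simp only [hR₃def, hsτ]
        module
      rw [e0]
      have z3 : ‖c • (avgErr θ τ e (n * τ + τ) - avgErr θ τ e (n * τ))‖ ≤ c * (Me * τ ^ 3) := by
        rw [norm_smul, Real.norm_of_nonneg hc.le]; gcongr
      have z4 : ‖(1 - θ) • (δ (n + 1 + 1) - δ (n + 1)) + θ • (δ (n + 1) - δ n)‖
          ≤ (1 - θ) * ‖δ (n + 1 + 1) - δ (n + 1)‖ + θ * ‖δ (n + 1) - δ n‖ := by
        refine (norm_add_le _ _).trans ?_
        rw [norm_smul, norm_smul, Real.norm_of_nonneg hθ0.le, Real.norm_of_nonneg hθ1]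
      refine (norm_sub_le _ _).trans ((add_le_add ((norm_add_le _ _).trans (add_le_add z4 z1))
        z3).trans (le_of_eq ?_))
      ring
    refine (Finset.sum_le_sum hb).trans ?_
    rw [Finset.sum_add_distrib, Finset.sum_add_distrib, ← Finset.mul_sum, ← Finset.mul_sum]
    have w1 : ∑ n ∈ Finset.range (N - 1), ‖δ (n + 1 + 1) - δ (n + 1)‖ ≤ Dδ * ts := by
      refine le_trans ?_ hδv
      obtain ⟨M, rfl⟩ : ∃ M, N = M + 1 := ⟨N - 1, by omega⟩
      rw [Nat.add_sub_cancel, Finset.sum_range_succ' _ M]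
      linarith [norm_nonneg (δ (0 + 1) - δ 0)]
    have w2 : ∑ n ∈ Finset.range (N - 1), ‖δ (n + 1) - δ n‖ ≤ Dδ * ts :=
      (Finset.sum_le_sum_of_subset_of_nonneg (Finset.range_mono (by omega))
        fun _ _ _ => norm_nonneg _).trans hδv
    have w3 := hsum3 (M := Mp + c * Me) (by positivity)
    calc _ ≤ (1 - θ) * (Dδ * ts) + θ * (Dδ * ts) + T * L * (Mp + c * Me) * ts := by gcongr
      _ = (Dδ + T * L * (Mp + c * Me)) * ts := by ring
      _ ≤ Kc * ts := by
        gcongr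
        have : 0 ≤ Dδ + L * Mp + c * (L * Me) := by positivity
        linarith
  intro n hn
  have hst := scheme_stability hε hμ hc ha hα0 hα1 hθ hτ ι cu (K := Kc * ts) (by positivity)
    (eE := eE) (ρ := ρ) (eP := eP) (eH := eH) (by simp [heE, hE0]) (by simp [heP, hP0, hpt0])
    (by simp [heH, hH0]) hEqA hEqF hEqQ bR₁ bR₂ bρ bρv bR₃ bR₃v hn
  rw [← hCs] at hst
  have q1 : ι (eE n) = e (n * τ) - ι (Eτ n) := by
    simp only [heE, map_sub]; rw [hEe _ (hmemI n hn)]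
  have q2 : ‖p (n * τ) - Pτ n‖ ≤ ‖eP n‖ + ‖δ n‖ := by
    have : p (n * τ) - Pτ n = eP n - δ n := by simp only [heP, hδdef]; abel
    rw [this]
    exact norm_sub_le _ _
  rw [q1] at hst
  have q3 := hδn n hn
  calc _ ≤ Cs * (Kc * ts) + Dδ * ts := by
        simp only [heH] at hst
        linarith
    _ ≤ _ := by nlinarith

end

/-! ### The concrete function spaces -/

/-- `fieldV` as a linear map. -/
def fieldVₗ (Ω : Set Plane) : H0curl Ω →ₗ[ℝ] L2V Ω where
  toFun := fieldV
  map_add' _ _ := rfl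
  map_smul' _ _ := rfl

/-- `curlE` as a linear map. -/
def curlEₗ (Ω : Set Plane) : H0curl Ω →ₗ[ℝ] L2S Ω where
  toFun := curlE
  map_add' _ _ := rfl
  map_smul' _ _ := rfl

theorem contDiffOn_funcS {Ω : Set Plane} {H : ℝ → HcurlS Ω} {n : WithTop ℕ∞} {s : Set ℝ}
    (hH : ContDiffOn ℝ n H s) : ContDiffOn ℝ n (fun t => funcS (H t)) s :=
  ((WithLp.fstL 2 ℝ (L2S Ω) (L2V Ω)).comp (HcurlS Ω).subtypeL).contDiff.comp_contDiffOn hH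

theorem contDiffOn_curlH {Ω : Set Plane} {H : ℝ → HcurlS Ω} {n : WithTop ℕ∞} {s : Set ℝ}
    (hH : ContDiffOn ℝ n H s) : ContDiffOn ℝ n (fun t => curlH (H t)) s :=
  ((WithLp.sndL 2 ℝ (L2S Ω) (L2V Ω)).comp (HcurlS Ω).subtypeL).contDiff.comp_contDiffOn hH

/-- The integral sees derivatives only on `(0, t]`, all interior points, near which the two curves
coincide. -/
theorem IsC3.caputo_congr {F : Type*} [NormedAddCommGroup F] [NormedSpace ℝ F]
    {u U U₁ U₂ U₃ : ℝ → F} {T α : ℝ} (hU : IsC3 U U₁ U₂ U₃)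
    (h : EqOn U u (Icc 0 T)) {t : ℝ} (ht : t ∈ Ioo 0 T) : caputo α u t = caputo α U t := by
  unfold caputo rlIntegral
  congr 1
  refine intervalIntegral.integral_congr_ae (Filter.Eventually.of_forall fun s hs => ?_)
  rw [uIoc_of_le ht.1.le] at hs
  have hs' : s ∈ Ioo 0 T := ⟨hs.1, hs.2.trans_lt ht.2⟩
  rw [hU.deriv_eq h hs', (hU.h1 s).deriv]

/-- A `C³` solution of the polarization equation with `C¹` data has vanishing derivative at `0`. -/
theorem IsC3.deriv_zero_of_polarization {F : Type*} [NormedAddCommGroup F] [NormedSpace ℝ F]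
    [CompleteSpace F] {p p₁ p₂ p₃ e f : ℝ → F} (hp : IsC3 p p₁ p₂ p₃) {α T κ c : ℝ}
    (h0 : 0 < α) (h1 : α < 1) (hT : 0 < T) (hκ : 0 < κ) (he : ContDiffOn ℝ 1 e (Icc 0 T))
    (hf : ContDiffOn ℝ 1 f (Icc 0 T))
    (hpol : ∀ t ∈ Ioo 0 T, κ • caputo α p t + p t = c • e t + f t) : p₁ 0 = 0 := by
  have hpc : ContDiff ℝ 1 p := contDiff_one_iff_deriv.2
    ⟨fun t => (hp.h1 t).differentiableAt, by
      rw [funext fun t => (hp.h1 t).deriv]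
      exact continuous_iff_continuousAt.2 fun t => (hp.h2 t).continuousAt⟩
  have hr : ContDiffOn ℝ (1 : ℕ) (fun t => c • e t + f t - p t) (Icc 0 T) := by
    rw [Nat.cast_one]
    exact ((contDiffOn_const.smul he).add hf).sub hpc.contDiffOn
  obtain ⟨R, hR, hRr⟩ := exists_contDiff_extension hT 1 _ hr
  refine hp.deriv_zero_of_caputo_eq h0 h1 hT hκ (by exact_mod_cast hR) fun t ht => ?_
  rw [hRr (Ioo_subset_Icc_self ht), eq_sub_iff_add_eq]
  exact hpol t ht

end ColeCole

end


/-! ### The error bound for the Cole–Cole system -/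

open ColeCole

theorem theorem2 (M : ColeCole.Medium) (θ : ℝ) (hθ : θ ∈ Set.Icc (M.α / 2) (1 / 2))
    (a b c d : ℝ) (hab : a < b) (hcd : c < d) (T : ℝ) (hT : 0 < T)
    (f₁ : ℝ → ColeCole.L2V (ColeCole.rect a b c d))
    (f₂ : ℝ → ColeCole.L2S (ColeCole.rect a b c d))
    (f₃ : ℝ → ColeCole.L2V (ColeCole.rect a b c d))
    (E : ℝ → ColeCole.H0curl (ColeCole.rect a b c d))
    (P : ℝ → ColeCole.L2V (ColeCole.rect a b c d))
    (H : ℝ → ColeCole.HcurlS (ColeCole.rect a b c d))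
    (hE : ContinuousOn E (Set.Icc 0 T))
    (hE3 : ContDiffOn ℝ 3 (fun t => ColeCole.fieldV (E t)) (Set.Icc 0 T))
    (hP3 : ContDiffOn ℝ 3 P (Set.Icc 0 T))
    (hH3 : ContDiffOn ℝ 3 H (Set.Icc 0 T))
    (hf₃ : θ = 1 / 2 → ContDiffOn ℝ 1 f₃ (Set.Icc 0 T))
    (hsol : ColeCole.IsSolution M T f₁ f₂ f₃ E P H) :
    ∃ C > 0, ∃ τmax > 0, ∀ (N : ℕ) (τ : ℝ), 1 ≤ N → τ = T / N → τ ≤ τmax →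
      ∀ (Eτ : ℕ → ColeCole.H0curl (ColeCole.rect a b c d))
        (Pτ : ℕ → ColeCole.L2V (ColeCole.rect a b c d))
        (Hτ : ℕ → ColeCole.L2S (ColeCole.rect a b c d)),
        ColeCole.IsSchemeSolution M θ τ N f₁ f₂ f₃ (E 0) (P 0) (ColeCole.funcS (H 0)) Eτ Pτ Hτ →
        ∀ n : ℕ, 1 ≤ n → n ≤ N →
          ‖ColeCole.fieldV (E (n * τ)) - ColeCole.fieldV (Eτ n)‖ + ‖P (n * τ) - Pτ n‖
            + ‖ColeCole.funcS (H (n * τ)) - Hτ n‖ ≤ C * τ ^ ColeCole.order θ := by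
  obtain ⟨e, e₁, e₂, e₃, he, hee⟩ := exists_isC3_extension hT hE3
  obtain ⟨p, p₁, p₂, p₃, hp, hpp⟩ := exists_isC3_extension hT hP3
  -- Regularity of `H` in the graph norm makes its curl a `C³` curve in `L²`, hence the averaging
  -- error of the curl is `O(τ²)`.
  obtain ⟨k, k₁, k₂, k₃, hk, hkk⟩ := exists_isC3_extension hT (contDiffOn_curlH hH3)
  obtain ⟨h, h₁, h₂, h₃, hh, hhh⟩ := exists_isC3_extension hT (contDiffOn_funcS hH3)
  have h0T : (0 : ℝ) ∈ Icc 0 T := ⟨le_rfl, hT.le⟩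
  have hp0 : p 0 = 0 := (hpp h0T).trans hsol.init
  have hκ : 0 < M.τ₀ ^ M.α := Real.rpow_pos_of_pos M.τ₀_pos _
  have hpol : ∀ t ∈ Ioo 0 T,
      M.τ₀ ^ M.α • caputo M.α p t + p t = (M.ε₀ * (M.εs - M.εinf)) • e t + f₃ t := by
    intro t ht
    have ht' := Ioo_subset_Icc_self ht
    rw [← hp.caputo_congr hpp ht, hpp ht', hee ht']
    exact hsol.polarization t ht
  have hp₁0 : θ = 1 / 2 → p₁ 0 = 0 := by
    intro hθ2
    refine hp.deriv_zero_of_polarization (c := M.ε₀ * (M.εs - M.εinf)) M.α_pos M.α_lt_one hT hκ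
      (hE3.of_le (by norm_num)) (hf₃ hθ2) fun t ht => ?_
    rw [hpol t ht, hee (Ioo_subset_Icc_self ht)]
  obtain ⟨C, hC, hconv⟩ := scheme_convergence (mul_pos M.ε₀_pos M.εinf_pos) M.μ₀_pos
    (mul_pos M.ε₀_pos (sub_pos.2 M.εinf_lt_εs)) hκ.le M.α_pos M.α_lt_one hθ hT
    (fieldVₗ _) (curlEₗ _) (E := E) (f₁ := f₁) (f₂ := f₂) he hp hk hh (fun t ht => (hee ht).symm)
    -- Green's formula for `H(t)` and `χ` is exactly the vanishing of the tangential trace in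
    -- `H0curl`.
    (fun t ht χ => by
      rw [hhh ht, hkk ht, real_inner_comm, real_inner_comm _ (curlH (H t))]
      exact χ.2.2 (H t) (H t).2)
    (fun t ht => by
      rw [← he.deriv_eq hee ht, ← hp.deriv_eq hpp ht, hkk (Ioo_subset_Icc_self ht)]
      exact hsol.ampere t ht)
    (fun t ht => by
      rw [← hh.deriv_eq hhh ht]
      exact hsol.faraday t ht)
    hpol hp0 hp₁0
  -- The bound from `scheme_convergence` holds for every `τ = T / N`, so the threshold `1` is an
  -- arbitrary choice.
  refine ⟨C, hC, 1, one_pos, fun N τ hN hτ _ Eτ Pτ Hτ hs n _ hnN => ?_⟩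
  have hb := hconv N τ hN hτ Eτ Pτ Hτ hs.initE (hs.initP.trans hsol.init)
    (hs.initH.trans (hhh h0T).symm) hs.ampere hs.faraday hs.polarization n hnN
  have hmem : (n : ℝ) * τ ∈ Icc 0 T := by
    have hN0 : (0 : ℝ) < N := by exact_mod_cast hN
    have hnN' : (n : ℝ) ≤ N := by exact_mod_cast hnN
    rw [hτ]
    refine ⟨by positivity, ?_⟩
    calc (n : ℝ) * (T / N) ≤ N * (T / N) := by gcongr
      _ = T := by field_simp
  rw [hee hmem, hpp hmem, hhh hmem] at hb
  exact hb
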